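/- Let $M$ be an oriented smooth $5$-manifold. On $T\oplus T^*$ use the inner product with $(X+\xi,X+\xi)=i_X\xi$, the Clifford action $(X+\xi)\cdot\varphi=i_X\varphi+\xi\wedge\varphi$ on differential forms, and the Courant bracket $$[X+\xi,Y+\eta]=[X,Y]+\mathcal L_X\eta-\mathcal L_Y\xi-\tfrac12 d(i_X\eta-i_Y\xi).$$ For an odd form $\psi$ and an even form $\varphi$ on $M$ put $\langle\psi,\varphi\rangle=\psi_1\wedge\varphi_4-\psi_3\wedge\varphi_2+\psi_5\wedge\varphi_0\in\Lambda^5T^*$, and for even forms $\alpha,\beta$ define $P(\alpha,\beta)\in(T\oplus T^*)\otimes\Lambda^5T^*$ by $(P(\alpha,\beta),e)=\langle e\cdot\alpha,\beta\rangle$ for all $e\in T\oplus T^*$; write $Q(\alpha)=P(\alpha,\alpha)$. For a pair $\rho=(\rho_1,\rho_2)$ of even forms let $f(\rho)=(Q(\rho_1),Q(\rho_2))\in(\Lambda^5T^*)^2$. Suppose that $\rho$ lies in an open orbit of $Spin(5,5)\times GL(2,\mathbf R)$ at each point, i.e. that $f(\rho)$ vanishes nowhere, and that $f(\rho)$ has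 constant sign; let $\sigma=1$ if $f(\rho)<0$ and $\sigma=-1$ if $f(\rho)>0$. Let $\phi=|f(\rho)|^{1/2}$ be the associated positive volume form, define sections $v_1,h,v_2$ of $T\oplus T^*$ by $$P(\rho_1,\rho_1)=\phi\otimes v_1,\qquad P(\rho_1,\rho_2)=\phi\otimes h,\qquad P(\rho_2,\rho_2)=\phi\otimes v_2,$$ and let $\hat\rho=(\hat\rho_1,\hat\rho_2)$ be the pair of odd forms with $D\phi_\rho(\tau)=\langle\hat\rho_2,\tau_1\rangle-\langle\hat\rho_1,\tau_2\rangle$ for all pairs $\tau$ of even forms. (The inner product restricted to the span of $v_1,h,v_2$ has signature $(2,1)$ if $\sigma=1$ and $(1,2)$ if $\sigma=-1$.) Let $J\subseteq\mathbf R$ be open (for instance $J=\mathbf R$) and let $\rho(t)$, $t\in J$, be a smooth family of such pairs, of constant $\sigma$, with $d\rho(t)=0$, which satisfies the Hamiltonian flow equation $$\frac{\partial\rho}{\partial t}=d\hat\rho .$$ Then: (i) there is a function $\lambda$ on $J\times M$ such that the Nahm-type equations $$v_1'=-2\sigma[h,v_1]+\lambda v_1,\qquad h'=\sigma[v_1,v_2]+\lambda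 h,\qquad v_2'=2\sigma[h,v_2]+\lambda v_2$$ hold, where $'=\partial/\partial t$ and the brackets are Courant brackets on $M$ at fixed $t$; (ii) for each real $z\neq0$ put $$v(z)=v_1+2zh+z^2v_2,\qquad u(z)=\sigma(z^{-1}v_1-zv_2),\qquad w(z)=\frac{\partial}{\partial t}-2\sigma\,dt-u(z),$$ sections of $T\oplus T^*$ over the $6$-manifold $J\times M$. Then $v(z)$ and $w(z)$ are smooth, they span a subbundle $E_z\subset T\oplus T^*$ of rank $2$, this subbundle is isotropic, and it is Courant-integrable: the Courant bracket on $J\times M$ of any two (local) smooth sections of $E_z$ is a section of $E_z$; (iii) the same holds for $z=0$ and $z=\infty$, where $E_0$ is spanned by $v_1$ and $\frac{\partial}{\partial t}-2\sigma\,dt+2\sigma h$, and $E_\infty$ by $v_2$ and $\frac{\partial}{\partial t}-2\sigma\,dt-2\sigma h$. -/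

import Mathlib

open scoped Manifold ContDiff Topology

noncomputable section

namespace GenGeom

/-! ### Linear algebra of `V ⊕ V*` and of forms as spinors -/

section Algebra

variable {V : Type*} [NormedAddCommGroup V] [NormedSpace ℝ V]

/-- The space `V ⊕ V*`; an element `X + ξ` is the pair `(X, ξ)`. -/
abbrev GenVec (V : Type*) [NormedAddCommGroup V] [NormedSpace ℝ V] : Type _ :=
  V × (V →L[ℝ] ℝ)

/-- The inner product of `V ⊕ V*`, normalized by `(X + ξ, X + ξ) = ξ(X)`. -/
def pairing (a b : GenVec V) : ℝ := (a.2 b.1 + b.2 a.1) / 2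

/-- Forms of mixed degree on `V`: the component of degree `k` is the value at `k`. -/
abbrev MixedForm (V : Type*) [NormedAddCommGroup V] [NormedSpace ℝ V] : Type _ :=
  ∀ k : ℕ, V [⋀^Fin k]→L[ℝ] ℝ

/-- A form with components in even degrees only. -/
def IsEven (φ : MixedForm V) : Prop := ∀ k, Odd k → φ k = 0

/-- A form with components in odd degrees only. -/
def IsOdd (φ : MixedForm V) : Prop := ∀ k, Even k → φ k = 0

/-- The exterior product `ξ ∧ α` of a `1`-form and a `k`-form:
`(ξ ∧ α)(v₀, …, v_k) = ∑ i, (-1)^i ξ(v_i) α(v₀, …, v̂_i, …, v_k)`. -/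
def wedgeOne {k : ℕ} (ξ : V →L[ℝ] ℝ) (α : V [⋀^Fin k]→L[ℝ] ℝ) : V [⋀^Fin (k + 1)]→L[ℝ] ℝ :=
  ContinuousAlternatingMap.alternatizeUncurryFin (ξ.smulRight α)

/-- The Clifford action `(X + ξ) · φ = i_X φ + ξ ∧ φ`. -/
def clifford (a : GenVec V) (φ : MixedForm V) : MixedForm V
  | 0 => (φ 1).curryLeft a.1
  | k + 1 => (φ (k + 2)).curryLeft a.1 + wedgeOne a.2 (φ k)

/-- The exterior product of a `p`-form and a `q`-form, evaluated on `p + q` vectors. -/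
def wedge {p q : ℕ} (α : V [⋀^Fin p]→L[ℝ] ℝ) (β : V [⋀^Fin q]→L[ℝ] ℝ) (w : Fin (p + q) → V) : ℝ :=
  ((p.factorial : ℝ) * (q.factorial : ℝ))⁻¹ *
    ∑ s : Equiv.Perm (Fin (p + q)), ((Equiv.Perm.sign s : ℤ) : ℝ) *
      (α (fun i => w (s (Fin.castAdd q i))) * β (fun j => w (s (Fin.natAdd p j))))

/-- The Mukai pairing `⟨ψ, φ⟩ = ψ₁ ∧ φ₄ - ψ₃ ∧ φ₂ + ψ₅ ∧ φ₀` in dimension five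
(`ψ` odd, `φ` even), a `5`-form, evaluated on five vectors. -/
def mukai (ψ φ : MixedForm V) (w : Fin 5 → V) : ℝ :=
  wedge (p := 1) (q := 4) (ψ 1) (φ 4) w - wedge (p := 3) (q := 2) (ψ 3) (φ 2) w
    + wedge (p := 5) (q := 0) (ψ 5) (φ 0) w

lemma clifford_add (a b : GenVec V) (φ : MixedForm V) (k : ℕ) :
    clifford (a + b) φ k = clifford a φ k + clifford b φ k := by
  cases k with
  | zero => simp [clifford]
  | succ k =>
    have h : wedgeOne (a.2 + b.2) (φ k) = wedgeOne a.2 (φ k) + wedgeOne b.2 (φ k) := by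
      have h0 : (a.2 + b.2).smulRight (φ k) = a.2.smulRight (φ k) + b.2.smulRight (φ k) := by
        ext v; simp [add_mul]
      simp only [wedgeOne, h0, ContinuousAlternatingMap.alternatizeUncurryFin_add]
    simp only [clifford, Prod.fst_add, Prod.snd_add, map_add, h]
    abel

lemma clifford_smul (c : ℝ) (a : GenVec V) (φ : MixedForm V) (k : ℕ) :
    clifford (c • a) φ k = c • clifford a φ k := by
  cases k with
  | zero => simp [clifford]
  | succ k =>
    have h : wedgeOne (c • a.2) (φ k) = c • wedgeOne a.2 (φ k) := by
      have h0 : (c • a.2).smulRight (φ k) = c • a.2.smulRight (φ k) := by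
        ext v; simp [mul_assoc]
      simp only [wedgeOne, h0, ContinuousAlternatingMap.alternatizeUncurryFin_smul]
    simp only [clifford, Prod.smul_fst, Prod.smul_snd, map_smul, h, smul_add]

lemma wedge_add_left {p q : ℕ} (α α' : V [⋀^Fin p]→L[ℝ] ℝ) (β : V [⋀^Fin q]→L[ℝ] ℝ)
    (w : Fin (p + q) → V) : wedge (α + α') β w = wedge α β w + wedge α' β w := by
  simp only [wedge, ContinuousAlternatingMap.add_apply, add_mul, mul_add, Finset.sum_add_distrib]

lemma wedge_smul_left {p q : ℕ} (c : ℝ) (α : V [⋀^Fin p]→L[ℝ] ℝ) (β : V [⋀^Fin q]→L[ℝ] ℝ)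
    (w : Fin (p + q) → V) : wedge (c • α) β w = c * wedge α β w := by
  simp only [wedge, ContinuousAlternatingMap.smul_apply, smul_eq_mul, Finset.mul_sum]
  refine Finset.sum_congr rfl fun s _ => ?_
  ring

/-- The linear functional `e ↦ ⟨e · α, β⟩` on `V ⊕ V*`, evaluated on five vectors. -/
def mukaiFunctional (α β : MixedForm V) (w : Fin 5 → V) : GenVec V →ₗ[ℝ] ℝ where
  toFun e := mukai (clifford e α) β w
  map_add' a b := by
    simp only [mukai, clifford_add, wedge_add_left]; ring
  map_smul' c a := by
    simp only [mukai, clifford_smul, wedge_smul_left, smul_eq_mul, RingHom.id_apply]; ring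

end Algebra

/-! ### The invariant quartic and the associated sections in dimension five -/

section DimensionFive

/-- The model space of a five-manifold. -/
abbrev V5 : Type := EuclideanSpace ℝ (Fin 5)

/-- The standard basis of `V5`. Two `5`-forms are compared through their values on it. -/
def e5 (i : Fin 5) : V5 := EuclideanSpace.single i 1

/-- For a nonzero `5`-form `ν`, the element `P` of `V ⊕ V*` such that
`(P, e) ν = ⟨e · α, β⟩` for all `e ∈ V ⊕ V*`, i.e. `P(α, β) = ν ⊗ P`
(see `pairing_bilin`). -/
def bilin (ν : V5 [⋀^Fin 5]→L[ℝ] ℝ) (α β : MixedForm V5) : GenVec V5 :=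
  (∑ i, (2 * (mukaiFunctional α β e5 (0, EuclideanSpace.proj i) / ν e5)) • e5 i,
   ∑ i, (2 * (mukaiFunctional α β e5 (e5 i, 0) / ν e5)) • EuclideanSpace.proj i)

lemma pairing_bilin (ν : V5 [⋀^Fin 5]→L[ℝ] ℝ) (hν : ν e5 ≠ 0) (α β : MixedForm V5)
    (e : GenVec V5) : pairing (bilin ν α β) e * ν e5 = mukai (clifford e α) β e5 := by
  have hX : e.1 = ∑ i, e.1 i • e5 i := by
    ext j; simp [e5, Finset.sum_apply, Pi.single_apply]
  have hξ : e.2 = ∑ i, e.2 (e5 i) • (EuclideanSpace.proj i : V5 →L[ℝ] ℝ) := by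
    ext y
    have hy : y = ∑ i, y i • e5 i := by
      ext j; simp [e5, Finset.sum_apply, Pi.single_apply]
    conv_lhs => rw [hy]
    simp [map_sum, mul_comm]
  have he : e = ∑ i, e.1 i • ((e5 i, 0) : GenVec V5)
      + ∑ i, e.2 (e5 i) • ((0, EuclideanSpace.proj i) : GenVec V5) := by
    refine Prod.ext ?_ ?_
    · simpa [Prod.fst_sum] using hX
    · simpa [Prod.snd_sum] using hξ
  have hL : mukai (clifford e α) β e5 = mukaiFunctional α β e5 e := rfl
  rw [hL]
  conv_rhs => rw [he]
  simp only [map_add, map_sum, map_smul, smul_eq_mul, pairing, bilin,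
    sum_apply, smul_apply]
  rw [add_div, add_mul, Finset.sum_div, Finset.sum_div, Finset.sum_mul, Finset.sum_mul]
  congr 1
  · refine Finset.sum_congr rfl fun i _ => ?_
    field_simp
    rfl
  · refine Finset.sum_congr rfl fun i _ => ?_
    field_simp

/-- The invariant quartic `f(ρ) = (Q(ρ₁), Q(ρ₂))`, `Q(φ) = P(φ, φ)`, of a pair of even forms.
It takes values in the square of the space of `5`-forms; this is its coefficient with respect
to `ν²`. -/
def quartic (ν : V5 [⋀^Fin 5]→L[ℝ] ℝ) (ρ : Fin 2 → MixedForm V5) : ℝ :=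
  pairing (bilin ν (ρ 0) (ρ 0)) (bilin ν (ρ 1) (ρ 1))

/-- The volume form `φ(ρ) = |f(ρ)|^{1/2}`, positive for the orientation given by `μ`. -/
def volForm (μ : V5 [⋀^Fin 5]→L[ℝ] ℝ) (ρ : Fin 2 → MixedForm V5) : V5 [⋀^Fin 5]→L[ℝ] ℝ :=
  √|quartic μ ρ| • μ

/-- `v₁`, where `P(ρ₁, ρ₁) = φ ⊗ v₁`. -/
def vOne (μ : V5 [⋀^Fin 5]→L[ℝ] ℝ) (ρ : Fin 2 → MixedForm V5) : GenVec V5 :=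
  bilin (volForm μ ρ) (ρ 0) (ρ 0)

/-- `h`, where `P(ρ₁, ρ₂) = φ ⊗ h`. -/
def hMid (μ : V5 [⋀^Fin 5]→L[ℝ] ℝ) (ρ : Fin 2 → MixedForm V5) : GenVec V5 :=
  bilin (volForm μ ρ) (ρ 0) (ρ 1)

/-- `v₂`, where `P(ρ₂, ρ₂) = φ ⊗ v₂`. -/
def vTwo (μ : V5 [⋀^Fin 5]→L[ℝ] ℝ) (ρ : Fin 2 → MixedForm V5) : GenVec V5 :=
  bilin (volForm μ ρ) (ρ 1) (ρ 1)

/-- `ρ̂` is the odd `ℝ²`-valued form which represents the derivative of `φ` at `ρ`: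
`Dφ(τ) = ⟨ρ̂₂, τ₁⟩ - ⟨ρ̂₁, τ₂⟩` for every even `ℝ²`-valued form `τ`
(Mukai pairing on forms combined with the skew form on `ℝ²`). -/
def IsHat (μ : V5 [⋀^Fin 5]→L[ℝ] ℝ) (ρ ρhat : Fin 2 → MixedForm V5) : Prop :=
  (∀ i, IsOdd (ρhat i)) ∧
    ∀ τ : Fin 2 → MixedForm V5, (∀ i, IsEven (τ i)) → ∀ w : Fin 5 → V5,
      HasDerivAt (fun s : ℝ => volForm μ (fun i k => ρ i k + s • τ i k) w)
        (mukai (ρhat 1) (τ 0) w - mukai (ρhat 0) (τ 1) w) 0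

end DimensionFive

/-! ### Forms and sections of `T ⊕ T*` on manifolds

The tangent space `TangentSpace I x` of a manifold modelled on `E` is, by definition, `E`;
a `k`-form is therefore given by its values in `E [⋀^Fin k]→L[ℝ] ℝ`, and a section of
`T ⊕ T*` by its values in `GenVec E`. -/

section Manifold

variable {E : Type*} [NormedAddCommGroup E] [NormedSpace ℝ E] {H : Type*} [TopologicalSpace H]
  (I : ModelWithCorners ℝ E H) {M : Type*} [TopologicalSpace M] [ChartedSpace H M]

/-- A `k`-form read in the chart at `x₀` (its pullback under the inverse chart). -/
def inChart {k : ℕ} (x₀ : M) (α : M → E [⋀^Fin k]→L[ℝ] ℝ) (y : E) : E [⋀^Fin k]→L[ℝ] ℝ :=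
  (α ((extChartAt I x₀).symm y)).compContinuousLinearMap
    (mfderivWithin 𝓘(ℝ, E) I (extChartAt I x₀).symm (Set.range I) y : E →L[ℝ] E)

/-- The exterior derivative of a `k`-form, computed at `x` in the chart at `x`. -/
def extD {k : ℕ} (α : M → E [⋀^Fin k]→L[ℝ] ℝ) (x : M) : E [⋀^Fin (k + 1)]→L[ℝ] ℝ :=
  (extDerivWithin (inChart I x α) (Set.range I) (extChartAt I x x)).compContinuousLinearMap
    (mfderiv I 𝓘(ℝ, E) (extChartAt I x) x : E →L[ℝ] E)

/-- The exterior derivative of a form of mixed degree. -/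
def mixedD (α : M → MixedForm E) (x : M) : MixedForm E
  | 0 => 0
  | k + 1 => extD I (fun y => α y k) x

/-- A `k`-form is smooth on `U` if it is so in all charts. -/
def IsSmoothFormOn {k : ℕ} (α : M → E [⋀^Fin k]→L[ℝ] ℝ) (U : Set M) : Prop :=
  ∀ x₀ : M, ContDiffOn ℝ ∞ (inChart I x₀ α)
    ((extChartAt I x₀).target ∩ (extChartAt I x₀).symm ⁻¹' U)

/-- A family of forms, smooth in the parameter `t ∈ J` and the point of `M` jointly. -/
def IsSmoothFamilyOn (J : Set ℝ) (α : ℝ → M → MixedForm E) : Prop :=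
  ∀ (k : ℕ) (x₀ : M), ContDiffOn ℝ ∞
    (fun p : ℝ × E => inChart I x₀ (fun x => α p.1 x k) p.2) (J ×ˢ (extChartAt I x₀).target)

/-- A field of covectors as a `1`-form. -/
def asForm (ξ : M → E →L[ℝ] ℝ) (x : M) : E [⋀^Fin 1]→L[ℝ] ℝ :=
  ContinuousAlternatingMap.ofSubsingleton ℝ E ℝ (0 : Fin 1) (ξ x)

/-- The differential of a function. -/
def dFun (g : M → ℝ) (x : M) : E →L[ℝ] ℝ := mfderiv I 𝓘(ℝ, ℝ) g x

/-- The Lie derivative `L_X η = i_X dη + d (i_X η)` of a `1`-form. -/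
def lieDeriv (X : M → E) (η : M → E →L[ℝ] ℝ) (x : M) : E →L[ℝ] ℝ :=
  (ContinuousAlternatingMap.ofSubsingleton ℝ E ℝ (0 : Fin 1)).symm
    ((extD I (asForm η) x).curryLeft (X x)) + dFun I (fun y => η y (X y)) x

/-- The Courant bracket
`[X + ξ, Y + η] = [X, Y] + L_X η - L_Y ξ - (1/2) d (i_X η - i_Y ξ)`. -/
def courant (a b : M → GenVec E) (x : M) : GenVec E :=
  (VectorField.mlieBracket I (fun y => ((a y).1 : TangentSpace I y))
      (fun y => ((b y).1 : TangentSpace I y)) x,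
    lieDeriv I (fun y => (a y).1) (fun y => (b y).2) x
      - lieDeriv I (fun y => (b y).1) (fun y => (a y).2) x
      - (1 / 2 : ℝ) • dFun I (fun y => (b y).2 (a y).1 - (a y).2 (b y).1) x)

/-- Smoothness of a section of `T ⊕ T*` on a set. -/
def IsSmoothSectionOn [IsManifold I ∞ M] (a : M → GenVec E) (U : Set M) : Prop :=
  ContMDiffOn I I.tangent ∞ (fun x => (⟨x, (a x).1⟩ : TangentBundle I M)) U ∧
    IsSmoothFormOn I (asForm fun x => (a x).2) U

/-- The distribution `D` of subspaces of `T ⊕ T*` is isotropic on `W`. -/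
def IsIsotropicOn (D : M → Submodule ℝ (GenVec E)) (W : Set M) : Prop :=
  ∀ x ∈ W, ∀ a ∈ D x, ∀ b ∈ D x, pairing a b = 0

/-- The distribution `D` is Courant-integrable on `W`: the Courant bracket of any two smooth
(local) sections of `D` is a section of `D`. -/
def IsCourantIntegrableOn [IsManifold I ∞ M] (D : M → Submodule ℝ (GenVec E)) (W : Set M) : Prop :=
  ∀ U : Set M, IsOpen U → U ⊆ W → ∀ a b : M → GenVec E,
    IsSmoothSectionOn I a U → IsSmoothSectionOn I b U →
    (∀ x ∈ U, a x ∈ D x) → (∀ x ∈ U, b x ∈ D x) → ∀ x ∈ U, courant I a b x ∈ D x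

/-- On `W`, the smooth sections `v`, `w` of `T ⊕ T*` span a subbundle of rank two
which is isotropic and Courant-integrable. -/
structure SpanIsotropicIntegrable [IsManifold I ∞ M] (v w : M → GenVec E) (W : Set M) : Prop where
  smooth_left : IsSmoothSectionOn I v W
  smooth_right : IsSmoothSectionOn I w W
  rank_two : ∀ x ∈ W, LinearIndependent ℝ ![v x, w x]
  isotropic : IsIsotropicOn (fun x => Submodule.span ℝ {v x, w x}) W
  integrable : IsCourantIntegrableOn I (fun x => Submodule.span ℝ {v x, w x}) W

end Manifold

/-! ### The product `ℝ × M` -/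

section Product

variable {E : Type*} [NormedAddCommGroup E] [NormedSpace ℝ E] {M : Type*}

/-- A time-dependent section of `T ⊕ T*` on `M`, as a section of `T ⊕ T*` on `ℝ × M`.
The tangent space of `ℝ × M` at a point is `ℝ × E`. -/
def lift (a : ℝ → M → GenVec E) (p : ℝ × M) : GenVec (ℝ × E) :=
  ((0, (a p.1 p.2).1), (a p.1 p.2).2.comp (ContinuousLinearMap.snd ℝ ℝ E))

/-- The section `∂/∂t + c dt` on `ℝ × M`. -/
def timeSection (c : ℝ) (_p : ℝ × M) : GenVec (ℝ × E) :=
  ((1, 0), c • ContinuousLinearMap.fst ℝ ℝ E)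

end Product

end GenGeom

end

/-!
The theorem is an identity between 1-jets at a point of `M`, which comes from spinor algebra in
dimension five, followed by a Lax pair argument on `ℝ × M`.

*Algebra.* An even form `α` on a five-dimensional space is a half-spinor, and the vector `Q(α)`
satisfies the cubic identity `Q(α) · α = 0` (`clifford_quad_self`). Its polarization gives
`v₁ · ρ₁ = 0`, `v₂ · ρ₂ = 0`, `v₁ · ρ₂ = -2 h · ρ₁` and `v₂ · ρ₁ = -2 h · ρ₂`. With the symmetry of
the Clifford action for the Mukai pairing and the normalization of `φ`, these determine all inner
products of `v₁`, `h`, `v₂` (`relations`). Differentiating `φ = |f(ρ)|^{1/2}` and using that the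
pairing is nondegenerate, one finds `ρ̂₁ = -2σ h · ρ₁` and `ρ̂₂ = 2σ h · ρ₂` (`IsHat.eq`). For a
closed form, `d(a · α)` is the Lie derivative `L_a α` along the section `a` of `T ⊕ T*`, so the flow
equation reads `ρ₁' = -2σ L_h ρ₁`, `ρ₂' = 2σ L_h ρ₂`.

*Nahm-type equations.* The Lie derivative satisfies a Leibniz rule for `P`, in which vectors are
differentiated by the Dorfman bracket and `φ` by a divergence (`mukai_lieJet`). On sections with
constant inner product the Dorfman bracket is the Courant bracket. Since `v₁ · ρ₁ = 0` and
`[v₁, v₁] = 0`, the divergence of `φ ⊗ v₁` vanishes; the same holds for `φ ⊗ v₂` and, by the same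
argument for `ρ₁ + ρ₂`, for `φ ⊗ h` (`divergence_eq_zero`). Differentiating the equations that
define `v₁`, `h`, `v₂` in time now gives the Nahm-type equations, with `λ = -φ'/φ` (`nahm_jet`).
These are equations between 1-jets; they are applied at each point of `M` in the chart at that
point, where the forms and sections are given by the same expressions (`bilin_volForm_pull`) and
the brackets and exterior derivatives by their 1-jets (`courant_eq`, `mixedD_eq_dirac`); the result
is `nahm_of_flow`.

*Integrability.* The Nahm-type equations give the Lax equation `v(z)' = [u(z), v(z)] + λ v(z)` for
all `z`. By the inner products, `v(z)` is null, orthogonal to `u(z)`, and `(u(z), u(z)) = 2σ`, so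
that `v(z)` and `w(z) = ∂/∂t - 2σ dt - u(z)` span an isotropic plane field, and the Lax equation
says that `[w(z), v(z)] = λ v(z)` on `ℝ × M` (`courantJet_time_sub_lift`). On an isotropic plane
field the Courant bracket obeys the Leibniz rule, so this one bracket decides integrability
(`courantJet_mem`, `spanIsotropicIntegrable_of_lax`).
-/

open scoped Manifold ContDiff Topology

noncomputable section

namespace GenGeom

/-! ### The Clifford action on forms -/

section Clifford
variable {V : Type*} [NormedAddCommGroup V] [NormedSpace ℝ V]

lemma wedgeOne_apply {k : ℕ} (ξ : V →L[ℝ] ℝ) (α : V [⋀^Fin k]→L[ℝ] ℝ) (v : Fin (k + 1) → V) :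
    wedgeOne ξ α v = ∑ i : Fin (k + 1), (-1) ^ (i : ℕ) * (ξ (v i) * α (i.removeNth v)) := by
  simp [wedgeOne, ContinuousAlternatingMap.alternatizeUncurryFin_apply]

lemma curryLeft_wedgeOne_zero (ξ : V →L[ℝ] ℝ) (α : V [⋀^Fin 0]→L[ℝ] ℝ) (X : V) :
    (wedgeOne ξ α).curryLeft X = ξ X • α := by
  ext v
  simp [wedgeOne_apply]

lemma removeNth_succ_vecCons {α : Type*} {k : ℕ} (i : Fin (k + 1)) (X : α) (v : Fin (k + 1) → α) :
    i.succ.removeNth (Matrix.vecCons X v : Fin (k + 2) → α) = Matrix.vecCons X (i.removeNth v) := by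
  funext j
  refine Fin.cases ?_ (fun j => ?_) j
  · simp [Fin.removeNth]
  · simp [Fin.removeNth, Fin.succ_succAbove_succ]

/-- Contraction with a vector is an antiderivation: `i_X (ξ ∧ α) = ξ(X) α - ξ ∧ i_X α`. In degree
zero, where the last term is absent, this is `curryLeft_wedgeOne_zero`. -/
lemma curryLeft_wedgeOne {k : ℕ} (ξ : V →L[ℝ] ℝ) (α : V [⋀^Fin (k + 1)]→L[ℝ] ℝ) (X : V) :
    (wedgeOne ξ α).curryLeft X = ξ X • α - wedgeOne ξ (α.curryLeft X) := by
  ext v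
  simp [wedgeOne_apply, Fin.sum_univ_succ (n := k + 1), pow_succ, Finset.sum_neg_distrib,
    sub_eq_add_neg, removeNth_succ_vecCons]

lemma wedgeOne_wedgeOne_self {k : ℕ} (ξ : V →L[ℝ] ℝ) (α : V [⋀^Fin k]→L[ℝ] ℝ) :
    wedgeOne ξ (wedgeOne ξ α) = 0 := by
  have h := ContinuousAlternatingMap.alternatizeUncurryFin_alternatizeUncurryFinCLM_comp_of_symmetric
    (f := ξ.smulRight (ξ.smulRight α)) (by intro x y; ext v; simp; ring)
  rw [← h]
  unfold wedgeOne
  congr 1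
  ext x v
  simp

lemma wedgeOne_add_right {k : ℕ} (ξ : V →L[ℝ] ℝ) (α β : V [⋀^Fin k]→L[ℝ] ℝ) :
    wedgeOne ξ (α + β) = wedgeOne ξ α + wedgeOne ξ β := by
  ext v; simp [wedgeOne_apply, mul_add, Finset.sum_add_distrib]

lemma wedgeOne_smul_right {k : ℕ} (ξ : V →L[ℝ] ℝ) (c : ℝ) (α : V [⋀^Fin k]→L[ℝ] ℝ) :
    wedgeOne ξ (c • α) = c • wedgeOne ξ α := by
  ext v; simp [wedgeOne_apply, Finset.mul_sum]; refine Finset.sum_congr rfl fun i _ => ?_; ring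

lemma wedgeOne_zero_right {k : ℕ} (ξ : V →L[ℝ] ℝ) :
    wedgeOne ξ (0 : V [⋀^Fin k]→L[ℝ] ℝ) = 0 := by
  ext v; simp [wedgeOne_apply]

lemma clifford_add_left (a b : GenVec V) (φ : MixedForm V) :
    clifford (a + b) φ = clifford a φ + clifford b φ := funext (clifford_add a b φ)

lemma clifford_smul_left (c : ℝ) (a : GenVec V) (φ : MixedForm V) :
    clifford (c • a) φ = c • clifford a φ := funext (clifford_smul c a φ)

lemma clifford_add_right (a : GenVec V) (φ ψ : MixedForm V) :
    clifford a (φ + ψ) = clifford a φ + clifford a ψ := by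
  funext k
  cases k with
  | zero => simp [clifford]
  | succ k => simp [clifford, wedgeOne_add_right]; abel

lemma clifford_smul_right (c : ℝ) (a : GenVec V) (φ : MixedForm V) :
    clifford a (c • φ) = c • clifford a φ := by
  funext k
  cases k with
  | zero => simp [clifford]
  | succ k => simp [clifford, wedgeOne_smul_right]

/-- The Clifford action as a bilinear map. -/
def cliffordₗ : GenVec V →ₗ[ℝ] MixedForm V →ₗ[ℝ] MixedForm V :=
  LinearMap.mk₂ ℝ clifford clifford_add_left clifford_smul_left clifford_add_right
    fun c a φ => clifford_smul_right c a φ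

@[simp] lemma cliffordₗ_apply (a : GenVec V) (φ : MixedForm V) : cliffordₗ a φ = clifford a φ := rfl

/-- The square of the Clifford action of `a` is the scalar `(a, a)`. -/
lemma clifford_clifford_self (a : GenVec V) (φ : MixedForm V) :
    clifford a (clifford a φ) = pairing a a • φ := by
  have hp : pairing a a = a.2 a.1 := by unfold pairing; ring
  rw [hp]
  funext k
  match k with
  | 0 => simp [clifford, curryLeft_wedgeOne_zero]
  | 1 =>
    simp only [clifford, ContinuousAlternatingMap.curryLeft_add, add_apply,
      ContinuousAlternatingMap.curryLeft_same, curryLeft_wedgeOne]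
    simp
  | k + 2 =>
    simp only [clifford, ContinuousAlternatingMap.curryLeft_add, add_apply,
      ContinuousAlternatingMap.curryLeft_same, curryLeft_wedgeOne, wedgeOne_add_right,
      wedgeOne_wedgeOne_self]
    simp

lemma clifford_zero_right (a : GenVec V) : clifford a (0 : MixedForm V) = 0 :=
  map_zero (cliffordₗ a)

/-- The Clifford relation `a b + b a = 2 (a, b)`. -/
lemma clifford_clifford_add (a b : GenVec V) (φ : MixedForm V) :
    clifford a (clifford b φ) + clifford b (clifford a φ) = (2 * pairing a b) • φ := by
  have h := clifford_clifford_self (a + b) φ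
  simp only [clifford_add_left, clifford_add_right, clifford_clifford_self] at h
  have hp : pairing (a + b) (a + b) = pairing a a + 2 * pairing a b + pairing b b := by
    simp [pairing]; ring
  rw [hp, add_smul, add_smul] at h
  have h' : (pairing a a • φ + pairing b b • φ) +
      (clifford a (clifford b φ) + clifford b (clifford a φ)) =
      (pairing a a • φ + pairing b b • φ) + (2 * pairing a b) • φ := by
    rw [← sub_eq_zero] at h ⊢
    rw [← h]
    abel
  exact add_left_cancel h'

lemma IsEven.clifford {φ : MixedForm V} (h : IsEven φ) (a : GenVec V) :
    IsOdd (clifford a φ) := by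
  intro k hk
  match k with
  | 0 => simp [GenGeom.clifford, h 1 (by decide)]
  | k + 1 =>
    have h1 : Odd k := by rcases hk with ⟨m, hm⟩; exact ⟨m - 1, by omega⟩
    have h2 : Odd (k + 2) := by rcases h1 with ⟨m, hm⟩; exact ⟨m + 1, by omega⟩
    simp [GenGeom.clifford, h _ h1, h _ h2, wedgeOne_zero_right]

lemma IsOdd.clifford {φ : MixedForm V} (h : IsOdd φ) (a : GenVec V) :
    IsEven (clifford a φ) := by
  intro k hk
  match k with
  | 0 => exact absurd hk (by decide)
  | k + 1 =>
    have h1 : Even k := by rcases hk with ⟨m, hm⟩; exact ⟨m, by omega⟩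
    have h2 : Even (k + 2) := by rcases h1 with ⟨m, hm⟩; exact ⟨m + 1, by omega⟩
    simp [GenGeom.clifford, h _ h1, h _ h2, wedgeOne_zero_right]

end Clifford

/-! ### Signed sums over permutations -/

/-- A signed sum over permutations, expanded along the value at the first index. -/
lemma sum_sign_mul_perm_succ {n : ℕ} (G : Equiv.Perm (Fin (n + 1)) → ℝ) :
    ∑ s, ((Equiv.Perm.sign s : ℤ) : ℝ) * G s = ∑ p : Fin (n + 1), (if p = 0 then (1 : ℝ) else -1) *
      ∑ σ : Equiv.Perm (Fin n), ((Equiv.Perm.sign σ : ℤ) : ℝ) *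
        G (Equiv.Perm.decomposeFin.symm (p, σ)) := by
  rw [← Equiv.sum_comp Equiv.Perm.decomposeFin.symm, Fintype.sum_prod_type]
  refine Finset.sum_congr rfl fun p _ => ?_
  rw [Finset.mul_sum]
  refine Finset.sum_congr rfl fun σ _ => ?_
  rw [Equiv.Perm.decomposeFin.symm_sign]
  split_ifs <;> simp

/-- A signed sum over the permutations of five indices as an iterated sum: a permutation is a
product of transpositions `swap 0 p`, `swap 1 (q + 1)`, and so on. In this form `simp` expands the
sums in the exterior products of degree five. -/
lemma sum_sign_mul_perm_five (F : Fin 5 → Fin 5 → Fin 5 → Fin 5 → Fin 5 → ℝ) :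
    ∑ s : Equiv.Perm (Fin 5), ((Equiv.Perm.sign s : ℤ) : ℝ) * F (s 0) (s 1) (s 2) (s 3) (s 4) =
    ∑ p : Fin 5, (if p = 0 then (1 : ℝ) else -1) * ∑ q : Fin 4, (if q = 0 then (1 : ℝ) else -1) *
     ∑ r : Fin 3, (if r = 0 then (1 : ℝ) else -1) * ∑ t : Fin 2, (if t = 0 then (1 : ℝ) else -1) *
       F p (Equiv.swap 0 p q.succ) (Equiv.swap 0 p (Equiv.swap 0 q r.succ).succ)
        (Equiv.swap 0 p (Equiv.swap 0 q (Equiv.swap 0 r t.succ).succ).succ)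
        (Equiv.swap 0 p (Equiv.swap 0 q (Equiv.swap 0 r (Equiv.swap 0 t 1).succ).succ).succ) := by
  have h1 : (1 : Fin 5) = Fin.succ (0 : Fin 4) := rfl
  have h2 : (2 : Fin 5) = Fin.succ (Fin.succ (0 : Fin 3)) := rfl
  have h3 : (3 : Fin 5) = Fin.succ (Fin.succ (Fin.succ (0 : Fin 2))) := rfl
  have h4 : (4 : Fin 5) = Fin.succ (Fin.succ (Fin.succ (Fin.succ (0 : Fin 1)))) := rfl
  have h5 : (1 : Fin 2) = Fin.succ (0 : Fin 1) := rfl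
  simp only [h1, h2, h3, h4, h5, sum_sign_mul_perm_succ (n := 4), sum_sign_mul_perm_succ (n := 3),
    sum_sign_mul_perm_succ (n := 2), sum_sign_mul_perm_succ (n := 1),
    Equiv.Perm.decomposeFin_symm_apply_zero, Equiv.Perm.decomposeFin_symm_apply_succ]
  simp only [Finset.univ_unique, Finset.sum_singleton]
  simp

/-! ### Coordinates of forms -/

/-- The component of degree `0`. -/
def co0 (φ : MixedForm V5) : ℝ := φ 0 ![]

/-- The coordinates of the component of degree `1`. -/
def co1 (φ : MixedForm V5) (i : Fin 5) : ℝ := φ 1 ![e5 i]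

/-- The coordinates of the component of degree `2`. As in the higher degrees below, the indices
are arbitrary; the `simp` lemmas of this section sort them and remove repetitions. -/
def co2 (φ : MixedForm V5) (i j : Fin 5) : ℝ := φ 2 ![e5 i, e5 j]

/-- The coordinates of the component of degree `3`. -/
def co3 (φ : MixedForm V5) (i j k : Fin 5) : ℝ := φ 3 ![e5 i, e5 j, e5 k]

/-- The coordinates of the component of degree `4`. -/
def co4 (φ : MixedForm V5) (i j k l : Fin 5) : ℝ := φ 4 ![e5 i, e5 j, e5 k, e5 l]

/-- The coordinates of the component of degree `5`. -/
def co5 (φ : MixedForm V5) (i j k l m : Fin 5) : ℝ := φ 5 ![e5 i, e5 j, e5 k, e5 l, e5 m]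

lemma map_swap_eq {k : ℕ} (α : V5 [⋀^Fin k]→L[ℝ] ℝ) {v w : Fin k → V5} (i j : Fin k)
    (hij : i ≠ j) (h : v = w ∘ Equiv.swap i j) : α v = - α w := by
  rw [h]; exact α.toAlternatingMap.map_swap w hij

section Swaps
variable (φ : MixedForm V5) (i j k l m : Fin 5)

@[simp] lemma co2_swap (_ : j < i) : co2 φ i j = - co2 φ j i :=
  map_swap_eq _ 0 1 (by decide) (by funext x; fin_cases x <;> rfl)
@[simp] lemma co3_swap01 (_ : j < i) : co3 φ i j k = - co3 φ j i k :=
  map_swap_eq _ 0 1 (by decide) (by funext x; fin_cases x <;> rfl)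
@[simp] lemma co3_swap12 (_ : k < j) : co3 φ i j k = - co3 φ i k j :=
  map_swap_eq _ 1 2 (by decide) (by funext x; fin_cases x <;> rfl)
@[simp] lemma co4_swap01 (_ : j < i) : co4 φ i j k l = - co4 φ j i k l :=
  map_swap_eq _ 0 1 (by decide) (by funext x; fin_cases x <;> rfl)
@[simp] lemma co4_swap12 (_ : k < j) : co4 φ i j k l = - co4 φ i k j l :=
  map_swap_eq _ 1 2 (by decide) (by funext x; fin_cases x <;> rfl)
@[simp] lemma co4_swap23 (_ : l < k) : co4 φ i j k l = - co4 φ i j l k :=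
  map_swap_eq _ 2 3 (by decide) (by funext x; fin_cases x <;> rfl)
@[simp] lemma co5_swap01 (_ : j < i) : co5 φ i j k l m = - co5 φ j i k l m :=
  map_swap_eq _ 0 1 (by decide) (by funext x; fin_cases x <;> rfl)
@[simp] lemma co5_swap12 (_ : k < j) : co5 φ i j k l m = - co5 φ i k j l m :=
  map_swap_eq _ 1 2 (by decide) (by funext x; fin_cases x <;> rfl)
@[simp] lemma co5_swap23 (_ : l < k) : co5 φ i j k l m = - co5 φ i j l k m :=
  map_swap_eq _ 2 3 (by decide) (by funext x; fin_cases x <;> rfl)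
@[simp] lemma co5_swap34 (_ : m < l) : co5 φ i j k l m = - co5 φ i j k m l :=
  map_swap_eq _ 3 4 (by decide) (by funext x; fin_cases x <;> rfl)

@[simp] lemma co2_self : co2 φ i i = 0 :=
  ContinuousAlternatingMap.map_eq_zero_of_eq _ _ (i := 0) (j := 1) rfl (by decide)
@[simp] lemma co3_self01 : co3 φ i i k = 0 :=
  ContinuousAlternatingMap.map_eq_zero_of_eq _ _ (i := 0) (j := 1) rfl (by decide)
@[simp] lemma co3_self12 : co3 φ i j j = 0 :=
  ContinuousAlternatingMap.map_eq_zero_of_eq _ _ (i := 1) (j := 2) rfl (by decide)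
@[simp] lemma co4_self01 : co4 φ i i k l = 0 :=
  ContinuousAlternatingMap.map_eq_zero_of_eq _ _ (i := 0) (j := 1) rfl (by decide)
@[simp] lemma co4_self12 : co4 φ i j j l = 0 :=
  ContinuousAlternatingMap.map_eq_zero_of_eq _ _ (i := 1) (j := 2) rfl (by decide)
@[simp] lemma co4_self23 : co4 φ i j k k = 0 :=
  ContinuousAlternatingMap.map_eq_zero_of_eq _ _ (i := 2) (j := 3) rfl (by decide)
@[simp] lemma co5_self01 : co5 φ i i k l m = 0 :=
  ContinuousAlternatingMap.map_eq_zero_of_eq _ _ (i := 0) (j := 1) rfl (by decide)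
@[simp] lemma co5_self12 : co5 φ i j j l m = 0 :=
  ContinuousAlternatingMap.map_eq_zero_of_eq _ _ (i := 1) (j := 2) rfl (by decide)
@[simp] lemma co5_self23 : co5 φ i j k k m = 0 :=
  ContinuousAlternatingMap.map_eq_zero_of_eq _ _ (i := 2) (j := 3) rfl (by decide)
@[simp] lemma co5_self34 : co5 φ i j k l l = 0 :=
  ContinuousAlternatingMap.map_eq_zero_of_eq _ _ (i := 3) (j := 4) rfl (by decide)

end Swaps

/-- The sum over permutations reduces to the `5` shuffles; the other permutations repeat these and
cancel the factorials. -/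
lemma wedge_one_four (ψ φ : MixedForm V5) :
    wedge (p := 1) (q := 4) (ψ 1) (φ 4) e5 =
      co1 ψ 0 * co4 φ 1 2 3 4 - co1 ψ 1 * co4 φ 0 2 3 4 + co1 ψ 2 * co4 φ 0 1 3 4
        - co1 ψ 3 * co4 φ 0 1 2 4 + co1 ψ 4 * co4 φ 0 1 2 3 := by
  have h : ∀ s : Equiv.Perm (Fin 5),
      (ψ 1 fun i => e5 (s (Fin.castAdd 4 i))) * (φ 4 fun j => e5 (s (Fin.natAdd 1 j))) =
      co1 ψ (s 0) * co4 φ (s 1) (s 2) (s 3) (s 4) := by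
    intro s
    unfold co1 co4
    congr 2
    · funext x; fin_cases x; rfl
    · funext x; fin_cases x <;> rfl
  simp only [wedge, h]
  erw [sum_sign_mul_perm_five fun a b c d e => co1 ψ a * co4 φ b c d e]
  simp only [Fin.sum_univ_five, Fin.sum_univ_four, Fin.sum_univ_three, Fin.sum_univ_two]
  simp [Equiv.swap_apply_def, Nat.factorial]
  ring

lemma wedge_three_two (ψ φ : MixedForm V5) :
    wedge (p := 3) (q := 2) (ψ 3) (φ 2) e5 =
      co3 ψ 0 1 2 * co2 φ 3 4 - co3 ψ 0 1 3 * co2 φ 2 4 + co3 ψ 0 1 4 * co2 φ 2 3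
        + co3 ψ 0 2 3 * co2 φ 1 4 - co3 ψ 0 2 4 * co2 φ 1 3 + co3 ψ 0 3 4 * co2 φ 1 2
        - co3 ψ 1 2 3 * co2 φ 0 4 + co3 ψ 1 2 4 * co2 φ 0 3 - co3 ψ 1 3 4 * co2 φ 0 2
        + co3 ψ 2 3 4 * co2 φ 0 1 := by
  have h : ∀ s : Equiv.Perm (Fin 5),
      (ψ 3 fun i => e5 (s (Fin.castAdd 2 i))) * (φ 2 fun j => e5 (s (Fin.natAdd 3 j))) =
      co3 ψ (s 0) (s 1) (s 2) * co2 φ (s 3) (s 4) := by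
    intro s
    unfold co3 co2
    congr 2
    · funext x; fin_cases x <;> rfl
    · funext x; fin_cases x <;> rfl
  simp only [wedge, h]
  erw [sum_sign_mul_perm_five fun a b c d e => co3 ψ a b c * co2 φ d e]
  simp only [Fin.sum_univ_five, Fin.sum_univ_four, Fin.sum_univ_three, Fin.sum_univ_two]
  simp [Equiv.swap_apply_def, Nat.factorial]
  ring

lemma wedge_five_zero (ψ φ : MixedForm V5) :
    wedge (p := 5) (q := 0) (ψ 5) (φ 0) e5 = co5 ψ 0 1 2 3 4 * co0 φ := by
  have h : ∀ s : Equiv.Perm (Fin 5),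
      (ψ 5 fun i => e5 (s (Fin.castAdd 0 i))) * (φ 0 fun j => e5 (s (Fin.natAdd 5 j))) =
      co5 ψ (s 0) (s 1) (s 2) (s 3) (s 4) * co0 φ := by
    intro s
    unfold co5 co0
    congr 2
    · funext x; fin_cases x <;> rfl
    · exact Subsingleton.elim _ _
  simp only [wedge, h]
  erw [sum_sign_mul_perm_five fun a b c d e => co5 ψ a b c d e * co0 φ]
  simp only [Fin.sum_univ_five, Fin.sum_univ_four, Fin.sum_univ_three, Fin.sum_univ_two]
  simp [Equiv.swap_apply_def, Nat.factorial]
  ring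

lemma vec_eq_sum (X : V5) : X = ∑ i, X i • e5 i := by
  ext j; simp [e5, Finset.sum_apply, Pi.single_apply]

section CliffordCoordinates
variable (a : GenVec V5) (φ : MixedForm V5) (i j k l m : Fin 5)

/-- The first argument of a form, expanded in the standard basis. -/
lemma map_vecCons_eq_sum {n : ℕ} (α : V5 [⋀^Fin (n + 1)]→L[ℝ] ℝ) (X : V5) (v : Fin n → V5) :
    α (Matrix.vecCons X v) = ∑ i, X i * α (Matrix.vecCons (e5 i) v) := by
  have h : α.curryLeft X v = ∑ i, X i * α.curryLeft (e5 i) v := by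
    conv_lhs => rw [vec_eq_sum X]
    simp [map_sum]
  simpa using h

lemma clifford_succ_apply {n : ℕ} (v : Fin (n + 1) → V5) : clifford a φ (n + 1) v =
    ∑ p, a.1 p * φ (n + 2) (Matrix.vecCons (e5 p) v) +
      ∑ i : Fin (n + 1), (-1) ^ (i : ℕ) * (a.2 (v i) * φ n (i.removeNth v)) := by
  rw [← map_vecCons_eq_sum, ← wedgeOne_apply]
  rfl

lemma co0_clifford : co0 (clifford a φ) = ∑ p, a.1 p * co1 φ p :=
  map_vecCons_eq_sum (φ 1) a.1 ![]

lemma co1_clifford : co1 (clifford a φ) i = ∑ p, a.1 p * co2 φ p i + a.2 (e5 i) * co0 φ := by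
  unfold co1
  rw [clifford_succ_apply]
  simp only [Fin.sum_univ_succ, Fin.sum_univ_zero]
  simp [co2, co0]

lemma co2_clifford : co2 (clifford a φ) i j =
    ∑ p, a.1 p * co3 φ p i j + (a.2 (e5 i) * co1 φ j - a.2 (e5 j) * co1 φ i) := by
  unfold co2
  rw [clifford_succ_apply]
  have h0 : (0 : Fin 2).removeNth ![e5 i, e5 j] = ![e5 j] := by
    funext x; fin_cases x; rfl
  have h1 : (1 : Fin 2).removeNth ![e5 i, e5 j] = ![e5 i] := by
    funext x; fin_cases x; rfl
  rw [Fin.sum_univ_two, h0, h1]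
  simp [co3, co1, sub_eq_add_neg]

lemma co3_clifford : co3 (clifford a φ) i j k =
    ∑ p, a.1 p * co4 φ p i j k +
      (a.2 (e5 i) * co2 φ j k - a.2 (e5 j) * co2 φ i k + a.2 (e5 k) * co2 φ i j) := by
  unfold co3
  rw [clifford_succ_apply]
  have h0 : (0 : Fin 3).removeNth ![e5 i, e5 j, e5 k] = ![e5 j, e5 k] := by
    funext x; fin_cases x <;> rfl
  have h1 : (1 : Fin 3).removeNth ![e5 i, e5 j, e5 k] = ![e5 i, e5 k] := by
    funext x; fin_cases x <;> rfl
  have h2 : (2 : Fin 3).removeNth ![e5 i, e5 j, e5 k] = ![e5 i, e5 j] := by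
    funext x; fin_cases x <;> rfl
  rw [Fin.sum_univ_three, h0, h1, h2]
  simp [co4, co2, sub_eq_add_neg]

lemma co4_clifford : co4 (clifford a φ) i j k l =
    ∑ p, a.1 p * co5 φ p i j k l +
      (a.2 (e5 i) * co3 φ j k l - a.2 (e5 j) * co3 φ i k l + a.2 (e5 k) * co3 φ i j l
        - a.2 (e5 l) * co3 φ i j k) := by
  unfold co4
  rw [clifford_succ_apply]
  have h0 : (0 : Fin 4).removeNth ![e5 i, e5 j, e5 k, e5 l] = ![e5 j, e5 k, e5 l] := by
    funext x; fin_cases x <;> rfl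
  have h1 : (1 : Fin 4).removeNth ![e5 i, e5 j, e5 k, e5 l] = ![e5 i, e5 k, e5 l] := by
    funext x; fin_cases x <;> rfl
  have h2 : (2 : Fin 4).removeNth ![e5 i, e5 j, e5 k, e5 l] = ![e5 i, e5 j, e5 l] := by
    funext x; fin_cases x <;> rfl
  have h3 : (3 : Fin 4).removeNth ![e5 i, e5 j, e5 k, e5 l] = ![e5 i, e5 j, e5 k] := by
    funext x; fin_cases x <;> rfl
  rw [Fin.sum_univ_four, h0, h1, h2, h3]
  simp [co5, co3, sub_eq_add_neg, pow_succ]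

/-- Forms of degree greater than five vanish. -/
lemma eq_zero_of_five_lt {n : ℕ} (hn : 5 < n) (α : V5 [⋀^Fin n]→L[ℝ] ℝ) : α = 0 := by
  ext v
  exact α.toAlternatingMap.map_linearDependent v fun h => by
    have := h.fintype_card_le_finrank
    simp at this
    omega

lemma co5_clifford : co5 (clifford a φ) i j k l m =
      a.2 (e5 i) * co4 φ j k l m - a.2 (e5 j) * co4 φ i k l m + a.2 (e5 k) * co4 φ i j l m
        - a.2 (e5 l) * co4 φ i j k m + a.2 (e5 m) * co4 φ i j k l := by
  unfold co5
  have hφ : φ (4 + 2) = 0 := eq_zero_of_five_lt (by norm_num) _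
  rw [clifford_succ_apply, Finset.sum_eq_zero (fun p _ => by rw [hφ]; exact mul_zero _), zero_add]
  have h0 : (0 : Fin 5).removeNth ![e5 i, e5 j, e5 k, e5 l, e5 m] = ![e5 j, e5 k, e5 l, e5 m] := by
    funext x; fin_cases x <;> rfl
  have h1 : (1 : Fin 5).removeNth ![e5 i, e5 j, e5 k, e5 l, e5 m] = ![e5 i, e5 k, e5 l, e5 m] := by
    funext x; fin_cases x <;> rfl
  have h2 : (2 : Fin 5).removeNth ![e5 i, e5 j, e5 k, e5 l, e5 m] = ![e5 i, e5 j, e5 l, e5 m] := by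
    funext x; fin_cases x <;> rfl
  have h3 : (3 : Fin 5).removeNth ![e5 i, e5 j, e5 k, e5 l, e5 m] = ![e5 i, e5 j, e5 k, e5 m] := by
    funext x; fin_cases x <;> rfl
  have h4 : (4 : Fin 5).removeNth ![e5 i, e5 j, e5 k, e5 l, e5 m] = ![e5 i, e5 j, e5 k, e5 l] := by
    funext x; fin_cases x <;> rfl
  rw [Fin.sum_univ_five, h0, h1, h2, h3, h4]
  simp [co4, sub_eq_add_neg, pow_succ]

end CliffordCoordinates

/-! ### Symmetry and nondegeneracy of the Mukai pairing -/

/-- The standard basis `e5` of `V5`, as a `Module.Basis`. -/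
def basis5 : Module.Basis (Fin 5) ℝ V5 := (EuclideanSpace.basisFun (Fin 5) ℝ).toBasis

lemma coe_basis5 : ⇑basis5 = e5 := by
  funext i; simp [basis5, e5]

/-- Alternating forms agree if they agree on the tuples of distinct basis vectors. -/
lemma alternating_ext {n : ℕ} {α β : V5 [⋀^Fin n]→L[ℝ] ℝ}
    (h : ∀ s : Fin n → Fin 5, Function.Injective s →
      α (fun i => e5 (s i)) = β (fun i => e5 (s i))) : α = β := by
  apply ContinuousAlternatingMap.toAlternatingMap_injective
  refine Module.Basis.ext_alternating basis5 fun s hs => ?_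
  rw [coe_basis5]
  exact h s hs

lemma mukai_e5 (ψ φ : MixedForm V5) : mukai ψ φ e5 =
    co1 ψ 0 * co4 φ 1 2 3 4 - co1 ψ 1 * co4 φ 0 2 3 4 + co1 ψ 2 * co4 φ 0 1 3 4
        - co1 ψ 3 * co4 φ 0 1 2 4 + co1 ψ 4 * co4 φ 0 1 2 3
     - (co3 ψ 0 1 2 * co2 φ 3 4 - co3 ψ 0 1 3 * co2 φ 2 4 + co3 ψ 0 1 4 * co2 φ 2 3
        + co3 ψ 0 2 3 * co2 φ 1 4 - co3 ψ 0 2 4 * co2 φ 1 3 + co3 ψ 0 3 4 * co2 φ 1 2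
        - co3 ψ 1 2 3 * co2 φ 0 4 + co3 ψ 1 2 4 * co2 φ 0 3 - co3 ψ 1 3 4 * co2 φ 0 2
        + co3 ψ 2 3 4 * co2 φ 0 1) + co5 ψ 0 1 2 3 4 * co0 φ := by
  simp only [mukai, wedge_one_four, wedge_three_two, wedge_five_zero]

set_option linter.unusedSimpArgs false in
/-- `⟨a · φ, ψ⟩ = ⟨a · ψ, φ⟩`: the Clifford action is symmetric for the Mukai pairing. Here the
even components of `φ` and `ψ` enter, in `mukai_clifford_symm'` the odd ones. -/
lemma mukai_clifford_symm (a : GenVec V5) (φ ψ : MixedForm V5) :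
    mukai (clifford a φ) ψ e5 = mukai (clifford a ψ) φ e5 := by
  simp only [mukai_e5, co1_clifford, co3_clifford, co5_clifford, Fin.sum_univ_five]
  simp
  ring

set_option linter.unusedSimpArgs false in
/-- The symmetry of the Clifford action on odd forms: `⟨φ, a · ψ⟩ = ⟨ψ, a · φ⟩`. -/
lemma mukai_clifford_symm' (a : GenVec V5) (φ ψ : MixedForm V5) :
    mukai φ (clifford a ψ) e5 = mukai ψ (clifford a φ) e5 := by
  simp only [mukai_e5, co0_clifford, co2_clifford, co4_clifford, Fin.sum_univ_five]
  simp
  ring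

/-- An odd form is determined by its coordinates on increasing tuples of indices. -/
lemma eq_zero_of_coords {ψ : MixedForm V5} (hψ : IsOdd ψ) (h1 : ∀ i, co1 ψ i = 0)
    (h3 : ∀ i j k, i < j → j < k → co3 ψ i j k = 0) (h5 : co5 ψ 0 1 2 3 4 = 0) : ψ = 0 := by
  have h3' : ∀ i j k, i ≠ j → i ≠ k → j ≠ k → co3 ψ i j k = 0 := by
    intro i j k hij hik hjk
    rcases lt_or_gt_of_ne hij with a | a <;> rcases lt_or_gt_of_ne hik with b | b <;>
      rcases lt_or_gt_of_ne hjk with c | c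
    · exact h3 _ _ _ a c
    · rw [co3_swap12 _ _ _ _ c, h3 _ _ _ b c, neg_zero]
    · exact absurd (a.trans c) b.asymm
    · rw [co3_swap12 _ _ _ _ c, co3_swap01 _ _ _ _ b, h3 _ _ _ b a, neg_zero, neg_zero]
    · rw [co3_swap01 _ _ _ _ a, h3 _ _ _ a b, neg_zero]
    · exact absurd (b.trans c) a.asymm
    · rw [co3_swap01 _ _ _ _ a, co3_swap12 _ _ _ _ b, h3 _ _ _ c b, neg_zero, neg_zero]
    · rw [co3_swap01 _ _ _ _ a, co3_swap12 _ _ _ _ b, co3_swap01 _ _ _ _ c, h3 _ _ _ c a]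
      simp
  funext n
  by_cases hn : 5 < n
  · rw [eq_zero_of_five_lt hn (ψ n)]; rfl
  · have hn' : n = 0 ∨ n = 1 ∨ n = 2 ∨ n = 3 ∨ n = 4 ∨ n = 5 := by omega
    rcases hn' with rfl | rfl | rfl | rfl | rfl | rfl
    · exact hψ _ (by decide)
    · refine alternating_ext fun s _ => ?_
      refine Eq.trans ?_ (h1 (s 0))
      unfold co1
      congr 1
      funext x; fin_cases x; rfl
    · exact hψ _ (by decide)
    · refine alternating_ext fun s hs => ?_
      refine Eq.trans ?_ (h3' (s 0) (s 1) (s 2) (hs.ne (by decide)) (hs.ne (by decide))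
        (hs.ne (by decide)))
      unfold co3
      congr 1
      funext x; fin_cases x <;> rfl
    · exact hψ _ (by decide)
    · apply ContinuousAlternatingMap.toAlternatingMap_injective
      have h : (ψ 5) e5 = 0 := by
        rw [← h5]
        unfold co5
        congr 1
        funext x; fin_cases x <;> rfl
      rw [AlternatingMap.eq_smul_basis_det basis5 (ψ 5).toAlternatingMap, coe_basis5]
      simp [h]

/-- The constant form `1`. -/
def oneForm : MixedForm V5
  | 0 => ContinuousAlternatingMap.constOfIsEmpty ℝ V5 (Fin 0) 1
  | _ + 1 => 0

lemma isEven_oneForm : IsEven oneForm := by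
  intro k hk
  match k with
  | 0 => exact absurd hk (by decide)
  | k + 1 => rfl

@[simp] lemma co0_oneForm : co0 oneForm = 1 := rfl
@[simp] lemma co1_oneForm (i : Fin 5) : co1 oneForm i = 0 := rfl
@[simp] lemma co2_oneForm (i j : Fin 5) : co2 oneForm i j = 0 := rfl
@[simp] lemma co3_oneForm (i j k : Fin 5) : co3 oneForm i j k = 0 := rfl
@[simp] lemma co4_oneForm (i j k l : Fin 5) : co4 oneForm i j k l = 0 := rfl
@[simp] lemma co5_oneForm (i j k l m : Fin 5) : co5 oneForm i j k l m = 0 := rfl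

/-- The `i`-th coordinate covector, as an element of `V ⊕ V*`. -/
def ε (i : Fin 5) : GenVec V5 := (0, EuclideanSpace.proj i)

@[simp] lemma ε_fst (i : Fin 5) : (ε i).1 = 0 := rfl
@[simp] lemma ε_snd_e5 (i j : Fin 5) : (ε i).2 (e5 j) = if i = j then 1 else 0 := by
  simp [ε, e5]

/-- The Mukai pairing of odd and even forms is nondegenerate. By the symmetry of the Clifford action
the pairing of `ψ` with `ε · … · ε · 1` is the top coordinate of `ε · … · ε · ψ`, and such
coordinates give all coordinates of `ψ`. -/
lemma mukai_nondegenerate {ψ : MixedForm V5} (hψ : IsOdd ψ)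
    (h : ∀ φ, IsEven φ → mukai ψ φ e5 = 0) : ψ = 0 := by
  have h0 : ∀ χ, mukai χ oneForm e5 = co5 χ 0 1 2 3 4 := fun χ => by simp [mukai_e5]
  have h2 : ∀ i j, co5 (clifford (ε j) (clifford (ε i) ψ)) 0 1 2 3 4 = 0 := fun i j => by
    rw [← h0, mukai_clifford_symm, ← mukai_clifford_symm']
    exact h _ ((isEven_oneForm.clifford _).clifford _)
  have h4 : ∀ i j k l, co5 (clifford (ε l) (clifford (ε k) (clifford (ε j)
      (clifford (ε i) ψ)))) 0 1 2 3 4 = 0 := fun i j k l => by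
    rw [← h0, mukai_clifford_symm, ← mukai_clifford_symm', mukai_clifford_symm,
      ← mukai_clifford_symm']
    exact h _ ((((isEven_oneForm.clifford _).clifford _).clifford _).clifford _)
  simp only [co2_clifford, co3_clifford, co4_clifford, co5_clifford, ε_fst, ε_snd_e5,
    PiLp.zero_apply, zero_mul, Finset.sum_const_zero, zero_add] at h2 h4
  refine eq_zero_of_coords hψ ?_ ?_ ?_
  · intro i
    fin_cases i
    · simpa using h4 1 2 3 4
    · simpa using h4 0 2 3 4
    · simpa using h4 0 1 3 4
    · simpa using h4 0 1 2 4
    · simpa using h4 0 1 2 3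
  · intro i j k hij hjk
    fin_cases i <;> fin_cases j <;> (try exact absurd hij (by decide)) <;> fin_cases k <;>
      (try exact absurd hjk (by decide))
    · simpa using h2 3 4
    · simpa using h2 2 4
    · simpa using h2 2 3
    · simpa using h2 1 4
    · simpa using h2 1 3
    · simpa using h2 1 2
    · simpa using h2 0 4
    · simpa using h2 0 3
    · simpa using h2 0 2
    · simpa using h2 0 1
  · simpa [mukai_e5] using h oneForm isEven_oneForm

/-! ### The quadratic map `Q` and its cubic identity -/

/-- The vector `q(α)` with `2 (q(α), e) = ⟨e · α, α⟩`, where `5`-forms are replaced by their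
coefficients. Up to a scalar this is `Q(α)`, with no division by a volume form. -/
def quad (α : MixedForm V5) : GenVec V5 :=
  (∑ i, mukaiFunctional α α e5 (0, EuclideanSpace.proj i) • e5 i,
   ∑ i, mukaiFunctional α α e5 (e5 i, 0) • EuclideanSpace.proj i)

lemma bilin_self (ν : V5 [⋀^Fin 5]→L[ℝ] ℝ) (α : MixedForm V5) :
    bilin ν α α = (2 / ν e5) • quad α := by
  simp only [bilin, quad, Prod.smul_mk, Finset.smul_sum, smul_smul]
  congr 1 <;> refine Finset.sum_congr rfl fun i _ => ?_ <;> congr 1 <;> ring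

lemma quad_fst (α : MixedForm V5) (i : Fin 5) : (quad α).1 i = mukai (clifford (ε i) α) α e5 := by
  simp [quad, e5, Pi.single_apply]
  rfl

lemma quad_snd (α : MixedForm V5) (i : Fin 5) :
    (quad α).2 (e5 i) = mukai (clifford (e5 i, 0) α) α e5 := by
  simp [quad, e5, sum_apply]
  rfl

lemma e5_apply (i j : Fin 5) : e5 i j = if j = i then 1 else 0 := by
  simp [e5]

/-- The vector part of `quad` in coordinates: `co0 · co4` minus a Pfaffian. -/
lemma quad_fst_coords (α : MixedForm V5) :
    (quad α).1 0 = 2 * (co0 α * co4 α 1 2 3 4 - co2 α 1 2 * co2 α 3 4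
        + co2 α 1 3 * co2 α 2 4 - co2 α 1 4 * co2 α 2 3) ∧
    (quad α).1 1 = -2 * (co0 α * co4 α 0 2 3 4 - co2 α 0 2 * co2 α 3 4
        + co2 α 0 3 * co2 α 2 4 - co2 α 0 4 * co2 α 2 3) ∧
    (quad α).1 2 = 2 * (co0 α * co4 α 0 1 3 4 - co2 α 0 1 * co2 α 3 4
        + co2 α 0 3 * co2 α 1 4 - co2 α 0 4 * co2 α 1 3) ∧
    (quad α).1 3 = -2 * (co0 α * co4 α 0 1 2 4 - co2 α 0 1 * co2 α 2 4
        + co2 α 0 2 * co2 α 1 4 - co2 α 0 4 * co2 α 1 2) ∧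
    (quad α).1 4 = 2 * (co0 α * co4 α 0 1 2 3 - co2 α 0 1 * co2 α 2 3
        + co2 α 0 2 * co2 α 1 3 - co2 α 0 3 * co2 α 1 2) := by
  refine ⟨?_, ?_, ?_, ?_, ?_⟩
  all_goals
    rw [quad_fst, mukai_e5]
    simp only [co1_clifford, co3_clifford, co5_clifford, Fin.sum_univ_five, ε_fst, ε_snd_e5]
    simp
    ring

/-- The covector part of `quad` in coordinates. -/
lemma quad_snd_coords (α : MixedForm V5) (i : Fin 5) :
    (quad α).2 (e5 i) = 2 * (co2 α i 0 * co4 α 1 2 3 4 - co2 α i 1 * co4 α 0 2 3 4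
      + co2 α i 2 * co4 α 0 1 3 4 - co2 α i 3 * co4 α 0 1 2 4 + co2 α i 4 * co4 α 0 1 2 3) := by
  rw [quad_snd, mukai_e5]
  simp only [co1_clifford, co3_clifford, co5_clifford, Fin.sum_univ_five, e5_apply]
  fin_cases i <;> simp <;> ring

/-- The cubic identity `q(α) · α = 0` for even forms in dimension five. Both sides are polynomials
in the `16` coordinates of `α`; invariantly, the half-spin representation `S` of `Spin(5, 5)` has no
equivariant cubic map to the other half-spin representation. -/
lemma clifford_quad_self {α : MixedForm V5} (hα : IsEven α) : clifford (quad α) α = 0 := by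
  obtain ⟨h0, h1, h2, h3, h4⟩ := quad_fst_coords α
  refine eq_zero_of_coords (hα.clifford _) ?_ ?_ ?_
  · intro i
    simp only [co1_clifford, Fin.sum_univ_five, h0, h1, h2, h3, h4, quad_snd_coords]
    fin_cases i <;> simp <;> ring
  · intro i j k hij hjk
    simp only [co3_clifford, Fin.sum_univ_five, h0, h1, h2, h3, h4, quad_snd_coords]
    fin_cases i <;> fin_cases j <;> (try exact absurd hij (by decide)) <;> fin_cases k <;>
      (try exact absurd hjk (by decide)) <;> simp <;> ring
  · simp only [co5_clifford, quad_snd_coords]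
    simp
    ring

lemma clifford_bilin_self (ν : V5 [⋀^Fin 5]→L[ℝ] ℝ) {α : MixedForm V5} (hα : IsEven α) :
    clifford (bilin ν α α) α = 0 := by
  rw [bilin_self, clifford_smul_left, clifford_quad_self hα, smul_zero]

/-! ### Bilinearity -/

section PairingLemmas
variable {V : Type*} [NormedAddCommGroup V] [NormedSpace ℝ V]

lemma pairing_comm (a b : GenVec V) : pairing a b = pairing b a := by
  unfold pairing; ring

lemma pairing_add_left (a b c : GenVec V) : pairing (a + b) c = pairing a c + pairing b c := by
  simp [pairing]; ring

lemma pairing_smul_left (r : ℝ) (a b : GenVec V) : pairing (r • a) b = r * pairing a b := by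
  simp [pairing]; ring

lemma pairing_add_right (a b c : GenVec V) : pairing a (b + c) = pairing a b + pairing a c := by
  simp [pairing]; ring

lemma pairing_smul_right (r : ℝ) (a b : GenVec V) : pairing a (r • b) = r * pairing a b := by
  simp [pairing]; ring

/-- The pairing as a bilinear map. -/
def pairingₗ : GenVec V →ₗ[ℝ] GenVec V →ₗ[ℝ] ℝ :=
  LinearMap.mk₂ ℝ pairing pairing_add_left (fun r a b => pairing_smul_left r a b)
    pairing_add_right (fun r a b => pairing_smul_right r a b)

lemma pairing_zero_left (a : GenVec V) : pairing 0 a = 0 := by simp [pairing]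

lemma pairing_sum_left {ι : Type*} (s : Finset ι) (a : ι → GenVec V) (b : GenVec V) :
    pairing (∑ i ∈ s, a i) b = ∑ i ∈ s, pairing (a i) b := by
  exact LinearMap.map_sum₂ pairingₗ s a b

/-- The inner product of `V ⊕ V*` is nondegenerate. -/
lemma eq_of_pairing_eq {a b : GenVec V} (h : ∀ e, pairing a e = pairing b e) : a = b := by
  refine Prod.ext ?_ ?_
  · by_contra hne
    obtain ⟨f, hf⟩ := SeparatingDual.exists_separating_of_ne (R := ℝ) hne
    have := h (0, f)
    simp [pairing] at this
    exact hf this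
  · ext X
    have := h (X, 0)
    simpa [pairing] using this

end PairingLemmas

section MukaiLinear

lemma mukai_add_left (ψ ψ' φ : MixedForm V5) :
    mukai (ψ + ψ') φ e5 = mukai ψ φ e5 + mukai ψ' φ e5 := by
  simp only [mukai_e5, co0, co1, co2, co3, co4, co5, Pi.add_apply,
    ContinuousAlternatingMap.add_apply]
  ring

lemma mukai_smul_left (c : ℝ) (ψ φ : MixedForm V5) :
    mukai (c • ψ) φ e5 = c * mukai ψ φ e5 := by
  simp only [mukai_e5, co0, co1, co2, co3, co4, co5, Pi.smul_apply,
    ContinuousAlternatingMap.smul_apply, smul_eq_mul]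
  ring

lemma mukai_add_right (ψ φ φ' : MixedForm V5) :
    mukai ψ (φ + φ') e5 = mukai ψ φ e5 + mukai ψ φ' e5 := by
  simp only [mukai_e5, co0, co1, co2, co3, co4, co5, Pi.add_apply,
    ContinuousAlternatingMap.add_apply]
  ring

lemma mukai_smul_right (c : ℝ) (ψ φ : MixedForm V5) :
    mukai ψ (c • φ) e5 = c * mukai ψ φ e5 := by
  simp only [mukai_e5, co0, co1, co2, co3, co4, co5, Pi.smul_apply,
    ContinuousAlternatingMap.smul_apply, smul_eq_mul]
  ring

/-- The coefficient of the Mukai pairing as a bilinear map. -/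
def mukaiₗ : MixedForm V5 →ₗ[ℝ] MixedForm V5 →ₗ[ℝ] ℝ :=
  LinearMap.mk₂ ℝ (fun ψ φ => mukai ψ φ e5) mukai_add_left mukai_smul_left mukai_add_right
    (fun c ψ φ => mukai_smul_right c ψ φ)

lemma mukaiₗ_apply (ψ φ : MixedForm V5) : mukaiₗ ψ φ = mukai ψ φ e5 := rfl

lemma mukai_zero_left (φ : MixedForm V5) : mukai 0 φ e5 = 0 := LinearMap.map_zero₂ mukaiₗ φ

lemma mukai_zero_right (φ : MixedForm V5) : mukai φ 0 e5 = 0 := map_zero (mukaiₗ φ)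

lemma mukai_sum_left {ι : Type*} (s : Finset ι) (ψ : ι → MixedForm V5) (φ : MixedForm V5) :
    mukai (∑ i ∈ s, ψ i) φ e5 = ∑ i ∈ s, mukai (ψ i) φ e5 := LinearMap.map_sum₂ mukaiₗ s ψ φ

lemma mukai_sum_right {ι : Type*} (s : Finset ι) (ψ : MixedForm V5) (φ : ι → MixedForm V5) :
    mukai ψ (∑ i ∈ s, φ i) e5 = ∑ i ∈ s, mukai ψ (φ i) e5 := map_sum (mukaiₗ ψ) φ s

end MukaiLinear

/-! ### Polarization of the cubic identity -/

section Bilin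
variable {ν : V5 [⋀^Fin 5]→L[ℝ] ℝ}

lemma pairing_bilin_eq (hν : ν e5 ≠ 0) (α β : MixedForm V5) (e : GenVec V5) :
    pairing (bilin ν α β) e = mukai (clifford e α) β e5 / ν e5 := by
  rw [← pairing_bilin ν hν, mul_div_cancel_right₀ _ hν]

lemma bilin_comm (hν : ν e5 ≠ 0) (α β : MixedForm V5) : bilin ν α β = bilin ν β α :=
  eq_of_pairing_eq fun e => by
    rw [pairing_bilin_eq hν, pairing_bilin_eq hν, mukai_clifford_symm]

/-- The expansion of the quadratic map `Q` along a line. -/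
lemma bilin_add_smul_self (hν : ν e5 ≠ 0) (α τ : MixedForm V5) (s : ℝ) :
    bilin ν (α + s • τ) (α + s • τ) = bilin ν α α + s • (2 • bilin ν α τ) + s ^ 2 • bilin ν τ τ :=
  eq_of_pairing_eq fun e => by
    simp only [two_smul, pairing_add_left, pairing_smul_left, pairing_bilin_eq hν,
      clifford_add_right, clifford_smul_right, mukai_add_left, mukai_add_right, mukai_smul_left,
      mukai_smul_right, mukai_clifford_symm e τ α]
    ring

lemma bilin_smul_form (hν : ν e5 ≠ 0) {r : ℝ} (hr : r ≠ 0) (α β : MixedForm V5) :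
    bilin (r • ν) α β = r⁻¹ • bilin ν α β :=
  eq_of_pairing_eq fun e => by
    have h : (r • ν) e5 ≠ 0 := by simp [hr, hν]
    rw [pairing_smul_left, pairing_bilin_eq hν, pairing_bilin_eq h]
    simp only [ContinuousAlternatingMap.smul_apply, smul_eq_mul]
    field_simp

/-- Polarization of the cubic identity: `Q(α) · β + 2 P(α, β) · α` is the coefficient of `s` in
`Q(α + s β) · (α + s β) = 0`. -/
lemma clifford_bilin_polar (hν : ν e5 ≠ 0) {α β : MixedForm V5}
    (hα : IsEven α) (hβ : IsEven β) :
    clifford (bilin ν α α) β = (-2 : ℝ) • clifford (bilin ν α β) α := by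
  have key : ∀ s : ℝ, s • (clifford (bilin ν α α) β + (2 : ℝ) • clifford (bilin ν α β) α) +
      s ^ 2 • (clifford (bilin ν β β) α + (2 : ℝ) • clifford (bilin ν α β) β) = 0 := by
    intro s
    have hE : IsEven (α + s • β) := fun k hk => by simp [hα k hk, hβ k hk]
    have h := clifford_bilin_self ν hE
    rw [bilin_add_smul_self hν] at h
    simp only [clifford_add_left, clifford_add_right, clifford_smul_left, clifford_smul_right,
      clifford_bilin_self ν hα, clifford_bilin_self ν hβ, two_smul] at h
    rw [← h]
    module
  -- the part of `key s` linear in `s` is isolated as the difference of `s = 1` and `s = -1`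
  have h1 := key 1
  have h2 := key (-1)
  have h3 : (2 : ℝ) • (clifford (bilin ν α α) β + (2 : ℝ) • clifford (bilin ν α β) α) = 0 := by
    rw [← sub_self (0 : MixedForm V5)]
    nth_rewrite 1 [← h1]
    rw [← h2]
    module
  have h4 := (smul_eq_zero.mp h3).resolve_left two_ne_zero
  rw [eq_neg_of_add_eq_zero_left h4]
  module

end Bilin

/-! ### The derivative of the volume form and the relations between `v₁`, `h`, `v₂` -/

section PairingDeriv
variable {V : Type*} [NormedAddCommGroup V] [NormedSpace ℝ V]
  {W : Type*} [NormedAddCommGroup W] [NormedSpace ℝ W]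

/-- The Leibniz rule for the inner product of `V ⊕ V*`. -/
lemma HasFDerivAt.pairing {a b : W → GenVec V} {a' b' : W →L[ℝ] GenVec V} {x : W}
    (ha : HasFDerivAt a a' x) (hb : HasFDerivAt b b' x) :
    ∃ L : W →L[ℝ] ℝ, HasFDerivAt (fun y => GenGeom.pairing (a y) (b y)) L x ∧
      ∀ X, L X = GenGeom.pairing (a' X) (b x) + GenGeom.pairing (a x) (b' X) := by
  have h := ((ha.snd.clm_apply hb.fst).add (hb.snd.clm_apply ha.fst)).mul_const (1 / 2 : ℝ)
  refine ⟨_, h.congr_of_eventuallyEq (Filter.Eventually.of_forall fun y => ?_), fun X => ?_⟩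
  · simp only [GenGeom.pairing, Pi.add_apply]; ring
  · simp [GenGeom.pairing]; ring

lemma HasDerivAt.pairing {a b : ℝ → GenVec V} {a' b' : GenVec V} {x : ℝ}
    (ha : HasDerivAt a a' x) (hb : HasDerivAt b b' x) :
    HasDerivAt (fun y => GenGeom.pairing (a y) (b y))
      (GenGeom.pairing a' (b x) + GenGeom.pairing (a x) b') x := by
  obtain ⟨L, hL, h⟩ := HasFDerivAt.pairing ha.hasFDerivAt hb.hasFDerivAt
  have := hL.hasDerivAt
  rw [h] at this
  simpa using this

end PairingDeriv

section Hat
variable {μ : V5 [⋀^Fin 5]→L[ℝ] ℝ} {ρ : Fin 2 → MixedForm V5} {σ : ℝ}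

lemma volForm_e5_ne_zero (hμ : μ e5 ≠ 0) (hs : σ * quartic μ ρ < 0) : volForm μ ρ e5 ≠ 0 := by
  have : quartic μ ρ ≠ 0 := by rintro h; simp [h] at hs
  simp [volForm, hμ, Real.sqrt_eq_zero, this]

lemma abs_quartic (hσ : σ = 1 ∨ σ = -1) (hs : σ * quartic μ ρ < 0) :
    |quartic μ ρ| = -(σ * quartic μ ρ) := by
  rcases hσ with rfl | rfl
  · rw [abs_of_neg (by linarith)]; ring
  · rw [abs_of_pos (by linarith)]; ring

/-- The form `ρ̂` is determined by the Clifford action of `v₁` and `v₂`: the derivative of the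
volume form is computed from `f(ρ) = (Q(ρ₁), Q(ρ₂))` and compared with the defining property of
`ρ̂`, and the Mukai pairing is nondegenerate. -/
lemma IsHat.eq {ρhat : Fin 2 → MixedForm V5} (hμ : μ e5 ≠ 0) (hσ : σ = 1 ∨ σ = -1)
    (hs : σ * quartic μ ρ < 0) (heven : ∀ i, IsEven (ρ i)) (h : IsHat μ ρ ρhat) :
    ρhat 0 = σ • clifford (vOne μ ρ) (ρ 1) ∧ ρhat 1 = -σ • clifford (vTwo μ ρ) (ρ 0) := by
  have hq : quartic μ ρ ≠ 0 := by rintro h; simp [h] at hs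
  have hr : √|quartic μ ρ| ≠ 0 := by simp [Real.sqrt_eq_zero, hq]
  have key : ∀ τ : Fin 2 → MixedForm V5, (∀ i, IsEven (τ i)) →
      mukai (ρhat 1) (τ 0) e5 - mukai (ρhat 0) (τ 1) e5 =
        -σ * (mukai (clifford (vTwo μ ρ) (ρ 0)) (τ 0) e5
          + mukai (clifford (vOne μ ρ) (ρ 1)) (τ 1) e5) := by
    intro τ hτ
    have hb : ∀ i, HasDerivAt (fun s : ℝ => bilin μ (ρ i + s • τ i) (ρ i + s • τ i))
        ((2 : ℝ) • bilin μ (ρ i) (τ i)) 0 := by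
      intro i
      have h2 := (((hasDerivAt_id (0 : ℝ)).smul_const ((2 : ℝ) • bilin μ (ρ i) (τ i))).const_add
        (bilin μ (ρ i) (ρ i))).add
        ((hasDerivAt_pow 2 (0 : ℝ)).smul_const (bilin μ (τ i) (τ i)))
      refine (h2.congr_of_eventuallyEq (Filter.Eventually.of_forall fun s => ?_)).congr_deriv ?_
      · simp only [bilin_add_smul_self hμ, two_smul]; simp
      · simp
    have hq' := HasDerivAt.pairing (hb 0) (hb 1)
    simp only [zero_smul, add_zero] at hq'
    set c := GenGeom.pairing ((2 : ℝ) • bilin μ (ρ 0) (τ 0)) (bilin μ (ρ 1) (ρ 1)) +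
      GenGeom.pairing (bilin μ (ρ 0) (ρ 0)) ((2 : ℝ) • bilin μ (ρ 1) (τ 1)) with hc
    have h1 := h.2 τ hτ e5
    have h2 : HasDerivAt (fun s : ℝ => volForm μ (fun i k => ρ i k + s • τ i k) e5)
        (-(σ * c) / (2 * √|quartic μ ρ|) * μ e5) 0 := by
      have hf := (hq'.const_mul σ).neg
      have h0 : -(σ * GenGeom.pairing (bilin μ (ρ 0 + (0 : ℝ) • τ 0) (ρ 0 + (0 : ℝ) • τ 0))
          (bilin μ (ρ 1 + (0 : ℝ) • τ 1) (ρ 1 + (0 : ℝ) • τ 1))) = |quartic μ ρ| := by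
        rw [abs_quartic hσ hs]; simp [quartic]
      have hf' := (hf.sqrt (by simp only [Pi.neg_apply]; rw [h0]; simpa using hq)).mul_const (μ e5)
      simp only [Pi.neg_apply] at hf'
      rw [h0] at hf'
      refine hf'.congr_of_eventuallyEq ?_
      have hc0 : ContinuousAt (fun s : ℝ => σ * GenGeom.pairing
          (bilin μ (ρ 0 + s • τ 0) (ρ 0 + s • τ 0)) (bilin μ (ρ 1 + s • τ 1) (ρ 1 + s • τ 1))) 0 :=
        (hq'.const_mul σ).continuousAt
      have hlt := hc0.eventually_lt (continuousAt_const (y := (0 : ℝ)))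
        (by simp only [zero_smul, add_zero]; exact hs)
      filter_upwards [hlt] with s hs'
      have : |quartic μ (fun i k => ρ i k + s • τ i k)| =
          -(σ * GenGeom.pairing (bilin μ (ρ 0 + s • τ 0) (ρ 0 + s • τ 0))
            (bilin μ (ρ 1 + s • τ 1) (ρ 1 + s • τ 1))) := abs_quartic hσ hs'
      simp only [volForm, this, ContinuousAlternatingMap.smul_apply, smul_eq_mul]
    rw [h1.unique h2, hc, pairing_smul_left, pairing_comm (bilin μ (ρ 0) (ρ 0)), pairing_smul_left,
      pairing_bilin_eq hμ, pairing_bilin_eq hμ, vOne, vTwo, volForm, bilin_smul_form hμ hr,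
      bilin_smul_form hμ hr, clifford_smul_left, clifford_smul_left, mukai_smul_left,
      mukai_smul_left]
    field_simp
  constructor
  · rw [← sub_eq_zero]
    refine mukai_nondegenerate (fun k hk => ?_) fun φ hφ => ?_
    · simp [h.1 0 k hk, ((heven 1).clifford (vOne μ ρ)) k hk]
    · have := key ![0, φ] (by intro i; fin_cases i <;> simp [hφ]; exact fun _ _ => rfl)
      simp [mukai_zero_right] at this
      rw [sub_eq_add_neg, ← neg_one_smul ℝ, mukai_add_left, mukai_smul_left, mukai_smul_left, this]
      ring
  · rw [← sub_eq_zero]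
    refine mukai_nondegenerate (fun k hk => ?_) fun φ hφ => ?_
    · simp [h.1 1 k hk, ((heven 0).clifford (vTwo μ ρ)) k hk]
    · have := key ![φ, 0] (by intro i; fin_cases i <;> simp [hφ]; exact fun _ _ => rfl)
      simp [mukai_zero_right] at this
      rw [sub_eq_add_neg, ← neg_one_smul ℝ, mukai_add_left, mukai_smul_left, mukai_smul_left, this]
      ring

end Hat

section Relations
variable {μ : V5 [⋀^Fin 5]→L[ℝ] ℝ} {ρ : Fin 2 → MixedForm V5} {σ : ℝ}

/-- The algebraic relations between `v₁`, `h`, `v₂` and the pair `ρ = (α, β)`; the number `N` is the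
coefficient of the volume form `φ(ρ)`. -/
structure Relations (σ N : ℝ) (α β : MixedForm V5) (v₁ h v₂ : GenVec V5) : Prop where
  act₁ : clifford v₁ α = 0
  act₂ : clifford v₂ β = 0
  mid₁ : clifford v₁ β = (-2 : ℝ) • clifford h α
  mid₂ : clifford v₂ α = (-2 : ℝ) • clifford h β
  p₁ : ∀ e, N * pairing v₁ e = mukai (clifford e α) α e5
  ph : ∀ e, N * pairing h e = mukai (clifford e α) β e5
  p₂ : ∀ e, N * pairing v₂ e = mukai (clifford e β) β e5
  v₁v₁ : pairing v₁ v₁ = 0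
  v₂v₂ : pairing v₂ v₂ = 0
  hv₁ : pairing h v₁ = 0
  hv₂ : pairing h v₂ = 0
  v₁v₂ : pairing v₁ v₂ = -σ
  hh : pairing h h = σ / 2

/-- The sections attached to a pair in an open orbit satisfy `Relations`. The Clifford relations are
the cubic identity and its polarization; they imply the inner products, except for
`(v₁, v₂) = -σ`, which is the normalization of the volume form. -/
lemma relations (hμ : μ e5 ≠ 0) (hσ : σ = 1 ∨ σ = -1)
    (hs : σ * quartic μ ρ < 0) (heven : ∀ i, IsEven (ρ i)) :
    Relations σ (volForm μ ρ e5) (ρ 0) (ρ 1) (vOne μ ρ) (hMid μ ρ) (vTwo μ ρ) := by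
  have hN := volForm_e5_ne_zero hμ hs
  have hq : quartic μ ρ ≠ 0 := by rintro h; simp [h] at hs
  have hr : √|quartic μ ρ| ≠ 0 := by simp [Real.sqrt_eq_zero, hq]
  have act₁ : clifford (vOne μ ρ) (ρ 0) = 0 := clifford_bilin_self _ (heven 0)
  have act₂ : clifford (vTwo μ ρ) (ρ 1) = 0 := clifford_bilin_self _ (heven 1)
  have mid₁ : clifford (vOne μ ρ) (ρ 1) = (-2 : ℝ) • clifford (hMid μ ρ) (ρ 0) :=
    clifford_bilin_polar hN (heven 0) (heven 1)
  have mid₂ : clifford (vTwo μ ρ) (ρ 0) = (-2 : ℝ) • clifford (hMid μ ρ) (ρ 1) := by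
    rw [hMid, bilin_comm hN]
    exact clifford_bilin_polar hN (heven 1) (heven 0)
  have p₁ : ∀ e, volForm μ ρ e5 * pairing (vOne μ ρ) e = mukai (clifford e (ρ 0)) (ρ 0) e5 :=
    fun e => by rw [mul_comm]; exact pairing_bilin _ hN _ _ _
  have ph : ∀ e, volForm μ ρ e5 * pairing (hMid μ ρ) e = mukai (clifford e (ρ 0)) (ρ 1) e5 :=
    fun e => by rw [mul_comm]; exact pairing_bilin _ hN _ _ _
  have p₂ : ∀ e, volForm μ ρ e5 * pairing (vTwo μ ρ) e = mukai (clifford e (ρ 1)) (ρ 1) e5 :=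
    fun e => by rw [mul_comm]; exact pairing_bilin _ hN _ _ _
  have hv₁ : pairing (hMid μ ρ) (vOne μ ρ) = 0 := by
    apply mul_left_cancel₀ hN
    rw [ph, act₁, mukai_zero_left, mul_zero]
  have hv₂ : pairing (hMid μ ρ) (vTwo μ ρ) = 0 := by
    apply mul_left_cancel₀ hN
    rw [ph, mukai_clifford_symm, act₂, mukai_zero_left, mul_zero]
  have v₁v₂ : pairing (vOne μ ρ) (vTwo μ ρ) = -σ := by
    have : pairing (vOne μ ρ) (vTwo μ ρ) = quartic μ ρ / |quartic μ ρ| := by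
      rw [vOne, vTwo, volForm, bilin_smul_form hμ hr, bilin_smul_form hμ hr, pairing_smul_left,
        pairing_smul_right, ← Real.mul_self_sqrt (abs_nonneg (quartic μ ρ))]
      simp only [Real.sqrt_mul_self, Real.sqrt_nonneg]
      rw [quartic]
      field_simp
    rw [this, abs_quartic hσ hs]
    rcases hσ with rfl | rfl <;> field_simp
  refine ⟨act₁, act₂, mid₁, mid₂, p₁, ph, p₂, ?_, ?_, hv₁, hv₂, v₁v₂, ?_⟩
  · apply mul_left_cancel₀ hN
    rw [p₁, act₁, mukai_zero_left, mul_zero]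
  · apply mul_left_cancel₀ hN
    rw [p₂, act₂, mukai_zero_left, mul_zero]
  · have h1 := p₂ (vOne μ ρ)
    rw [mid₁, mukai_smul_left, ← ph, pairing_comm, v₁v₂] at h1
    apply mul_left_cancel₀ hN
    linarith

end Relations

/-! ### Lie derivatives and Dorfman brackets in terms of 1-jets -/

section LieDerivative

/-- The exterior derivative `d = ∑ εⁱ ∧ ∂ᵢ`, where `Dα` is the derivative of a form at a point. -/
def dirac (Dα : V5 → MixedForm V5) : MixedForm V5 := ∑ i, clifford (ε i) (Dα (e5 i))

/-- The Dorfman bracket of two sections of `T ⊕ T*`, in terms of their 1-jets. It differs from the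
Courant bracket by the differential of the inner product of the sections (see
`dorfman_eq_courantJet`) and satisfies the Leibniz rule `mukai_lieJet`. -/
def dorfman (a : GenVec V5) (Da : V5 →ₗ[ℝ] GenVec V5) (b : GenVec V5) (Db : V5 →ₗ[ℝ] GenVec V5) :
    GenVec V5 :=
  Db a.1 - Da b.1 + (2 : ℝ) • ∑ i, pairing (Da (e5 i)) b • ε i

lemma two_mul_pairing_ε (a : GenVec V5) (i : Fin 5) : 2 * pairing (ε i) a = a.1 i := by
  simp [pairing, ε]; ring

lemma map_eq_sum_e5 {W : Type*} [AddCommGroup W] [Module ℝ W] (L : V5 →ₗ[ℝ] W) (X : V5) :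
    L X = ∑ i, X i • L (e5 i) := by
  conv_lhs => rw [vec_eq_sum X]
  simp

/-- The Lie derivative `L_a α = d(a · α)` of a closed form, in terms of 1-jets. -/
def lieJet (a : GenVec V5) (Da : V5 →ₗ[ℝ] GenVec V5) (α : MixedForm V5)
    (Dα : V5 →ₗ[ℝ] MixedForm V5) : MixedForm V5 :=
  dirac fun X => clifford (Da X) α + clifford a (Dα X)

/-- For a closed form, `L_a α` is the derivative of `α` along the vector part of `a` plus a zeroth
order term in `α`. -/
lemma lieJet_eq {a : GenVec V5} {Da : V5 →ₗ[ℝ] GenVec V5} {α : MixedForm V5}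
    {Dα : V5 →ₗ[ℝ] MixedForm V5} (hα : dirac Dα = 0) :
    lieJet a Da α Dα = ∑ i, clifford (ε i) (clifford (Da (e5 i)) α) + Dα a.1 := by
  have h : ∀ i, clifford (ε i) (clifford a (Dα (e5 i))) =
      a.1 i • Dα (e5 i) - clifford a (clifford (ε i) (Dα (e5 i))) := by
    intro i
    rw [eq_sub_iff_add_eq, clifford_clifford_add, two_mul_pairing_ε]
  have h2 : ∑ i, clifford a (clifford (ε i) (Dα (e5 i))) = clifford a (dirac Dα) :=
    (map_sum (cliffordₗ a) _ _).symm
  simp only [lieJet, dirac, clifford_add_right, Finset.sum_add_distrib, h, Finset.sum_sub_distrib]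
  rw [h2, hα, clifford_zero_right, sub_zero, ← map_eq_sum_e5]

/-- The Leibniz rule for the Lie derivative: if `N ⊗ b = P(α, β)` with `α` and `β` closed, then
`P(L_a α, β) + P(α, L_a β)` is the Lie derivative of `N ⊗ b`, in which `b` is differentiated by the
Dorfman bracket with `a` and the density `N` by the vector part of `a`. -/
lemma mukai_lieJet {α β : MixedForm V5} {Dα Dβ : V5 →ₗ[ℝ] MixedForm V5} {b : GenVec V5}
    {Db : V5 →ₗ[ℝ] GenVec V5} {N : ℝ} {DN : V5 →ₗ[ℝ] ℝ} (a : GenVec V5) (Da : V5 →ₗ[ℝ] GenVec V5)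
    (hα : dirac Dα = 0) (hβ : dirac Dβ = 0)
    (h0 : ∀ e, N * pairing b e = mukai (clifford e α) β e5)
    (h1 : ∀ X e, DN X * pairing b e + N * pairing (Db X) e =
      mukai (clifford e (Dα X)) β e5 + mukai (clifford e α) (Dβ X) e5) (e : GenVec V5) :
    mukai (clifford e (lieJet a Da α Dα)) β e5 + mukai (clifford e α) (lieJet a Da β Dβ) e5 =
      N * pairing (dorfman a Da b Db) e + (DN a.1 + N * ∑ i, (Da (e5 i)).1 i) * pairing b e := by
  have hi : ∀ i, mukai (clifford e (clifford (ε i) (clifford (Da (e5 i)) α))) β e5 +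
      mukai (clifford e α) (clifford (ε i) (clifford (Da (e5 i)) β)) e5 =
      N * ((Da (e5 i)).1 i * pairing b e - b.1 i * pairing (Da (e5 i)) e +
        2 * (pairing (Da (e5 i)) b * pairing (ε i) e)) := by
    intro i
    set A := Da (e5 i)
    -- `A` and `ε i` are transferred from `β` to the first factor and then moved past `e`, by the
    -- Clifford relations
    have e1 : mukai (clifford e α) (clifford (ε i) (clifford A β)) e5 =
        mukai (clifford A (clifford (ε i) (clifford e α))) β e5 := by
      rw [mukai_clifford_symm', mukai_clifford_symm]
    have e2 : clifford A (clifford (ε i) (clifford e α)) =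
        (2 * pairing A (ε i)) • clifford e α - clifford (ε i) (clifford A (clifford e α)) := by
      rw [eq_sub_iff_add_eq, clifford_clifford_add]
    have e3 : clifford A (clifford e α) = (2 * pairing A e) • α - clifford e (clifford A α) := by
      rw [eq_sub_iff_add_eq, clifford_clifford_add]
    have e4 : clifford (ε i) (clifford e (clifford A α)) =
        (2 * pairing (ε i) e) • clifford A α - clifford e (clifford (ε i) (clifford A α)) := by
      rw [eq_sub_iff_add_eq, clifford_clifford_add]
    have e5' : clifford (ε i) ((2 * pairing A e) • α - clifford e (clifford A α)) =
        (2 * pairing A e) • clifford (ε i) α - clifford (ε i) (clifford e (clifford A α)) := by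
      rw [sub_eq_add_neg, ← neg_one_smul ℝ, clifford_add_right, clifford_smul_right,
        clifford_smul_right]
      module
    rw [e1, e2, e3, e5', e4]
    simp only [← mukaiₗ_apply, map_sub, map_smul, LinearMap.sub_apply, LinearMap.smul_apply,
      smul_eq_mul]
    simp only [mukaiₗ_apply, ← h0]
    rw [pairing_comm A (ε i), two_mul_pairing_ε, pairing_comm b (ε i), pairing_comm b A]
    linear_combination -N * pairing A e * two_mul_pairing_ε b i
  have hs := Finset.sum_congr rfl fun i (_ : i ∈ Finset.univ) => hi i
  rw [Finset.sum_add_distrib, ← mukai_sum_right, ← Finset.mul_sum] at hs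
  have hc : ∑ i, clifford e (clifford (ε i) (clifford (Da (e5 i)) α)) =
    clifford e (∑ i, clifford (ε i) (clifford (Da (e5 i)) α)) := (map_sum (cliffordₗ e) _ _).symm
  rw [← mukai_sum_left, hc] at hs
  rw [lieJet_eq hα, lieJet_eq hβ, clifford_add_right, mukai_add_left, mukai_add_right]
  have h1' := h1 a.1 e
  have hd : pairing (dorfman a Da b Db) e = pairing (Db a.1) e +
      ∑ i, (2 * (pairing (Da (e5 i)) b * pairing (ε i) e) - b.1 i * pairing (Da (e5 i)) e) := by
    rw [dorfman, map_eq_sum_e5 Da b.1, sub_eq_add_neg, ← neg_one_smul ℝ]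
    simp only [pairing_add_left, pairing_smul_left, pairing_sum_left, Finset.sum_sub_distrib,
      Finset.mul_sum, neg_one_mul, Finset.sum_neg_distrib]
    ring
  rw [hd]
  simp only [Finset.sum_add_distrib, Finset.sum_sub_distrib, ← Finset.sum_mul] at hs ⊢
  linear_combination hs - h1'

end LieDerivative

/-! ### The Courant bracket in terms of 1-jets -/

section CourantJet
variable {V : Type*} [NormedAddCommGroup V] [NormedSpace ℝ V]

lemma pairing_neg_left (a b : GenVec V) : pairing (-a) b = -pairing a b := by
  simp [pairing]; ring

lemma pairing_sub_left (a b c : GenVec V) : pairing (a - b) c = pairing a c - pairing b c := by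
  simp [pairing]; ring

/-- The pairing with a fixed vector, as a continuous linear map. -/
def pairingCLM (a : GenVec V) : GenVec V →L[ℝ] ℝ :=
  (1 / 2 : ℝ) • (a.2 ∘L ContinuousLinearMap.fst ℝ V (V →L[ℝ] ℝ) +
    ContinuousLinearMap.apply ℝ ℝ a.1 ∘L ContinuousLinearMap.snd ℝ V (V →L[ℝ] ℝ))

@[simp] lemma pairingCLM_apply (a b : GenVec V) : pairingCLM a b = pairing a b := by
  simp [pairingCLM, pairing]; ring

/-- The Courant bracket of two sections of `T ⊕ T*` of a vector space, in terms of their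
1-jets. -/
def courantJet (a : GenVec V) (Da : V →L[ℝ] GenVec V) (b : GenVec V) (Db : V →L[ℝ] GenVec V) :
    GenVec V :=
  Db a.1 - Da b.1 + (0, pairingCLM b ∘L Da - pairingCLM a ∘L Db)

/-- The components of the Courant bracket. Identities between Courant brackets are proved by
comparing these. -/
lemma pairing_courantJet (a : GenVec V) (Da : V →L[ℝ] GenVec V) (b : GenVec V)
    (Db : V →L[ℝ] GenVec V) (e : GenVec V) : pairing (courantJet a Da b Db) e =
      pairing (Db a.1) e - pairing (Da b.1) e +
        (pairing (Da e.1) b - pairing a (Db e.1)) / 2 := by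
  simp [courantJet, pairing]; ring

lemma courantJet_self (a : GenVec V) (Da : V →L[ℝ] GenVec V) : courantJet a Da a Da = 0 := by
  simp [courantJet]

end CourantJet

/-- The Dorfman and the Courant bracket agree on sections whose inner product is constant. -/
lemma dorfman_eq_courantJet {a b : GenVec V5} {Da Db : V5 →L[ℝ] GenVec V5}
    (h : ∀ X, pairing (Da X) b + pairing a (Db X) = 0) :
    dorfman a Da b Db = courantJet a Da b Db := by
  refine eq_of_pairing_eq fun e => ?_
  have h1 : pairing (Da e.1) b = ∑ i, e.1 i * pairing (Da (e5 i)) b := by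
    have := map_eq_sum_e5 (Da : V5 →ₗ[ℝ] GenVec V5) e.1
    simp only [ContinuousLinearMap.coe_coe] at this
    rw [this]; simp only [pairing_sum_left, pairing_smul_left]
  have h2 : ∀ i, 2 * (pairing (Da (e5 i)) b * pairing (ε i) e) = e.1 i * pairing (Da (e5 i)) b :=
    fun i => by rw [← two_mul_pairing_ε]; ring
  rw [pairing_courantJet, dorfman]
  simp only [pairing_add_left, pairing_sub_left, pairing_smul_left, pairing_sum_left,
    ContinuousLinearMap.coe_coe, Finset.mul_sum, h2, ← h1]
  linear_combination (1 / 2) * h e.1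

lemma dorfman_swap {a b : GenVec V5} {Da Db : V5 →L[ℝ] GenVec V5}
    (h : ∀ X, pairing (Da X) b + pairing a (Db X) = 0) :
    dorfman b Db a Da = - dorfman a Da b Db := by
  rw [dorfman_eq_courantJet h, dorfman_eq_courantJet fun X => by
    rw [pairing_comm, pairing_comm b, add_comm]; exact h X]
  refine eq_of_pairing_eq fun e => ?_
  rw [pairing_neg_left, pairing_courantJet, pairing_courantJet,
    pairing_comm _ a, pairing_comm b]
  ring

/-! ### The Nahm-type equations at a point -/

/-- First-order variation of `Relations`, with `σ` constant: primes denote derivatives in one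
direction of space or time. -/
structure Variation (N : ℝ) (α β : MixedForm V5) (v₁ h v₂ : GenVec V5)
    (N' : ℝ) (α' β' : MixedForm V5) (v₁' h' v₂' : GenVec V5) : Prop where
  act₁ : clifford v₁' α + clifford v₁ α' = 0
  act₂ : clifford v₂' β + clifford v₂ β' = 0
  mid₁ : clifford v₁' β + clifford v₁ β' = (-2 : ℝ) • (clifford h' α + clifford h α')
  mid₂ : clifford v₂' α + clifford v₂ α' = (-2 : ℝ) • (clifford h' β + clifford h β')
  p₁ : ∀ e, N' * pairing v₁ e + N * pairing v₁' e =
    mukai (clifford e α') α e5 + mukai (clifford e α) α' e5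
  ph : ∀ e, N' * pairing h e + N * pairing h' e =
    mukai (clifford e α') β e5 + mukai (clifford e α) β' e5
  p₂ : ∀ e, N' * pairing v₂ e + N * pairing v₂' e =
    mukai (clifford e β') β e5 + mukai (clifford e β) β' e5
  v₁v₁ : pairing v₁' v₁ + pairing v₁ v₁' = 0
  v₂v₂ : pairing v₂' v₂ + pairing v₂ v₂' = 0
  hv₁ : pairing h' v₁ + pairing h v₁' = 0
  hv₂ : pairing h' v₂ + pairing h v₂' = 0
  v₁v₂ : pairing v₁' v₂ + pairing v₁ v₂' = 0
  hh : pairing h' h + pairing h h' = 0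

lemma dirac_smul (c : ℝ) (D : V5 → MixedForm V5) : dirac (fun X => c • D X) = c • dirac D := by
  simp only [dirac, clifford_smul_right, Finset.smul_sum]

lemma lieJet_eq_zero {a : GenVec V5} {Da : V5 →ₗ[ℝ] GenVec V5} {α : MixedForm V5}
    {Dα : V5 →ₗ[ℝ] MixedForm V5} (h : ∀ X, clifford (Da X) α + clifford a (Dα X) = 0) :
    lieJet a Da α Dα = 0 := by
  simp [lieJet, dirac, h, clifford_zero_right]

/-- If `P(γ, γ) = N ⊗ v` for a closed form `γ` with `v · γ = 0` and `(v, v) = 0`, then the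
divergence of `N ⊗ v` vanishes: in the Leibniz rule for `L_v` both `L_v γ = d(v · γ)` and `[v, v]`
are zero. -/
lemma divergence_eq_zero {N : ℝ} {γ : MixedForm V5} {v : GenVec V5} {DN : V5 →ₗ[ℝ] ℝ}
    {Dγ : V5 →ₗ[ℝ] MixedForm V5} {Dv : V5 →L[ℝ] GenVec V5} (hγ : dirac Dγ = 0)
    (p : ∀ e, N * pairing v e = mukai (clifford e γ) γ e5)
    (Dp : ∀ X e, DN X * pairing v e + N * pairing (Dv X) e =
      mukai (clifford e (Dγ X)) γ e5 + mukai (clifford e γ) (Dγ X) e5)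
    (Dact : ∀ X, clifford (Dv X) γ + clifford v (Dγ X) = 0)
    (Dvv : ∀ X, pairing (Dv X) v + pairing v (Dv X) = 0) {e : GenVec V5} (he : pairing v e ≠ 0) :
    DN v.1 + N * ∑ i, (Dv (e5 i)).1 i = 0 := by
  have key := mukai_lieJet v (Dv : V5 →ₗ[ℝ] GenVec V5) (Db := (Dv : V5 →ₗ[ℝ] GenVec V5))
    hγ hγ p Dp e
  rw [lieJet_eq_zero Dact, clifford_zero_right, mukai_zero_left, mukai_zero_right,
    dorfman_eq_courantJet Dvv, courantJet_self, pairing_zero_left] at key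
  simpa [he] using key

/-- The Nahm-type equations at a point, as a consequence of the 1-jet of the relations. The defining
equations of `v₁`, `h`, `v₂` are differentiated in time; on the right hand sides appear the Lie
derivatives `α' = -2σ L_h α` and `β' = 2σ L_h β`, and the Leibniz rule turns them into brackets. For
`h'` the Lie derivatives along `h` are first exchanged for those along `v₁` and `v₂`, by the
relations `v₁ · β = -2 h · α` and `v₂ · α = -2 h · β`. -/
theorem nahm_jet {σ N N' : ℝ} {α β α' β' : MixedForm V5} {v₁ h v₂ v₁' h' v₂' : GenVec V5}
    {DN : V5 →ₗ[ℝ] ℝ} {Dα Dβ : V5 →ₗ[ℝ] MixedForm V5} {Dv₁ Dh Dv₂ : V5 →L[ℝ] GenVec V5}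
    (hσ : σ = 1 ∨ σ = -1) (hN : N ≠ 0) (R : Relations σ N α β v₁ h v₂)
    (hX : ∀ X, Variation N α β v₁ h v₂ (DN X) (Dα X) (Dβ X) (Dv₁ X) (Dh X) (Dv₂ X))
    (ht : Variation N α β v₁ h v₂ N' α' β' v₁' h' v₂')
    (hα : dirac Dα = 0) (hβ : dirac Dβ = 0)
    (hα' : α' = (-2 * σ) • lieJet h Dh α Dα) (hβ' : β' = (2 * σ) • lieJet h Dh β Dβ) :
    v₁' = -(2 * σ) • courantJet h Dh v₁ Dv₁ + (-N' / N) • v₁ ∧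
    h' = σ • courantJet v₁ Dv₁ v₂ Dv₂ + (-N' / N) • h ∧
    v₂' = (2 * σ) • courantJet h Dh v₂ Dv₂ + (-N' / N) • v₂ := by
  have hσ0 : σ ≠ 0 := by rcases hσ with rfl | rfl <;> norm_num
  have sym : ∀ (e : GenVec V5) (φ ψ : MixedForm V5),
      mukai (clifford e φ) ψ e5 = mukai (clifford e ψ) φ e5 := mukai_clifford_symm
  -- the divergence of `φ ⊗ v₁`, `φ ⊗ v₂` and `φ ⊗ (v₁ + 2h + v₂)`, which belong to the closed forms
  -- `α`, `β` and `α + β`, vanishes, hence so does that of `φ ⊗ h`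
  have δ₁ : DN v₁.1 + N * ∑ i, (Dv₁ (e5 i)).1 i = 0 :=
    divergence_eq_zero hα R.p₁ (fun X => (hX X).p₁) (fun X => (hX X).act₁) (fun X => (hX X).v₁v₁)
      (e := v₂) (by rw [R.v₁v₂]; exact neg_ne_zero.2 hσ0)
  have δ₂ : DN v₂.1 + N * ∑ i, (Dv₂ (e5 i)).1 i = 0 :=
    divergence_eq_zero hβ R.p₂ (fun X => (hX X).p₂) (fun X => (hX X).act₂) (fun X => (hX X).v₂v₂)
      (e := v₁) (by rw [pairing_comm, R.v₁v₂]; exact neg_ne_zero.2 hσ0)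
  have δ₃ : DN v₁.1 + 2 * DN h.1 + DN v₂.1 + N * (∑ i, (Dv₁ (e5 i)).1 i +
      2 * ∑ i, (Dh (e5 i)).1 i + ∑ i, (Dv₂ (e5 i)).1 i) = 0 := by
    obtain ⟨v, hv⟩ : ∃ v, v = v₁ + (2 : ℝ) • h + v₂ := ⟨_, rfl⟩
    obtain ⟨Dv, hDv'⟩ : ∃ Dv, Dv = Dv₁ + (2 : ℝ) • Dh + Dv₂ := ⟨_, rfl⟩
    obtain ⟨Dγ, hDγ'⟩ : ∃ Dγ, Dγ = Dα + Dβ := ⟨_, rfl⟩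
    have hDv : ∀ X, Dv X = Dv₁ X + (2 : ℝ) • Dh X + Dv₂ X := fun X => by simp [hDv']
    have hDγ : ∀ X, Dγ X = Dα X + Dβ X := fun X => by simp [hDγ']
    have hγ : dirac Dγ = 0 := by
      rw [← add_zero (0 : MixedForm V5)]
      nth_rewrite 1 [← hα]
      rw [← hβ]
      simp [dirac, hDγ, clifford_add_right, Finset.sum_add_distrib]
    have key : DN v.1 + N * ∑ i, (Dv (e5 i)).1 i = 0 := by
      refine divergence_eq_zero (γ := α + β) (e := h) hγ ?_ ?_ ?_ ?_ ?_
      · intro e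
        simp only [hv, pairing_add_left, pairing_smul_left, clifford_add_right, mukai_add_left,
          mukai_add_right]
        linear_combination R.p₁ e + 2 * R.ph e + R.p₂ e + sym e α β
      · intro X e
        simp only [hv, hDv, hDγ, pairing_add_left, pairing_smul_left, clifford_add_right,
          mukai_add_left, mukai_add_right]
        linear_combination (hX X).p₁ e + 2 * (hX X).ph e + (hX X).p₂ e + sym e α (Dβ X)
          + sym e (Dα X) β
      · intro X
        have m₁ := (hX X).mid₁
        have m₂ := (hX X).mid₂
        have a₁ := (hX X).act₁
        have a₂ := (hX X).act₂
        simp only [hv, hDv, hDγ, clifford_add_left, clifford_smul_left, clifford_add_right]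
        calc _ = (clifford (Dv₁ X) α + clifford v₁ (Dα X)) +
              (clifford (Dv₂ X) β + clifford v₂ (Dβ X))
              + (clifford (Dv₁ X) β + clifford v₁ (Dβ X))
              + (clifford (Dv₂ X) α + clifford v₂ (Dα X))
              + (2 : ℝ) • (clifford (Dh X) α + clifford h (Dα X))
              + (2 : ℝ) • (clifford (Dh X) β + clifford h (Dβ X)) := by module
          _ = 0 := by rw [m₁, m₂, a₁, a₂]; module
      · intro X
        have q₁ := (hX X).hv₁
        have q₂ := (hX X).hv₂
        have q₃ := (hX X).v₁v₂
        have q₄ := (hX X).v₁v₁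
        have q₅ := (hX X).v₂v₂
        have q₆ := (hX X).hh
        simp only [hv, hDv, pairing_add_left, pairing_smul_left, pairing_add_right,
          pairing_smul_right]
        rw [pairing_comm h (Dv₁ X)] at q₁
        rw [pairing_comm h (Dv₂ X)] at q₂
        rw [pairing_comm v₁ (Dv₂ X)] at q₃
        rw [pairing_comm h (Dh X)] at q₆
        rw [pairing_comm v₁ (Dv₁ X)] at q₄
        rw [pairing_comm v₂ (Dv₂ X)] at q₅
        rw [pairing_comm v₁ (Dv₁ X), pairing_comm v₁ (Dv₂ X), pairing_comm v₁ (Dh X),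
          pairing_comm v₂ (Dv₁ X), pairing_comm v₂ (Dv₂ X), pairing_comm v₂ (Dh X),
          pairing_comm h (Dv₁ X), pairing_comm h (Dv₂ X), pairing_comm h (Dh X)]
        linear_combination q₄ + q₅ + 4 * q₆ + 4 * q₁ + 4 * q₂ + 2 * q₃
      · have hh : pairing v h = σ := by
          simp only [hv, pairing_add_left, pairing_smul_left, R.hh, pairing_comm v₁ h,
            pairing_comm v₂ h, R.hv₁, R.hv₂]
          ring
        rw [hh]; exact hσ0
    rw [← key]
    simp only [hv, hDv, Prod.fst_add, Prod.smul_fst, map_add, map_smul,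
      PiLp.add_apply, PiLp.smul_apply, smul_eq_mul, Finset.sum_add_distrib, ← Finset.mul_sum]
  have δh : DN h.1 + N * ∑ i, (Dh (e5 i)).1 i = 0 := by
    linear_combination (δ₃ - δ₁ - δ₂) / 2
  -- the two middle relations, differentiated
  have l₁ : lieJet v₁ Dv₁ β Dβ = (-2 : ℝ) • lieJet h Dh α Dα := by
    unfold lieJet
    rw [← dirac_smul]
    congr 1
    funext X
    exact (hX X).mid₁
  have l₂ : lieJet v₂ Dv₂ α Dα = (-2 : ℝ) • lieJet h Dh β Dβ := by
    unfold lieJet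
    rw [← dirac_smul]
    congr 1
    funext X
    exact (hX X).mid₂
  refine ⟨eq_of_pairing_eq fun e => mul_left_cancel₀ hN ?_,
    eq_of_pairing_eq fun e => mul_left_cancel₀ hN ?_,
    eq_of_pairing_eq fun e => mul_left_cancel₀ hN ?_⟩
  · have key := mukai_lieJet (a := h) (Da := (Dh : V5 →ₗ[ℝ] GenVec V5)) (b := v₁)
      (Db := (Dv₁ : V5 →ₗ[ℝ] GenVec V5)) (N := N) (DN := DN) hα hα R.p₁ (fun X e => (hX X).p₁ e) e
    rw [dorfman_eq_courantJet fun X => (hX X).hv₁] at key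
    have t := ht.p₁ e
    rw [hα', clifford_smul_right, mukai_smul_left, mukai_smul_right] at t
    simp only [ContinuousLinearMap.coe_coe] at key
    rw [δh] at key
    simp only [pairing_add_left, pairing_smul_left]
    field_simp
    linear_combination t - 2 * σ * key
  · have key₁ := mukai_lieJet (a := v₁) (Da := (Dv₁ : V5 →ₗ[ℝ] GenVec V5)) (b := v₂)
      (Db := (Dv₂ : V5 →ₗ[ℝ] GenVec V5)) (N := N) (DN := DN) hβ hβ R.p₂ (fun X e => (hX X).p₂ e) e
    have key₂ := mukai_lieJet (a := v₂) (Da := (Dv₂ : V5 →ₗ[ℝ] GenVec V5)) (b := v₁)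
      (Db := (Dv₁ : V5 →ₗ[ℝ] GenVec V5)) (N := N) (DN := DN) hα hα R.p₁ (fun X e => (hX X).p₁ e) e
    rw [dorfman_swap fun X => (hX X).v₁v₂] at key₂
    rw [dorfman_eq_courantJet fun X => (hX X).v₁v₂] at key₁ key₂
    simp only [ContinuousLinearMap.coe_coe] at key₁ key₂
    rw [l₂, δ₂, clifford_smul_right, mukai_smul_left, mukai_smul_right,
      pairing_neg_left] at key₂
    rw [l₁, δ₁, clifford_smul_right, mukai_smul_left, mukai_smul_right] at key₁
    have t := ht.ph e
    rw [hα', hβ', clifford_smul_right, mukai_smul_left, mukai_smul_right] at t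
    simp only [pairing_add_left, pairing_smul_left]
    field_simp
    have x₁ := sym e β (lieJet h Dh α Dα)
    have x₂ := sym e α (lieJet h Dh β Dβ)
    linear_combination t + σ / 2 * key₁ - σ / 2 * key₂ + σ * x₁ + σ * x₂
  · have key := mukai_lieJet (a := h) (Da := (Dh : V5 →ₗ[ℝ] GenVec V5)) (b := v₂)
      (Db := (Dv₂ : V5 →ₗ[ℝ] GenVec V5)) (N := N) (DN := DN) hβ hβ R.p₂ (fun X e => (hX X).p₂ e) e
    rw [dorfman_eq_courantJet fun X => (hX X).hv₂] at key
    have t := ht.p₂ e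
    rw [hβ', clifford_smul_right, mukai_smul_left, mukai_smul_right] at t
    simp only [ContinuousLinearMap.coe_coe] at key
    rw [δh] at key
    simp only [pairing_add_left, pairing_smul_left]
    field_simp
    linear_combination t + 2 * σ * key

/-! ### Derivatives of form-valued functions -/

lemma HasFDerivAt.clm_comp {W F G : Type*} [NormedAddCommGroup W] [NormedSpace ℝ W]
    [NormedAddCommGroup F] [NormedSpace ℝ F] [NormedAddCommGroup G] [NormedSpace ℝ G]
    {f : W → F} {f' : W →L[ℝ] F} {x : W} (L : F →L[ℝ] G) (h : HasFDerivAt f f' x) :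
    HasFDerivAt (fun y => L (f y)) (L ∘L f') x :=
  (ContinuousLinearMap.hasFDerivAt L).comp x h

lemma HasFDerivAt.smulRight_clm {V W F : Type*} [NormedAddCommGroup V] [NormedSpace ℝ V]
    [NormedAddCommGroup W] [NormedSpace ℝ W] [NormedAddCommGroup F] [NormedSpace ℝ F]
    {c : W → V →L[ℝ] ℝ} {c' : W →L[ℝ] V →L[ℝ] ℝ} {f : W → F} {f' : W →L[ℝ] F} {x : W}
    (hc : HasFDerivAt c c' x) (hf : HasFDerivAt f f' x) :
    ∃ L : W →L[ℝ] V →L[ℝ] F, HasFDerivAt (fun y => (c y).smulRight (f y)) L x ∧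
      ∀ X, L X = (c' X).smulRight (f x) + (c x).smulRight (f' X) := by
  have h := HasFDerivAt.clm_apply (HasFDerivAt.clm_comp (F := V →L[ℝ] ℝ) (G := F →L[ℝ] V →L[ℝ] F)
    (ContinuousLinearMap.smulRightL ℝ V F) hc) hf
  exact ⟨_, h, fun X => by simp [add_comm]⟩

section Derivatives
variable {V : Type*} [NormedAddCommGroup V] [NormedSpace ℝ V]
  {W : Type*} [NormedAddCommGroup W] [NormedSpace ℝ W]

/-- The form-valued function `φ` is differentiable at `x`, in each degree, with derivative `φ'`.
The space `MixedForm V` is a product over all degrees and carries no norm, so that `HasFDerivAt` is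
used degree by degree and `φ'` is merely linear. -/
def HasFormDerivAt (φ : W → MixedForm V) (φ' : W →ₗ[ℝ] MixedForm V) (x : W) : Prop :=
  ∀ k, ∃ L : W →L[ℝ] V [⋀^Fin k]→L[ℝ] ℝ, HasFDerivAt (fun y => φ y k) L x ∧ ∀ X, L X = φ' X k

/-- The Leibniz rule for the Clifford action. -/
lemma HasFormDerivAt.clifford {a : W → GenVec V} {a' : W →L[ℝ] GenVec V} {φ : W → MixedForm V}
    {φ' : W →ₗ[ℝ] MixedForm V} {x : W} (ha : HasFDerivAt a a' x) (hφ : HasFormDerivAt φ φ' x) :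
    HasFormDerivAt (fun y => GenGeom.clifford (a y) (φ y))
      (cliffordₗ.flip (φ x) ∘ₗ (a' : W →ₗ[ℝ] GenVec V) + cliffordₗ (a x) ∘ₗ φ') x := by
  have hc : ∀ k, ∃ L : W →L[ℝ] V [⋀^Fin k]→L[ℝ] ℝ,
      HasFDerivAt (fun y => (φ y (k + 1)).curryLeft (a y).1) L x ∧
      ∀ X, L X = (φ x (k + 1)).curryLeft (a' X).1 + (φ' X (k + 1)).curryLeft (a x).1 := by
    intro k
    obtain ⟨L, hL, hL'⟩ := hφ (k + 1)
    have h1 :=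
      HasFDerivAt.clm_comp (F := V [⋀^Fin (k + 1)]→L[ℝ] ℝ)
        (G := V →L[ℝ] V [⋀^Fin k]→L[ℝ] ℝ) (ContinuousAlternatingMap.curryLeftLI (𝕜 := ℝ) (E := V)
          (F := ℝ) (n := k)).toContinuousLinearMap hL
    refine ⟨_, h1.clm_apply ha.fst, fun X => ?_⟩
    simp [hL']
  have hw : ∀ k, ∃ L : W →L[ℝ] V [⋀^Fin (k + 1)]→L[ℝ] ℝ,
      HasFDerivAt (fun y => wedgeOne (a y).2 (φ y k)) L x ∧
      ∀ X, L X = wedgeOne (a' X).2 (φ x k) + wedgeOne (a x).2 (φ' X k) := by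
    intro k
    obtain ⟨L, hL, hL'⟩ := hφ k
    obtain ⟨L₁, h1, h1'⟩ := HasFDerivAt.smulRight_clm (F := V [⋀^Fin k]→L[ℝ] ℝ) ha.snd hL
    have h2 :=
      HasFDerivAt.clm_comp (F := V →L[ℝ] V [⋀^Fin k]→L[ℝ] ℝ)
        (G := V [⋀^Fin (k + 1)]→L[ℝ] ℝ)
        (ContinuousAlternatingMap.alternatizeUncurryFinCLM ℝ V ℝ (n := k)) h1
    refine ⟨_, h2, fun X => ?_⟩
    simp [h1', hL', wedgeOne, ContinuousAlternatingMap.alternatizeUncurryFin_add]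
  intro k
  cases k with
  | zero =>
    obtain ⟨L, hL, hL'⟩ := hc 0
    exact ⟨L, hL, fun X => by rw [hL']; rfl⟩
  | succ k =>
    obtain ⟨L, hL, hL'⟩ := hc (k + 1)
    obtain ⟨L₂, hL₂, hL₂'⟩ := hw k
    refine ⟨L + L₂, hL.add hL₂, fun X => ?_⟩
    rw [add_apply, hL', hL₂']
    simp [GenGeom.clifford]
    abel

lemma HasFormDerivAt.const_clifford {φ : W → MixedForm V} {φ' : W →ₗ[ℝ] MixedForm V} {x : W}
    (e : GenVec V) (hφ : HasFormDerivAt φ φ' x) :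
    HasFormDerivAt (fun y => GenGeom.clifford e (φ y)) (cliffordₗ e ∘ₗ φ') x := by
  have := HasFormDerivAt.clifford (hasFDerivAt_const e x) hφ
  simpa using this

lemma HasFormDerivAt.const_smul {φ : W → MixedForm V} {φ' : W →ₗ[ℝ] MixedForm V} {x : W}
    (c : ℝ) (hφ : HasFormDerivAt φ φ' x) : HasFormDerivAt (fun y => c • φ y) (c • φ') x := by
  intro k
  obtain ⟨L, hL, hL'⟩ := hφ k
  exact ⟨c • L, hL.const_smul c, fun X => by simp [hL']⟩

lemma HasFormDerivAt.congr {φ ψ : W → MixedForm V} {φ' : W →ₗ[ℝ] MixedForm V} {x : W}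
    (hφ : HasFormDerivAt φ φ' x) (h : ψ =ᶠ[𝓝 x] φ) : HasFormDerivAt ψ φ' x := by
  intro k
  obtain ⟨L, hL, hL'⟩ := hφ k
  exact ⟨L, hL.congr_of_eventuallyEq (h.mono fun y hy => congrFun hy k), hL'⟩

lemma HasFormDerivAt.unique {φ : W → MixedForm V} {φ' ψ' : W →ₗ[ℝ] MixedForm V} {x : W}
    (hφ : HasFormDerivAt φ φ' x) (hψ : HasFormDerivAt φ ψ' x) (X : W) : φ' X = ψ' X := by
  funext k
  obtain ⟨L, hL, hL'⟩ := hφ k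
  obtain ⟨L₂, hL₂, hL₂'⟩ := hψ k
  rw [← hL', ← hL₂', hL.unique hL₂]

/-- The Leibniz rule for the Mukai pairing. -/
lemma HasFormDerivAt.mukai {φ ψ : W → MixedForm V5} {φ' ψ' : W →ₗ[ℝ] MixedForm V5} {x : W}
    (hφ : HasFormDerivAt φ φ' x) (hψ : HasFormDerivAt ψ ψ' x) :
    ∃ L : W →L[ℝ] ℝ, HasFDerivAt (fun y => GenGeom.mukai (φ y) (ψ y) e5) L x ∧
      ∀ X, L X = GenGeom.mukai (φ' X) (ψ x) e5 + GenGeom.mukai (φ x) (ψ' X) e5 := by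
  have ev : ∀ {k : ℕ} {χ : W → MixedForm V5} {χ' : W →ₗ[ℝ] MixedForm V5}
      (_ : HasFormDerivAt χ χ' x) (v : Fin k → V5), ∃ L : W →L[ℝ] ℝ,
      HasFDerivAt (fun y => χ y k v) L x ∧ ∀ X, L X = χ' X k v := by
    intro k χ χ' h v
    obtain ⟨L, hL, hL'⟩ := h k
    exact ⟨_, (ContinuousAlternatingMap.apply ℝ V5 ℝ v).hasFDerivAt.comp x hL, fun X => by
      simp [hL']⟩
  have pr : ∀ {k l : ℕ} (v : Fin k → V5) (w : Fin l → V5), ∃ L : W →L[ℝ] ℝ,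
      HasFDerivAt (fun y => φ y k v * ψ y l w) L x ∧
        ∀ X, L X = φ' X k v * ψ x l w + φ x k v * ψ' X l w := by
    intro k l v w
    obtain ⟨L, hL, hL'⟩ := ev hφ v
    obtain ⟨L₂, hL₂, hL₂'⟩ := ev hψ w
    exact ⟨_, hL.mul hL₂, fun X => by simp [hL', hL₂']; ring⟩
  choose D hD hD' using @pr
  simp only [mukai_e5, co0, co1, co2, co3, co4, co5]
  refine ⟨_, (((((hD _ _).sub (hD _ _)).add (hD _ _)).sub (hD _ _)).add (hD _ _)).sub
    ((((((((((hD _ _).sub (hD _ _)).add (hD _ _)).add (hD _ _)).sub (hD _ _)).add (hD _ _)).sub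
      (hD _ _)).add (hD _ _)).sub (hD _ _)).add (hD _ _)) |>.add (hD _ _), fun X => ?_⟩
  simp only [add_apply, sub_apply, hD']
  ring

end Derivatives

section VariationOfRelations
variable {W : Type*} [NormedAddCommGroup W] [NormedSpace ℝ W]

/-- Relations that hold near a point vary to first order as recorded in `Variation`. -/
lemma variation_of_eventually {σ : ℝ} {N : W → ℝ} {α β : W → MixedForm V5}
    {v₁ h v₂ : W → GenVec V5} {N' : W →L[ℝ] ℝ} {α' β' : W →ₗ[ℝ] MixedForm V5}
    {v₁' h' v₂' : W →L[ℝ] GenVec V5} {x : W}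
    (R : ∀ᶠ y in 𝓝 x, Relations σ (N y) (α y) (β y) (v₁ y) (h y) (v₂ y))
    (hN : HasFDerivAt N N' x) (hα : HasFormDerivAt α α' x) (hβ : HasFormDerivAt β β' x)
    (hv₁ : HasFDerivAt v₁ v₁' x) (hh : HasFDerivAt h h' x) (hv₂ : HasFDerivAt v₂ v₂' x) (X : W) :
    Variation (N x) (α x) (β x) (v₁ x) (h x) (v₂ x) (N' X) (α' X) (β' X) (v₁' X) (h' X)
      (v₂' X) := by
  have hp : ∀ {a b : W → GenVec V5} {a' b' : W →L[ℝ] GenVec V5} {c : ℝ}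
      (_ : HasFDerivAt a a' x) (_ : HasFDerivAt b b' x)
      (_ : ∀ᶠ y in 𝓝 x, pairing (a y) (b y) = c),
      pairing (a' X) (b x) + pairing (a x) (b' X) = 0 := by
    intro a b a' b' c ha hb he
    obtain ⟨L, hL, hL'⟩ := HasFDerivAt.pairing ha hb
    rw [← hL', hL.unique ((hasFDerivAt_const c x).congr_of_eventuallyEq he)]
    rfl
  have hP : ∀ {a : W → GenVec V5} {a' : W →L[ℝ] GenVec V5} {φ ψ : W → MixedForm V5}
      {φ' ψ' : W →ₗ[ℝ] MixedForm V5} (_ : HasFDerivAt a a' x) (_ : HasFormDerivAt φ φ' x)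
      (_ : HasFormDerivAt ψ ψ' x) (e : GenVec V5)
      (_ : ∀ᶠ y in 𝓝 x, N y * pairing (a y) e = mukai (clifford e (φ y)) (ψ y) e5),
      N' X * pairing (a x) e + N x * pairing (a' X) e =
        mukai (clifford e (φ' X)) (ψ x) e5 + mukai (clifford e (φ x)) (ψ' X) e5 := by
    intro a a' φ ψ φ' ψ' ha hφ hψ e he
    obtain ⟨L, hL, hL'⟩ := (hφ.const_clifford e).mukai hψ
    obtain ⟨K, hK, hK'⟩ := HasFDerivAt.pairing ha (hasFDerivAt_const e x)
    have h1 := hL' X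
    rw [hL.unique ((hN.mul hK).congr_of_eventuallyEq (he.mono fun y hy => hy.symm))] at h1
    simp [hK', pairing] at h1
    refine Eq.trans ?_ h1
    simp only [pairing]; ring
  have hc : ∀ {a : W → GenVec V5} {a' : W →L[ℝ] GenVec V5} {φ : W → MixedForm V5}
      {φ' : W →ₗ[ℝ] MixedForm V5} (_ : HasFDerivAt a a' x) (_ : HasFormDerivAt φ φ' x)
      (_ : ∀ᶠ y in 𝓝 x, clifford (a y) (φ y) = 0),
      clifford (a' X) (φ x) + clifford (a x) (φ' X) = 0 := by
    intro a a' φ φ' ha hφ he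
    have h0 : HasFormDerivAt (fun _ : W => (0 : MixedForm V5)) 0 x := fun k =>
      ⟨0, hasFDerivAt_const _ x, fun X => rfl⟩
    exact (HasFormDerivAt.clifford ha hφ).unique (h0.congr he) X
  have hm : ∀ {a b : W → GenVec V5} {a' b' : W →L[ℝ] GenVec V5} {φ ψ : W → MixedForm V5}
      {φ' ψ' : W →ₗ[ℝ] MixedForm V5} (_ : HasFDerivAt a a' x) (_ : HasFDerivAt b b' x)
      (_ : HasFormDerivAt φ φ' x) (_ : HasFormDerivAt ψ ψ' x)
      (_ : ∀ᶠ y in 𝓝 x, clifford (a y) (φ y) = (-2 : ℝ) • clifford (b y) (ψ y)),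
      clifford (a' X) (φ x) + clifford (a x) (φ' X) =
        (-2 : ℝ) • (clifford (b' X) (ψ x) + clifford (b x) (ψ' X)) := by
    intro a b a' b' φ ψ φ' ψ' ha hb hφ hψ he
    exact (HasFormDerivAt.clifford ha hφ).unique
      (((HasFormDerivAt.clifford hb hψ).const_smul (-2)).congr he) X
  exact
    { act₁ := hc hv₁ hα (R.mono fun y r => r.act₁)
      act₂ := hc hv₂ hβ (R.mono fun y r => r.act₂)
      mid₁ := hm hv₁ hh hβ hα (R.mono fun y r => r.mid₁)
      mid₂ := hm hv₂ hh hα hβ (R.mono fun y r => r.mid₂)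
      p₁ := fun e => hP hv₁ hα hα e (R.mono fun y r => r.p₁ e)
      ph := fun e => hP hh hα hβ e (R.mono fun y r => r.ph e)
      p₂ := fun e => hP hv₂ hβ hβ e (R.mono fun y r => r.p₂ e)
      v₁v₁ := hp hv₁ hv₁ (R.mono fun y r => r.v₁v₁)
      v₂v₂ := hp hv₂ hv₂ (R.mono fun y r => r.v₂v₂)
      hv₁ := hp hh hv₁ (R.mono fun y r => r.hv₁)
      hv₂ := hp hh hv₂ (R.mono fun y r => r.hv₂)
      v₁v₂ := hp hv₁ hv₂ (R.mono fun y r => r.v₁v₂)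
      hh := hp hh hh (R.mono fun y r => r.hh) }

end VariationOfRelations

/-! ### Naturality under linear isomorphisms -/

section Pullback
variable {V : Type*} [NormedAddCommGroup V] [NormedSpace ℝ V]

/-- The pullback of a form of mixed degree by a linear map. -/
def pullForm (A : V →L[ℝ] V) (φ : MixedForm V) : MixedForm V :=
  fun k => (φ k).compContinuousLinearMap A

/-- The pullback of an element of `V ⊕ V*` by an invertible linear map. (For a map which is not
invertible, `ContinuousLinearMap.inverse` is zero.) -/
def pullVec (A : V →L[ℝ] V) (a : GenVec V) : GenVec V := (A.inverse a.1, a.2 ∘L A)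

@[simp] lemma pullForm_id (φ : MixedForm V) : pullForm (ContinuousLinearMap.id ℝ V) φ = φ := rfl

@[simp] lemma pullVec_id (a : GenVec V) : pullVec (ContinuousLinearMap.id ℝ V) a = a := by
  simp [pullVec]

lemma pullForm_smul (A : V →L[ℝ] V) (c : ℝ) (φ : MixedForm V) :
    pullForm A (c • φ) = c • pullForm A φ := rfl

lemma pullVec_add (A : V →L[ℝ] V) (a b : GenVec V) :
    pullVec A (a + b) = pullVec A a + pullVec A b := by
  simp [pullVec]

lemma pullVec_smul (A : V →L[ℝ] V) (c : ℝ) (a : GenVec V) :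
    pullVec A (c • a) = c • pullVec A a := by
  simp [pullVec]

lemma pullVec_neg (A : V →L[ℝ] V) (a : GenVec V) : pullVec A (-a) = -pullVec A a := by
  simp [pullVec]

lemma pullVec_sub (A : V →L[ℝ] V) (a b : GenVec V) :
    pullVec A (a - b) = pullVec A a - pullVec A b := by
  rw [sub_eq_add_neg, pullVec_add, pullVec_neg, sub_eq_add_neg]

variable {A : V →L[ℝ] V}

lemma pullVec_surjective (hA : A.IsInvertible) : Function.Surjective (pullVec A) := by
  obtain ⟨A, rfl⟩ := hA
  intro a
  refine ⟨(A a.1, a.2 ∘L (A.symm : V →L[ℝ] V)), Prod.ext ?_ ?_⟩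
  · simp [pullVec]
  · ext; simp [pullVec]

lemma pairing_pullVec (hA : A.IsInvertible) (a b : GenVec V) :
    pairing (pullVec A a) (pullVec A b) = pairing a b := by
  obtain ⟨A, rfl⟩ := hA
  simp [pairing, pullVec]

lemma clifford_pull (hA : A.IsInvertible) (a : GenVec V) (φ : MixedForm V) :
    clifford (pullVec A a) (pullForm A φ) = pullForm A (clifford a φ) := by
  obtain ⟨A, rfl⟩ := hA
  have hc : ∀ k, ((φ (k + 1)).compContinuousLinearMap (A : V →L[ℝ] V)).curryLeft (A.symm a.1) =
      ((φ (k + 1)).curryLeft a.1).compContinuousLinearMap (A : V →L[ℝ] V) := by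
    intro k
    ext v
    simp only [ContinuousAlternatingMap.curryLeft_apply_apply,
      ContinuousAlternatingMap.compContinuousLinearMap_apply]
    congr 1
    funext i
    refine Fin.cases ?_ (fun j => ?_) i <;> simp
  funext k
  cases k with
  | zero => simp only [clifford, pullVec, pullForm, ContinuousLinearMap.inverse_equiv,
      ContinuousLinearEquiv.coe_coe]; exact hc 0
  | succ k =>
    simp only [clifford, pullVec, pullForm, ContinuousLinearMap.inverse_equiv,
      ContinuousLinearEquiv.coe_coe]
    rw [hc]
    ext v
    simp only [ContinuousAlternatingMap.compContinuousLinearMap_apply, wedgeOne_apply,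
      ContinuousAlternatingMap.add_apply]
    rfl

lemma mukai_pull (A : V →L[ℝ] V) (ψ φ : MixedForm V) (w : Fin 5 → V) :
    mukai (pullForm A ψ) (pullForm A φ) w = mukai ψ φ (fun i => A (w i)) := rfl

/-- The exterior product is an alternating map. -/
lemma exists_alternatingMap_wedge {p q : ℕ} (α : V [⋀^Fin p]→L[ℝ] ℝ) (β : V [⋀^Fin q]→L[ℝ] ℝ) :
    ∃ f : V [⋀^Fin (p + q)]→ₗ[ℝ] ℝ, ∀ w, f w = wedge α β w := by
  let m : MultilinearMap ℝ (fun _ : Fin (p + q) => V) ℝ :=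
    (LinearMap.mul' ℝ ℝ).compMultilinearMap
      (((α.toMultilinearMap).domCoprod (β.toMultilinearMap)).domDomCongr finSumFinEquiv)
  refine ⟨((p.factorial : ℝ) * (q.factorial : ℝ))⁻¹ • MultilinearMap.alternatization m,
    fun w => ?_⟩
  simp only [AlternatingMap.smul_apply, MultilinearMap.alternatization_apply, wedge, smul_eq_mul]
  congr 1
  refine Finset.sum_congr rfl fun s _ => ?_
  rw [Units.smul_def, zsmul_eq_mul]
  rfl

end Pullback

lemma eq_zero_of_apply_e5 {ν : V5 [⋀^Fin 5]→L[ℝ] ℝ} (h : ν e5 = 0) : ν = 0 := by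
  have h1 := AlternatingMap.eq_smul_basis_det basis5 ν.toAlternatingMap
  have h2 : ν.toAlternatingMap basis5 = 0 := by rw [coe_basis5]; exact h
  ext w
  have := congrArg (fun f => f w) h1
  simpa [h2] using this

/-- Two `5`-forms are proportional. -/
lemma mukai_mul_eq (ν : V5 [⋀^Fin 5]→L[ℝ] ℝ) (ψ φ : MixedForm V5) (w : Fin 5 → V5) :
    mukai ψ φ w * ν e5 = mukai ψ φ e5 * ν w := by
  obtain ⟨f₁, h₁⟩ := exists_alternatingMap_wedge (p := 1) (q := 4) (ψ 1) (φ 4)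
  obtain ⟨f₂, h₂⟩ := exists_alternatingMap_wedge (p := 3) (q := 2) (ψ 3) (φ 2)
  obtain ⟨f₃, h₃⟩ := exists_alternatingMap_wedge (p := 5) (q := 0) (ψ 5) (φ 0)
  have hf : ∀ w, (f₁ - f₂ + f₃) w = mukai ψ φ w := fun w => by
    simp [mukai, ← h₁, ← h₂, ← h₃]
  have e₁ := congrArg (fun f => f w) (AlternatingMap.eq_smul_basis_det basis5 (f₁ - f₂ + f₃))
  have e₂ := congrArg (fun f => f w) (AlternatingMap.eq_smul_basis_det basis5 ν.toAlternatingMap)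
  simp only [AlternatingMap.smul_apply, coe_basis5, smul_eq_mul, hf] at e₁ e₂
  rw [e₁]
  have e₂' : ν w = ν e5 * basis5.det w := e₂
  rw [e₂']; ring

section DimensionFive
variable {A : V5 →L[ℝ] V5} {ν : V5 [⋀^Fin 5]→L[ℝ] ℝ}

lemma compContinuousLinearMap_e5_ne_zero (hA : A.IsInvertible) (hν : ν e5 ≠ 0) :
    ν.compContinuousLinearMap A e5 ≠ 0 := by
  obtain ⟨A, rfl⟩ := hA
  intro h
  apply hν
  have h0 := eq_zero_of_apply_e5 h
  have := congrArg (fun f => f fun i => A.symm (e5 i)) h0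
  simpa [Function.comp_def] using this

/-- `P` is natural: both sides have the same inner products, since the Mukai pairing and `ν` are
pulled back alike. -/
lemma bilin_pull (hA : A.IsInvertible) (hν : ν e5 ≠ 0) (α β : MixedForm V5) :
    bilin (ν.compContinuousLinearMap A) (pullForm A α) (pullForm A β) =
      pullVec A (bilin ν α β) := by
  have hν' := compContinuousLinearMap_e5_ne_zero hA hν
  refine eq_of_pairing_eq fun e => ?_
  obtain ⟨e, rfl⟩ := pullVec_surjective hA e
  apply mul_right_cancel₀ hν'
  rw [pairing_bilin _ hν', clifford_pull hA, pairing_pullVec hA, mukai_pull]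
  apply mul_right_cancel₀ hν
  rw [mukai_mul_eq, ← pairing_bilin _ hν]
  simp only [ContinuousAlternatingMap.compContinuousLinearMap_apply]
  rw [mul_assoc, mul_assoc, mul_comm (ν e5)]
  rfl

lemma quartic_pull (hA : A.IsInvertible) (hν : ν e5 ≠ 0) (ρ : Fin 2 → MixedForm V5) :
    quartic (ν.compContinuousLinearMap A) (fun i => pullForm A (ρ i)) = quartic ν ρ := by
  rw [quartic, bilin_pull hA hν, bilin_pull hA hν, pairing_pullVec hA, quartic]

lemma volForm_pull (hA : A.IsInvertible) (hν : ν e5 ≠ 0) (ρ : Fin 2 → MixedForm V5) :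
    volForm (ν.compContinuousLinearMap A) (fun i => pullForm A (ρ i)) =
      (volForm ν ρ).compContinuousLinearMap A := by
  rw [volForm, quartic_pull hA hν]
  rfl

/-- `v₁`, `h` and `v₂` are natural. -/
lemma bilin_volForm_pull (hA : A.IsInvertible) (hν : ν e5 ≠ 0) {ρ : Fin 2 → MixedForm V5}
    (hq : quartic ν ρ ≠ 0) (i j : Fin 2) :
    bilin (volForm (ν.compContinuousLinearMap A) (fun i => pullForm A (ρ i)))
      (pullForm A (ρ i)) (pullForm A (ρ j)) = pullVec A (bilin (volForm ν ρ) (ρ i) (ρ j)) := by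
  rw [volForm_pull hA hν, bilin_pull hA]
  simp [volForm, hν, Real.sqrt_eq_zero, hq]

end DimensionFive

/-! ### Reading forms and sections of `T ⊕ T*` in a chart -/

section Chart

variable {E : Type*} [NormedAddCommGroup E] [NormedSpace ℝ E] {H : Type*} [TopologicalSpace H]
  (I : ModelWithCorners ℝ E H) {M : Type*} [TopologicalSpace M] [ChartedSpace H M]

/-- The derivative of the inverse of the chart at `x₀`. -/
def chartDeriv (x₀ : M) (y : E) : E →L[ℝ] E :=
  mfderivWithin 𝓘(ℝ, E) I (extChartAt I x₀).symm (Set.range I) y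

/-- A section of `T ⊕ T*` read in the chart at `x₀`. -/
def chartRep (x₀ : M) (a : M → GenVec E) (y : E) : GenVec E :=
  pullVec (chartDeriv I x₀ y) (a ((extChartAt I x₀).symm y))

/-- A form of mixed degree read in the chart at `x₀`. -/
def chartForm (x₀ : M) (α : M → MixedForm E) (y : E) : MixedForm E :=
  pullForm (chartDeriv I x₀ y) (α ((extChartAt I x₀).symm y))

/-- Covectors as `1`-forms. -/
def asFormCLM : (E →L[ℝ] ℝ) →L[ℝ] E [⋀^Fin 1]→L[ℝ] ℝ :=
  (ContinuousAlternatingMap.ofSubsingletonLIE (𝕜 := ℝ) (E := E) (F := ℝ)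
    (0 : Fin 1)).toLinearIsometry.toContinuousLinearMap

lemma asFormCLM_apply (ξ : E →L[ℝ] ℝ) (v : Fin 1 → E) : asFormCLM ξ v = ξ (v 0) := rfl

variable [IsManifold I 1 M]

lemma chartDeriv_isInvertible {x₀ : M} {y : E} (hy : y ∈ (extChartAt I x₀).target) :
    (chartDeriv I x₀ y).IsInvertible :=
  isInvertible_mfderivWithin_extChartAt_symm hy

/-- In the chart at `x` the tangent space at `x` is identified with `E` by the identity, so that
sections and forms agree at `x` with their representatives in this chart. -/
lemma chartDeriv_self (x : M) :
    chartDeriv I x (extChartAt I x x) = ContinuousLinearMap.id ℝ E :=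
  mfderivWithin_range_extChartAt_symm

lemma mfderiv_extChartAt_eq (x : M) :
    (mfderiv I 𝓘(ℝ, E) (extChartAt I x) x : E →L[ℝ] E) = ContinuousLinearMap.id ℝ E :=
  mfderiv_extChartAt_self

@[simp] lemma chartRep_self (x : M) (a : M → GenVec E) :
    chartRep I x a (extChartAt I x x) = a x := by
  rw [chartRep, chartDeriv_self, pullVec_id, extChartAt_to_inv]

@[simp] lemma chartForm_self (x : M) (α : M → MixedForm E) :
    chartForm I x α (extChartAt I x x) = α x := by
  rw [chartForm, chartDeriv_self, pullForm_id, extChartAt_to_inv]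

/-- The differential of a function, computed in the chart. -/
lemma dFun_eq {x : M} {g : M → ℝ} {g₀ : E → ℝ} {D : E →L[ℝ] ℝ}
    (h : HasFDerivAt g₀ D (extChartAt I x x))
    (hg : ∀ᶠ y in 𝓝 x, g y = g₀ (extChartAt I x y)) : dFun I g x = D := by
  have h1 : HasMFDerivAt 𝓘(ℝ, E) 𝓘(ℝ, ℝ) g₀ (extChartAt I x x) D := h.hasMFDerivAt
  have h2 : MDifferentiableAt I 𝓘(ℝ, E) (extChartAt I x) x :=
    mdifferentiableAt_extChartAt (mem_chart_source H x)
  have h3 := (h1.comp x h2.hasMFDerivAt).congr_of_eventuallyEq (f₁ := g) hg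
  have h4 := h3.mfderiv
  unfold dFun
  rw [h4, mfderiv_extChartAt_self]
  rfl

/-- The value of the covector part of `b` on the vector part of `a` can be computed in the chart. -/
lemma eventually_pairing_chart (x : M) (a b : M → GenVec E) :
    ∀ᶠ y in 𝓝 x, (b y).2 (a y).1 =
      (chartRep I x b (extChartAt I x y)).2 (chartRep I x a (extChartAt I x y)).1 := by
  filter_upwards [extChartAt_source_mem_nhds (I := I) x] with y hy
  obtain ⟨A, hA⟩ := chartDeriv_isInvertible I ((extChartAt I x).map_source hy)
  simp only [chartRep, pullVec, ← hA, (extChartAt I x).left_inv hy]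
  simp

/-- The differential, in the chart, of the covector part of `b` on the vector part of `a`. -/
lemma dFun_chart {x : M} {a b : M → GenVec E} {Da Db : E →L[ℝ] GenVec E}
    (ha : HasFDerivAt (chartRep I x a) Da (extChartAt I x x))
    (hb : HasFDerivAt (chartRep I x b) Db (extChartAt I x x)) :
    ∃ D : E →L[ℝ] ℝ, HasFDerivAt (fun y => (chartRep I x b y).2 (chartRep I x a y).1) D
      (extChartAt I x x) ∧ ∀ Y, D Y = (Db Y).2 (a x).1 + (b x).2 (Da Y).1 := by
  have := hb.snd.clm_apply ha.fst
  rw [chartRep_self, chartRep_self] at this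
  refine ⟨_, this, fun Y => ?_⟩
  simp [add_comm]

variable [I.Boundaryless]

/-- The exterior derivative, computed in the chart. -/
lemma extD_eq {k : ℕ} {x : M} {α : M → E [⋀^Fin k]→L[ℝ] ℝ} :
    extD I α x = ContinuousAlternatingMap.alternatizeUncurryFin
      (fderiv ℝ (inChart I x α) (extChartAt I x x)) := by
  rw [extD, mfderiv_extChartAt_eq, I.range_eq_univ, extDerivWithin_univ]
  rfl

/-- The Lie bracket of the vector parts, computed in the chart. -/
lemma lieBracket_chart {x : M} {a b : M → GenVec E} {Da Db : E →L[ℝ] GenVec E}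
    (ha : HasFDerivAt (chartRep I x a) Da (extChartAt I x x))
    (hb : HasFDerivAt (chartRep I x b) Db (extChartAt I x x)) :
    VectorField.mlieBracket I (fun y => ((a y).1 : TangentSpace I y))
      (fun y => ((b y).1 : TangentSpace I y)) x = ((Db (a x).1).1 - (Da (b x).1).1 : E) := by
  have ha' : HasFDerivAt (fun y => (chartRep I x a y).1) _ (extChartAt I x x) := ha.fst
  have hb' : HasFDerivAt (fun y => (chartRep I x b y).1) _ (extChartAt I x x) := hb.fst
  have h1 : VectorField.lieBracketWithin ℝ (fun y => (chartRep I x a y).1)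
      (fun y => (chartRep I x b y).1) Set.univ (extChartAt I x x) =
      ((Db (a x).1).1 - (Da (b x).1).1 : E) := by
    rw [VectorField.lieBracketWithin, fderivWithin_univ, fderivWithin_univ, ha'.fderiv, hb'.fderiv,
      chartRep_self, chartRep_self]
    rfl
  have h2 : (mfderiv I 𝓘(ℝ, E) (extChartAt I x) x).inverse = ContinuousLinearMap.id ℝ E := by
    rw [mfderiv_extChartAt_self]; exact ContinuousLinearMap.inverse_id
  have h3 : ∀ V W : Π y : M, TangentSpace I y, VectorField.mlieBracket I V W x =
      VectorField.lieBracketWithin ℝ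
        (VectorField.mpullbackWithin 𝓘(ℝ, E) I (extChartAt I x).symm V (Set.range I))
        (VectorField.mpullbackWithin 𝓘(ℝ, E) I (extChartAt I x).symm W (Set.range I))
        Set.univ (extChartAt I x x) := by
    intro V W
    rw [← VectorField.mlieBracketWithin_univ, VectorField.mlieBracketWithin_apply, h2]
    simp only [Set.preimage_univ, Set.univ_inter, I.range_eq_univ]
    rfl
  exact (h3 _ _).trans h1

/-- The Lie derivative of the covector part of `b` along the vector part of `a`, computed in the
chart. -/
lemma lieDeriv_chart {x : M} {a b : M → GenVec E} {Da Db : E →L[ℝ] GenVec E}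
    (ha : HasFDerivAt (chartRep I x a) Da (extChartAt I x x))
    (hb : HasFDerivAt (chartRep I x b) Db (extChartAt I x x)) (Y : E) :
    lieDeriv I (fun y => (a y).1) (fun y => (b y).2) x Y =
      (Db (a x).1).2 Y + (b x).2 (Da Y).1 := by
  obtain ⟨D, hD, hD'⟩ := dFun_chart I ha hb
  have h1 : HasFDerivAt (inChart I x (asForm fun x => (b x).2))
      (asFormCLM ∘L (ContinuousLinearMap.snd ℝ E (E →L[ℝ] ℝ) ∘L Db)) (extChartAt I x x) :=
    HasFDerivAt.clm_comp asFormCLM hb.snd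
  rw [lieDeriv, dFun_eq I hD (eventually_pairing_chart I x a b), extD_eq, h1.fderiv]
  have h2 : ∀ β : E [⋀^Fin 1]→L[ℝ] ℝ,
      (ContinuousAlternatingMap.ofSubsingleton ℝ E ℝ (0 : Fin 1)).symm β Y = β ![Y] := by
    intro β
    change β (fun _ => Y) = _
    congr 1
    funext i
    fin_cases i; rfl
  rw [add_apply, h2, hD', ContinuousAlternatingMap.curryLeft_apply_apply,
    ContinuousAlternatingMap.alternatizeUncurryFin_apply]
  simp [Fin.sum_univ_two, asFormCLM_apply, Fin.removeNth_apply]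

/-- The Courant bracket at `x`, computed from the 1-jets in the chart at `x`. -/
lemma courant_eq {x : M} {a b : M → GenVec E} {Da Db : E →L[ℝ] GenVec E}
    (ha : HasFDerivAt (chartRep I x a) Da (extChartAt I x x))
    (hb : HasFDerivAt (chartRep I x b) Db (extChartAt I x x)) :
    courant I a b x = courantJet (a x) Da (b x) Db := by
  obtain ⟨D, hD, hD'⟩ := dFun_chart I ha hb
  obtain ⟨K, hK, hK'⟩ := dFun_chart I hb ha
  have hd : dFun I (fun y => (b y).2 (a y).1 - (a y).2 (b y).1) x = D - K := by
    refine dFun_eq I (hD.sub hK) ?_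
    filter_upwards [eventually_pairing_chart I x a b, eventually_pairing_chart I x b a]
      with y h1 h2
    rw [h1, h2]; rfl
  refine Prod.ext ?_ ?_
  · refine (lieBracket_chart I ha hb).trans ?_
    simp only [courantJet, Prod.fst_add, Prod.fst_sub, add_zero]
    rfl
  · ext Y
    simp only [courant, sub_apply, smul_apply, lieDeriv_chart I ha hb, lieDeriv_chart I hb ha, hd,
      hD', hK', courantJet, Prod.snd_add, Prod.snd_sub, add_apply, pairingCLM_apply,
      ContinuousLinearMap.comp_apply, pairing, smul_eq_mul]
    ring

end Chart

section DimensionFive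

variable {M : Type*} [TopologicalSpace M] [ChartedSpace (EuclideanSpace ℝ (Fin 5)) M]
  [IsManifold (𝓡 5) 1 M]

/-- The exterior derivative of a form of mixed degree, computed in the chart. -/
lemma mixedD_eq_dirac {x : M} {α : M → MixedForm V5} {D : V5 →ₗ[ℝ] MixedForm V5}
    (h : HasFormDerivAt (chartForm (𝓡 5) x α) D (extChartAt (𝓡 5) x x)) :
    mixedD (𝓡 5) α x = dirac D := by
  funext k
  cases k with
  | zero => simp [mixedD, dirac, clifford, ε]
  | succ k =>
    obtain ⟨L, hL, hL'⟩ := h k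
    have h1 : HasFDerivAt (inChart (𝓡 5) x fun y => α y k) L (extChartAt (𝓡 5) x x) := hL
    rw [mixedD, extD_eq, h1.fderiv]
    have h2 : L = ∑ i, (EuclideanSpace.proj i : V5 →L[ℝ] ℝ).smulRight (L (e5 i)) := by
      ext X
      have := map_eq_sum_e5 (L : V5 →ₗ[ℝ] V5 [⋀^Fin k]→L[ℝ] ℝ) X
      simp only [ContinuousLinearMap.coe_coe] at this
      rw [this]
      simp
    have h3 : ContinuousAlternatingMap.alternatizeUncurryFin L =
        ∑ i, wedgeOne (EuclideanSpace.proj i : V5 →L[ℝ] ℝ) (L (e5 i)) := by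
      conv_lhs => rw [h2]
      exact map_sum (ContinuousAlternatingMap.alternatizeUncurryFinCLM ℝ V5 ℝ (n := k)) _ _
    rw [h3]
    simp [dirac, clifford, ε, hL']

end DimensionFive

/-! ### Smooth sections of `T ⊕ T*` in charts -/

section SmoothSections

variable {E : Type*} [NormedAddCommGroup E] [NormedSpace ℝ E] {H : Type*} [TopologicalSpace H]
  (I : ModelWithCorners ℝ E H) {M : Type*} [TopologicalSpace M] [ChartedSpace H M]
  [IsManifold I ∞ M]

/-- The vector part of a section, in the trivialization of the tangent bundle at `x`. -/
lemma trivializationAt_eq_chartRep (x : M) (a : M → GenVec E) :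
    ∀ᶠ y in 𝓝 x, ((trivializationAt E (TangentSpace I) x)
      (⟨y, (a y).1⟩ : TangentBundle I M)).2 = (chartRep I x a (extChartAt I x y)).1 := by
  filter_upwards [extChartAt_source_mem_nhds (I := I) x] with y hy
  have hy' : y ∈ (chartAt H x).source := by rwa [extChartAt_source] at hy
  have hb : y ∈ (trivializationAt E (TangentSpace I) x).baseSet := by simpa using hy'
  have h1 : ∀ v : TangentSpace I y, ((trivializationAt E (TangentSpace I) x)
      (⟨y, v⟩ : TangentBundle I M)).2 = mfderiv I 𝓘(ℝ, E) (extChartAt I x) y v := by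
    intro v
    have e₁ : (trivializationAt E (TangentSpace I) x).continuousLinearMapAt ℝ y v =
        ((trivializationAt E (TangentSpace I) x) (⟨y, v⟩ : TangentBundle I M)).2 := by
      rw [Bundle.Trivialization.continuousLinearMapAt_apply,
        Bundle.Trivialization.coe_linearMapAt_of_mem _ hb]
    exact e₁.symm.trans (congrArg (fun L : TangentSpace I y →L[ℝ] E => L v)
      (TangentBundle.continuousLinearMapAt_trivializationAt hy'))
  refine (h1 (a y).1).trans ?_
  have h2 := mfderiv_extChartAt_comp_mfderivWithin_extChartAt_symm' (I := I) hy
  have h3 := mfderivWithin_extChartAt_symm_comp_mfderiv_extChartAt' (I := I) hy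
  have h4 : (chartDeriv I x (extChartAt I x y)).inverse =
      (mfderiv I 𝓘(ℝ, E) (extChartAt I x) y : E →L[ℝ] E) := by
    refine ContinuousLinearMap.inverse_eq ?_ ?_
    · exact h3
    · exact h2
  simp only [chartRep, pullVec, h4, (extChartAt I x).left_inv hy]
  rfl

variable [I.Boundaryless]

lemma isSmoothSectionOn_of_chartRep {a : M → GenVec E} {U : Set M} (hU : IsOpen U)
    (h : ∀ x₀, ContDiffOn ℝ ∞ (chartRep I x₀ a)
      ((extChartAt I x₀).target ∩ (extChartAt I x₀).symm ⁻¹' U)) : IsSmoothSectionOn I a U := by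
  constructor
  · intro x hx
    refine ContMDiffAt.contMDiffWithinAt ?_
    have h1 : ContMDiffAt I 𝓘(ℝ, E) ∞
        (fun y => ((trivializationAt E (TangentSpace I) x)
          (⟨y, (a y).1⟩ : TangentBundle I M)).2) x := by
      have h2 : ContDiffAt ℝ ∞ (fun y => (chartRep I x a y).1) (extChartAt I x x) := by
        refine ((h x).contDiffAt (Filter.inter_mem (extChartAt_target_mem_nhds x) ?_)).fst
        exact (continuousAt_extChartAt_symm x).preimage_mem_nhds
          (by rw [extChartAt_to_inv]; exact hU.mem_nhds hx)
      exact (h2.contMDiffAt.comp x contMDiffAt_extChartAt).congr_of_eventuallyEq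
        (trivializationAt_eq_chartRep I x a)
    exact (Bundle.contMDiffAt_section (F := E) (E := TangentSpace I)
      (s := fun y => ((a y).1 : TangentSpace I y)) x).2 h1
  · intro x₀
    exact asFormCLM.contDiff.comp_contDiffOn (h x₀).snd

/-- A smooth section is differentiable in the chart; with `courant_eq` this makes its Courant
brackets computable from 1-jets. -/
lemma IsSmoothSectionOn.differentiableAt {a : M → GenVec E} {U : Set M} (hU : IsOpen U)
    (h : IsSmoothSectionOn I a U) {x : M} (hx : x ∈ U) :
    DifferentiableAt ℝ (chartRep I x a) (extChartAt I x x) := by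
  have hf : DifferentiableAt ℝ (fun y => (chartRep I x a y).1) (extChartAt I x x) := by
    have h1 : ContMDiffAt I 𝓘(ℝ, E) ∞
        (fun y => ((trivializationAt E (TangentSpace I) x)
          (⟨y, (a y).1⟩ : TangentBundle I M)).2) x :=
      (Bundle.contMDiffAt_section (F := E) (E := TangentSpace I)
        (s := fun y => ((a y).1 : TangentSpace I y)) x).1
        ((h.1 x hx).contMDiffAt (hU.mem_nhds hx))
    have h2 : ContMDiffAt I 𝓘(ℝ, E) ∞ (fun y => (chartRep I x a (extChartAt I x y)).1) x :=
      h1.congr_of_eventuallyEq ((trivializationAt_eq_chartRep I x a).mono fun y hy => hy.symm)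
    have h3 : ContMDiffAt 𝓘(ℝ, E) I ∞ (extChartAt I x).symm (extChartAt I x x) := by
      exact (contMDiffOn_extChartAt_symm x).contMDiffAt (extChartAt_target_mem_nhds x)
    have h4 := (ContMDiffAt.comp_of_eq h2 h3 (extChartAt_to_inv x)).contDiffAt.differentiableAt
      (by simp)
    refine h4.congr_of_eventuallyEq ?_
    filter_upwards [extChartAt_target_mem_nhds (I := I) x] with y hy
    simp only [Function.comp_apply, (extChartAt I x).right_inv hy]
  have hs : DifferentiableAt ℝ (fun y => (chartRep I x a y).2) (extChartAt I x x) := by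
    have h1 : DifferentiableAt ℝ (fun y => asFormCLM (chartRep I x a y).2) (extChartAt I x x) := by
      refine ((h.2 x).contDiffAt (Filter.inter_mem (extChartAt_target_mem_nhds x)
        ?_)).differentiableAt (by simp)
      exact (continuousAt_extChartAt_symm x).preimage_mem_nhds
          (by rw [extChartAt_to_inv]; exact hU.mem_nhds hx)
    exact (((ContinuousAlternatingMap.ofSubsingletonLIE (𝕜 := ℝ) (E := E) (F := ℝ)
      (0 : Fin 1)).symm.toContinuousLinearEquiv.toContinuousLinearMap).differentiableAt).comp _ h1
  exact hf.prodMk hs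

end SmoothSections

/-! ### Smooth dependence of `v₁`, `h`, `v₂` on the pair of forms -/

section SmoothDependence

lemma ContDiffOn.clm_comp {W F G : Type*} [NormedAddCommGroup W] [NormedSpace ℝ W]
    [NormedAddCommGroup F] [NormedSpace ℝ F] [NormedAddCommGroup G] [NormedSpace ℝ G]
    {f : W → F} {s : Set W} (L : F →L[ℝ] G) (hf : ContDiffOn ℝ ∞ f s) :
    ContDiffOn ℝ ∞ (fun y => L (f y)) s :=
  L.contDiff.comp_contDiffOn hf

lemma ContDiffOn.smulRight_const {V W F : Type*} [NormedAddCommGroup V] [NormedSpace ℝ V]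
    [NormedAddCommGroup W] [NormedSpace ℝ W] [NormedAddCommGroup F] [NormedSpace ℝ F]
    (ξ : V →L[ℝ] ℝ) {f : W → F} {s : Set W} (hf : ContDiffOn ℝ ∞ f s) :
    ContDiffOn ℝ ∞ (fun y => ξ.smulRight (f y)) s :=
  (ContinuousLinearMap.smulRightL ℝ V F ξ).contDiff.comp_contDiffOn hf

variable {W : Type*} [NormedAddCommGroup W] [NormedSpace ℝ W] {s : Set W}

lemma contDiffOn_clifford (e : GenVec V5) {φ : W → MixedForm V5}
    (hφ : ∀ k, ContDiffOn ℝ ∞ (fun y => φ y k) s) (k : ℕ) :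
    ContDiffOn ℝ ∞ (fun y => clifford e (φ y) k) s := by
  have hc : ∀ k, ContDiffOn ℝ ∞ (fun y => (φ y (k + 1)).curryLeft e.1) s := fun k =>
    (((ContinuousAlternatingMap.curryLeftLI (𝕜 := ℝ) (E := V5) (F := ℝ)
      (n := k)).contDiff.comp_contDiffOn (hφ (k + 1))).clm_apply contDiffOn_const)
  cases k with
  | zero => exact hc 0
  | succ k =>
    have hw : ContDiffOn ℝ ∞ (fun y => wedgeOne e.2 (φ y k)) s :=
      ContDiffOn.clm_comp (F := V5 →L[ℝ] V5 [⋀^Fin k]→L[ℝ] ℝ) (G := V5 [⋀^Fin (k + 1)]→L[ℝ] ℝ)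
        (ContinuousAlternatingMap.alternatizeUncurryFinCLM ℝ V5 ℝ (n := k))
        (ContDiffOn.smulRight_const e.2 (hφ k))
    exact (hc (k + 1)).add hw

lemma contDiffOn_mukai {φ ψ : W → MixedForm V5}
    (hφ : ∀ k, ContDiffOn ℝ ∞ (fun y => φ y k) s) (hψ : ∀ k, ContDiffOn ℝ ∞ (fun y => ψ y k) s) :
    ContDiffOn ℝ ∞ (fun y => mukai (φ y) (ψ y) e5) s := by
  have ev : ∀ {χ : W → MixedForm V5} (_ : ∀ k, ContDiffOn ℝ ∞ (fun y => χ y k) s) {k : ℕ}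
      (v : Fin k → V5), ContDiffOn ℝ ∞ (fun y => χ y k v) s := fun hχ k v =>
    (ContinuousAlternatingMap.apply ℝ V5 ℝ v).contDiff.comp_contDiffOn (hχ k)
  have pr : ∀ {k l : ℕ} (v : Fin k → V5) (w : Fin l → V5),
      ContDiffOn ℝ ∞ (fun y => φ y k v * ψ y l w) s := fun v w => (ev hφ v).mul (ev hψ w)
  simp only [mukai_e5, co0, co1, co2, co3, co4, co5]
  exact (((((pr _ _).sub (pr _ _)).add (pr _ _)).sub (pr _ _)).add (pr _ _)).sub
    ((((((((((pr _ _).sub (pr _ _)).add (pr _ _)).add (pr _ _)).sub (pr _ _)).add (pr _ _)).sub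
      (pr _ _)).add (pr _ _)).sub (pr _ _)).add (pr _ _)) |>.add (pr _ _)

lemma contDiffOn_bilin {ν : W → V5 [⋀^Fin 5]→L[ℝ] ℝ} {φ ψ : W → MixedForm V5}
    (hν : ContDiffOn ℝ ∞ ν s) (hν0 : ∀ y ∈ s, ν y e5 ≠ 0)
    (hφ : ∀ k, ContDiffOn ℝ ∞ (fun y => φ y k) s) (hψ : ∀ k, ContDiffOn ℝ ∞ (fun y => ψ y k) s) :
    ContDiffOn ℝ ∞ (fun y => bilin (ν y) (φ y) (ψ y)) s := by
  have hν' : ContDiffOn ℝ ∞ (fun y => ν y e5) s :=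
    (ContinuousAlternatingMap.apply ℝ V5 ℝ e5).contDiff.comp_contDiffOn hν
  have h : ∀ e, ContDiffOn ℝ ∞
      (fun y => 2 * (mukaiFunctional (φ y) (ψ y) e5 e / ν y e5)) s := fun e =>
    contDiffOn_const.mul ((contDiffOn_mukai (contDiffOn_clifford e hφ) hψ).div hν' hν0)
  exact (ContDiffOn.sum fun i _ => (h _).smul contDiffOn_const).prodMk
    (ContDiffOn.sum fun i _ => (h _).smul contDiffOn_const)

lemma contDiffOn_volForm {μ : W → V5 [⋀^Fin 5]→L[ℝ] ℝ} {ρ : Fin 2 → W → MixedForm V5}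
    (hμ : ContDiffOn ℝ ∞ μ s) (hμ0 : ∀ y ∈ s, μ y e5 ≠ 0)
    (hρ : ∀ i k, ContDiffOn ℝ ∞ (fun y => ρ i y k) s)
    (hq : ∀ y ∈ s, quartic (μ y) (fun i => ρ i y) ≠ 0) :
    ContDiffOn ℝ ∞ (fun y => volForm (μ y) (fun i => ρ i y)) s := by
  have h0 := contDiffOn_bilin hμ hμ0 (hρ 0) (hρ 0)
  have h1 := contDiffOn_bilin hμ hμ0 (hρ 1) (hρ 1)
  have hQ : ContDiffOn ℝ ∞ (fun y => quartic (μ y) (fun i => ρ i y)) s :=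
    ((h0.snd.clm_apply h1.fst).add (h1.snd.clm_apply h0.fst)).div_const 2
  have habs : ContDiffOn ℝ ∞ (fun y => |quartic (μ y) (fun i => ρ i y)|) s := fun y hy =>
    ContDiffAt.comp_contDiffWithinAt (g := fun r : ℝ => |r|) y (contDiffAt_abs (hq y hy)) (hQ y hy)
  exact (habs.sqrt fun y hy => abs_ne_zero.2 (hq y hy)).smul hμ

lemma contDiffOn_bilin_volForm {μ : W → V5 [⋀^Fin 5]→L[ℝ] ℝ} {ρ : Fin 2 → W → MixedForm V5}
    (hμ : ContDiffOn ℝ ∞ μ s) (hμ0 : ∀ y ∈ s, μ y e5 ≠ 0)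
    (hρ : ∀ i k, ContDiffOn ℝ ∞ (fun y => ρ i y k) s)
    (hq : ∀ y ∈ s, quartic (μ y) (fun i => ρ i y) ≠ 0) (i j : Fin 2) :
    ContDiffOn ℝ ∞ (fun y => bilin (volForm (μ y) (fun i => ρ i y)) (ρ i y) (ρ j y)) s := by
  refine contDiffOn_bilin (contDiffOn_volForm hμ hμ0 hρ hq) (fun y hy => ?_) (hρ i) (hρ j)
  simp [volForm, hμ0 y hy, Real.sqrt_eq_zero, hq y hy]

end SmoothDependence

/-! ### Families of sections of `T ⊕ T*` and the product with the time axis -/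

section Families

variable {E : Type*} [NormedAddCommGroup E] [NormedSpace ℝ E] {H : Type*} [TopologicalSpace H]
  (I : ModelWithCorners ℝ E H) {M : Type*} [TopologicalSpace M] [ChartedSpace H M]

/-- A time-dependent section of `T ⊕ T*`, smooth in the parameter `t ∈ J` and the point of `M`
jointly. -/
def IsSmoothSectionFamilyOn (J : Set ℝ) (a : ℝ → M → GenVec E) : Prop :=
  ∀ x₀ : M, ContDiffOn ℝ ∞ (fun p : ℝ × E => chartRep I x₀ (a p.1) p.2)
    (J ×ˢ (extChartAt I x₀).target)

variable {I} in
lemma IsSmoothSectionFamilyOn.add {J : Set ℝ} {a b : ℝ → M → GenVec E}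
    (ha : IsSmoothSectionFamilyOn I J a) (hb : IsSmoothSectionFamilyOn I J b) :
    IsSmoothSectionFamilyOn I J fun t x => a t x + b t x := fun x₀ => by
  simpa only [chartRep, pullVec_add] using (ha x₀).add (hb x₀)

variable {I} in
lemma IsSmoothSectionFamilyOn.const_smul {J : Set ℝ} {a : ℝ → M → GenVec E} (c : ℝ)
    (ha : IsSmoothSectionFamilyOn I J a) :
    IsSmoothSectionFamilyOn I J fun t x => c • a t x := fun x₀ => by
  simpa only [chartRep, pullVec_smul] using (ha x₀).const_smul c

/-- The inclusion of `V ⊕ V*` into `(ℝ × V) ⊕ (ℝ × V)*`. -/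
def liftCLM : GenVec E →L[ℝ] GenVec (ℝ × E) :=
  ((ContinuousLinearMap.inr ℝ ℝ E) ∘L ContinuousLinearMap.fst ℝ E (E →L[ℝ] ℝ)).prod
    (((ContinuousLinearMap.compL ℝ (ℝ × E) E ℝ).flip (ContinuousLinearMap.snd ℝ ℝ E)) ∘L
      ContinuousLinearMap.snd ℝ E (E →L[ℝ] ℝ))

lemma liftCLM_apply (a : GenVec E) :
    liftCLM a = ((0, a.1), a.2.comp (ContinuousLinearMap.snd ℝ ℝ E)) := rfl

lemma extChartAt_prod_symm_apply (q : ℝ × M) (p : ℝ × E) :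
    (extChartAt (𝓘(ℝ, ℝ).prod I) q).symm p = (p.1, (extChartAt I q.2).symm p.2) := by
  rw [extChartAt_prod]; rfl

lemma mem_extChartAt_prod_target (q : ℝ × M) (p : ℝ × E) :
    p ∈ (extChartAt (𝓘(ℝ, ℝ).prod I) q).target ↔ p.2 ∈ (extChartAt I q.2).target := by
  rw [extChartAt_prod]
  exact ⟨fun h => h.2, fun h => ⟨by simp [chartAt_self_eq], h⟩⟩

lemma chartRep_sub (x₀ : M) (a b : M → GenVec E) (y : E) :
    chartRep I x₀ (fun x => a x - b x) y = chartRep I x₀ a y - chartRep I x₀ b y := by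
  simp only [chartRep, pullVec_sub]

/-- The part of the chart of `ℝ × M` over `J × M` lies over the time interval `J`. -/
lemma prod_target_inter_subset (J : Set ℝ) (q : ℝ × M) :
    (extChartAt (𝓘(ℝ, ℝ).prod I) q).target ∩
      (extChartAt (𝓘(ℝ, ℝ).prod I) q).symm ⁻¹' (J ×ˢ (Set.univ : Set M)) ⊆
        J ×ˢ (extChartAt I q.2).target := by
  rintro p ⟨h1, h2⟩
  rw [Set.mem_preimage, extChartAt_prod_symm_apply] at h2
  exact ⟨h2.1, (mem_extChartAt_prod_target I q p).1 h1⟩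

variable [IsManifold I 1 M] [I.Boundaryless]

/-- The chart of `ℝ × M` is the product of the identity and a chart of `M`. -/
lemma chartDeriv_prod (q : ℝ × M) {p : ℝ × E} (hp : p.2 ∈ (extChartAt I q.2).target) :
    chartDeriv (𝓘(ℝ, ℝ).prod I) q p =
      (ContinuousLinearMap.id ℝ ℝ).prodMap (chartDeriv I q.2 p.2) := by
  have h0 := mdifferentiableWithinAt_extChartAt_symm (I := I) hp
  have h2 : HasFDerivAt (fun y => extChartAt I ((extChartAt I q.2).symm p.2)
      ((extChartAt I q.2).symm y)) (chartDeriv I q.2 p.2) p.2 := by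
    refine HasFDerivWithinAt.hasFDerivAt (E := E) (F := E) h0.hasMFDerivWithinAt.2 ?_
    rw [I.range_eq_univ]
    simp
  have h1 : HasMFDerivWithinAt 𝓘(ℝ, ℝ × E) (𝓘(ℝ, ℝ).prod I)
      (extChartAt (𝓘(ℝ, ℝ).prod I) q).symm (Set.range (𝓘(ℝ, ℝ).prod I)) p
      ((ContinuousLinearMap.id ℝ ℝ).prodMap (chartDeriv I q.2 p.2)) := by
    rw [ModelWithCorners.range_eq_univ]
    constructor
    · exact (continuousAt_extChartAt_symm'' (by
        rw [extChartAt_prod]; exact ⟨by simp [chartAt_self_eq], hp⟩)).continuousWithinAt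
    · have h4 : HasFDerivAt (Prod.map id (fun y => extChartAt I ((extChartAt I q.2).symm p.2)
        ((extChartAt I q.2).symm y))) ((ContinuousLinearMap.id ℝ ℝ).prodMap
          (chartDeriv I q.2 p.2)) p := (hasFDerivAt_id p.1).prodMap p h2
      have h5 : writtenInExtChartAt 𝓘(ℝ, ℝ × E) (𝓘(ℝ, ℝ).prod I) p
          (extChartAt (𝓘(ℝ, ℝ).prod I) q).symm = Prod.map id (fun y =>
            extChartAt I ((extChartAt I q.2).symm p.2) ((extChartAt I q.2).symm y)) := by
        rw [writtenInExtChartAt, extChartAt_prod, extChartAt_prod]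
        rfl
      rw [h5]
      exact h4.hasFDerivWithinAt
  refine h1.mfderivWithin ?_
  rw [ModelWithCorners.range_eq_univ]
  exact uniqueMDiffWithinAt_univ _

lemma pullVec_prodMap_id {A : E →L[ℝ] E} (hA : A.IsInvertible) (a : GenVec (ℝ × E)) :
    pullVec ((ContinuousLinearMap.id ℝ ℝ).prodMap A) a =
      ((a.1.1, A.inverse a.1.2), a.2 ∘L (ContinuousLinearMap.id ℝ ℝ).prodMap A) := by
  obtain ⟨A, rfl⟩ := hA
  have h : ((ContinuousLinearMap.id ℝ ℝ).prodMap (A : E →L[ℝ] E)) =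
      ((ContinuousLinearEquiv.refl ℝ ℝ).prodCongr A : ℝ × E →L[ℝ] ℝ × E) := rfl
  rw [pullVec, h, ContinuousLinearMap.inverse_equiv]
  refine Prod.ext ?_ rfl
  simp
  rfl

lemma chartRep_lift (q : ℝ × M) (a : ℝ → M → GenVec E) {p : ℝ × E}
    (hp : p.2 ∈ (extChartAt I q.2).target) :
    chartRep (𝓘(ℝ, ℝ).prod I) q (lift a) p = liftCLM (chartRep I q.2 (a p.1) p.2) := by
  rw [chartRep, chartDeriv_prod I q hp, pullVec_prodMap_id (chartDeriv_isInvertible I hp),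
    extChartAt_prod_symm_apply, lift, liftCLM_apply]
  rfl

lemma chartRep_timeSection (q : ℝ × M) (c : ℝ) {p : ℝ × E}
    (hp : p.2 ∈ (extChartAt I q.2).target) :
    chartRep (𝓘(ℝ, ℝ).prod I) q (timeSection c) p =
      ((1, 0), c • ContinuousLinearMap.fst ℝ ℝ E) := by
  rw [chartRep, chartDeriv_prod I q hp, pullVec_prodMap_id (chartDeriv_isInvertible I hp),
    timeSection]
  refine Prod.ext ?_ ?_
  · simp
  · ext <;> simp

lemma chartRep_time_sub_lift (q : ℝ × M) (c : ℝ) (u : ℝ → M → GenVec E) {p : ℝ × E}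
    (hp : p.2 ∈ (extChartAt I q.2).target) :
    chartRep (𝓘(ℝ, ℝ).prod I) q (fun p => timeSection c p - lift u p) p =
      ((1, 0), c • ContinuousLinearMap.fst ℝ ℝ E) - liftCLM (chartRep I q.2 (u p.1) p.2) := by
  rw [chartRep_sub, chartRep_lift I q u hp, chartRep_timeSection I q c hp]

end Families

section SmoothLift

variable {E : Type*} [NormedAddCommGroup E] [NormedSpace ℝ E] {H : Type*} [TopologicalSpace H]
  {I : ModelWithCorners ℝ E H} [I.Boundaryless]
  {M : Type*} [TopologicalSpace M] [ChartedSpace H M] [IsManifold I ∞ M]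

lemma IsSmoothSectionFamilyOn.lift {J : Set ℝ} (hJ : IsOpen J) {a : ℝ → M → GenVec E}
    (ha : IsSmoothSectionFamilyOn I J a) :
    IsSmoothSectionOn (𝓘(ℝ, ℝ).prod I) (GenGeom.lift a) (J ×ˢ (Set.univ : Set M)) := by
  refine isSmoothSectionOn_of_chartRep _ (hJ.prod isOpen_univ) fun q => ?_
  refine (ContDiffOn.clm_comp liftCLM ((ha q.2).mono (prod_target_inter_subset I J q))).congr ?_
  exact fun p hp => chartRep_lift I q a ((mem_extChartAt_prod_target I q p).1 hp.1)

lemma IsSmoothSectionFamilyOn.time_sub_lift {J : Set ℝ} (hJ : IsOpen J) {u : ℝ → M → GenVec E}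
    (hu : IsSmoothSectionFamilyOn I J u) (c : ℝ) :
    IsSmoothSectionOn (𝓘(ℝ, ℝ).prod I) (fun p => timeSection c p - GenGeom.lift u p)
      (J ×ˢ (Set.univ : Set M)) := by
  refine isSmoothSectionOn_of_chartRep _ (hJ.prod isOpen_univ) fun q => ?_
  refine ((contDiffOn_const
    (c := (((1, 0), c • ContinuousLinearMap.fst ℝ ℝ E) : GenVec (ℝ × E)))).sub
    (ContDiffOn.clm_comp liftCLM ((hu q.2).mono (prod_target_inter_subset I J q)))).congr ?_
  exact fun p hp => chartRep_time_sub_lift I q c u ((mem_extChartAt_prod_target I q p).1 hp.1)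

end SmoothLift

/-! ### The flow implies the Nahm-type equations -/

section FirstJets

/-- Differentiability in each degree gives a derivative of the form of mixed degree. -/
lemma exists_hasFormDerivAt {V W : Type*} [NormedAddCommGroup V] [NormedSpace ℝ V]
    [NormedAddCommGroup W] [NormedSpace ℝ W] {φ : W → MixedForm V} {x : W}
    (h : ∀ k, DifferentiableAt ℝ (fun y => φ y k) x) :
    ∃ φ' : W →ₗ[ℝ] MixedForm V, HasFormDerivAt φ φ' x :=
  ⟨{ toFun := fun X k => fderiv ℝ (fun y => φ y k) x X
     map_add' := fun X Y => funext fun _ => map_add _ X Y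
     map_smul' := fun c X => funext fun _ => map_smul _ c X },
   fun k => ⟨_, (h k).hasFDerivAt, fun _ => rfl⟩⟩

lemma HasFormDerivAt.comp_inr {V W : Type*} [NormedAddCommGroup V] [NormedSpace ℝ V]
    [NormedAddCommGroup W] [NormedSpace ℝ W] {φ : ℝ × W → MixedForm V}
    {φ' : ℝ × W →ₗ[ℝ] MixedForm V} {t : ℝ} {y : W} (h : HasFormDerivAt φ φ' (t, y)) :
    HasFormDerivAt (fun z => φ (t, z)) (φ' ∘ₗ LinearMap.inr ℝ ℝ W) y := by
  intro k
  obtain ⟨L, hL, hL'⟩ := h k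
  exact ⟨_, hL.comp y (hasFDerivAt_prodMk_right t y), fun X => hL' (0, X)⟩

lemma HasFDerivAt.comp_inr {W F : Type*} [NormedAddCommGroup W] [NormedSpace ℝ W]
    [NormedAddCommGroup F] [NormedSpace ℝ F] {f : ℝ × W → F} {f' : ℝ × W →L[ℝ] F} {t : ℝ} {y : W}
    (h : HasFDerivAt f f' (t, y)) :
    HasFDerivAt (fun z => f (t, z)) (f' ∘L ContinuousLinearMap.inr ℝ ℝ W) y :=
  h.comp y (hasFDerivAt_prodMk_right t y)

lemma HasFDerivAt.hasDerivAt_left {W F : Type*} [NormedAddCommGroup W] [NormedSpace ℝ W]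
    [NormedAddCommGroup F] [NormedSpace ℝ F] {f : ℝ × W → F} {f' : ℝ × W →L[ℝ] F} {t : ℝ} {y : W}
    (h : HasFDerivAt f f' (t, y)) : HasDerivAt (fun s => f (s, y)) (f' (1, 0)) t := by
  have := (HasFDerivAt.comp t h (hasFDerivAt_prodMk_left t y)).hasDerivAt
  simpa [Function.comp_def] using this

end FirstJets

section SectionJets

variable {E : Type*} [NormedAddCommGroup E] [NormedSpace ℝ E] {H : Type*} [TopologicalSpace H]
  {I : ModelWithCorners ℝ E H} {M : Type*} [TopologicalSpace M] [ChartedSpace H M]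

lemma IsSmoothSectionFamilyOn.exists_hasFDerivAt [I.Boundaryless] {J : Set ℝ} (hJ : IsOpen J)
    {a : ℝ → M → GenVec E} (ha : IsSmoothSectionFamilyOn I J a) {t : ℝ} (ht : t ∈ J) (x : M) :
    ∃ L : ℝ × E →L[ℝ] GenVec E, HasFDerivAt (fun p : ℝ × E => chartRep I x (a p.1) p.2) L
      (t, extChartAt I x x) := by
  refine ⟨_, (((ha x).contDiffAt ?_).differentiableAt (by simp)).hasFDerivAt⟩
  exact prod_mem_nhds (hJ.mem_nhds ht) (extChartAt_target_mem_nhds x)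

lemma hasDerivAt_of_chartRep [IsManifold I 1 M] {a : ℝ → M → GenVec E} {t : ℝ} {x : M}
    {L : ℝ × E →L[ℝ] GenVec E} (hL : HasFDerivAt (fun p : ℝ × E => chartRep I x (a p.1) p.2) L
      (t, extChartAt I x x)) : HasDerivAt (fun s => a s x) (L (1, 0)) t := by
  have := HasFDerivAt.hasDerivAt_left hL
  simpa only [chartRep_self] using this

end SectionJets

section Flow

variable {M : Type*} [TopologicalSpace M] [ChartedSpace (EuclideanSpace ℝ (Fin 5)) M]
  {μ : M → V5 [⋀^Fin 5]→L[ℝ] ℝ} {J : Set ℝ}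
  {ρ : ℝ → Fin 2 → M → MixedForm V5} {σ : ℝ}

lemma apply_e5_ne_zero {ν : V5 [⋀^Fin 5]→L[ℝ] ℝ} (h : ν ≠ 0) : ν e5 ≠ 0 :=
  fun h0 => h (eq_zero_of_apply_e5 h0)

lemma contDiffOn_inChart_prod (hμ : IsSmoothFormOn (𝓡 5) μ Set.univ) (x₀ : M) :
    ContDiffOn ℝ ∞ (fun p : ℝ × V5 => inChart (𝓡 5) x₀ μ p.2)
      (J ×ˢ (extChartAt (𝓡 5) x₀).target) :=
  (hμ x₀).comp contDiff_snd.contDiffOn fun _ hp => ⟨hp.2, trivial⟩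

variable [IsManifold (𝓡 5) ∞ M]

lemma inChart_e5_ne_zero (hμ0 : ∀ x, μ x ≠ 0) (x₀ : M) {y : V5}
    (hy : y ∈ (extChartAt (𝓡 5) x₀).target) : inChart (𝓡 5) x₀ μ y e5 ≠ 0 :=
  compContinuousLinearMap_e5_ne_zero (chartDeriv_isInvertible (𝓡 5) hy)
    (apply_e5_ne_zero (hμ0 _))

/-- The quartic `f(ρ)`, relative to `μ`, can be computed in any chart. -/
lemma quartic_inChart (hμ0 : ∀ x, μ x ≠ 0) (x₀ : M) {y : V5}
    (hy : y ∈ (extChartAt (𝓡 5) x₀).target) (r : Fin 2 → M → MixedForm V5) :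
    quartic (inChart (𝓡 5) x₀ μ y) (fun i => chartForm (𝓡 5) x₀ (r i) y) =
      quartic (μ ((extChartAt (𝓡 5) x₀).symm y)) (fun i => r i ((extChartAt (𝓡 5) x₀).symm y)) :=
  quartic_pull (chartDeriv_isInvertible (𝓡 5) hy) (apply_e5_ne_zero (hμ0 _)) _

/-- In a chart, `v₁`, `h` and `v₂` are given by the same algebraic expressions in the forms. -/
lemma chartRep_bilin_volForm (hμ0 : ∀ x, μ x ≠ 0) (x₀ : M) {y : V5}
    (hy : y ∈ (extChartAt (𝓡 5) x₀).target) (r : Fin 2 → M → MixedForm V5)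
    (hq : ∀ x, quartic (μ x) (fun i => r i x) ≠ 0) (i j : Fin 2) :
    chartRep (𝓡 5) x₀ (fun x => bilin (volForm (μ x) (fun i => r i x)) (r i x) (r j x)) y =
      bilin (volForm (inChart (𝓡 5) x₀ μ y) (fun i => chartForm (𝓡 5) x₀ (r i) y))
        (chartForm (𝓡 5) x₀ (r i) y) (chartForm (𝓡 5) x₀ (r j) y) :=
  (bilin_volForm_pull (chartDeriv_isInvertible (𝓡 5) hy) (apply_e5_ne_zero (hμ0 _))
    (ρ := fun i => r i ((extChartAt (𝓡 5) x₀).symm y)) (hq _) i j).symm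

/-- The sections `v₁`, `h`, `v₂` depend smoothly on time and position. -/
lemma isSmoothSectionFamilyOn_bilin (hμ : IsSmoothFormOn (𝓡 5) μ Set.univ) (hμ0 : ∀ x, μ x ≠ 0)
    (hsmooth : ∀ i, IsSmoothFamilyOn (𝓡 5) J (fun t => ρ t i))
    (hq : ∀ t ∈ J, ∀ x, quartic (μ x) (fun i => ρ t i x) ≠ 0) (i j : Fin 2) :
    IsSmoothSectionFamilyOn (𝓡 5) J
      (fun t x => bilin (volForm (μ x) (fun i => ρ t i x)) (ρ t i x) (ρ t j x)) := by
  intro x₀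
  refine (contDiffOn_bilin_volForm (W := ℝ × V5) (ρ := fun i p => chartForm (𝓡 5) x₀ (ρ p.1 i) p.2)
    (contDiffOn_inChart_prod hμ x₀) (fun p hp => inChart_e5_ne_zero hμ0 x₀ hp.2)
    (fun i k => hsmooth i k x₀) (fun p hp => ?_) i j).congr fun p hp => ?_
  · rw [quartic_inChart hμ0 x₀ hp.2]
    exact hq _ hp.1 _
  · exact chartRep_bilin_volForm hμ0 x₀ hp.2 (ρ p.1) (hq _ hp.1) i j

/-- Under the flow `∂ρ/∂t = dρ̂` the sections `v₁`, `h`, `v₂` satisfy the Nahm-type equations. At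
each point this is `nahm_jet` for the 1-jets in the chart at that point. -/
theorem nahm_of_flow (hμ : IsSmoothFormOn (𝓡 5) μ Set.univ) (hμ0 : ∀ x, μ x ≠ 0)
    (hJ : IsOpen J) (hsmooth : ∀ i, IsSmoothFamilyOn (𝓡 5) J (fun t => ρ t i))
    (heven : ∀ t ∈ J, ∀ i x, IsEven (ρ t i x))
    (hclosed : ∀ t ∈ J, ∀ i x k, mixedD (𝓡 5) (ρ t i) x k = 0)
    (hσ : σ = 1 ∨ σ = -1)
    (hstable : ∀ t ∈ J, ∀ x, σ * quartic (μ x) (fun i => ρ t i x) < 0)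
    {ρhat : ℝ → Fin 2 → M → MixedForm V5}
    (hhat : ∀ t ∈ J, ∀ x, IsHat (μ x) (fun i => ρ t i x) (fun i => ρhat t i x))
    (hflow : ∀ t ∈ J, ∀ i x k,
      HasDerivAt (fun s => ρ s i x k) (mixedD (𝓡 5) (ρhat t i) x k) t)
    {v₁ h v₂ : ℝ → M → GenVec V5}
    (hv₁ : v₁ = fun t x => vOne (μ x) (fun i => ρ t i x))
    (hh : h = fun t x => hMid (μ x) (fun i => ρ t i x))
    (hv₂ : v₂ = fun t x => vTwo (μ x) (fun i => ρ t i x)) {t : ℝ} (ht : t ∈ J) (x : M) :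
    ∃ l : ℝ, HasDerivAt (fun s => v₁ s x)
        (-(2 * σ) • courant (𝓡 5) (h t) (v₁ t) x + l • v₁ t x) t ∧
      HasDerivAt (fun s => h s x) (σ • courant (𝓡 5) (v₁ t) (v₂ t) x + l • h t x) t ∧
      HasDerivAt (fun s => v₂ s x)
        ((2 * σ) • courant (𝓡 5) (h t) (v₂ t) x + l • v₂ t x) t := by
  have hq : ∀ t ∈ J, ∀ x, quartic (μ x) (fun i => ρ t i x) ≠ 0 := fun t ht x h0 => by
    have := hstable t ht x
    simp [h0] at this
  have sv₁ : IsSmoothSectionFamilyOn (𝓡 5) J v₁ := by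
    rw [hv₁]; exact isSmoothSectionFamilyOn_bilin hμ hμ0 hsmooth hq 0 0
  have sh : IsSmoothSectionFamilyOn (𝓡 5) J h := by
    rw [hh]; exact isSmoothSectionFamilyOn_bilin hμ hμ0 hsmooth hq 0 1
  have sv₂ : IsSmoothSectionFamilyOn (𝓡 5) J v₂ := by
    rw [hv₂]; exact isSmoothSectionFamilyOn_bilin hμ hμ0 hsmooth hq 1 1
  obtain ⟨L₁, hL₁⟩ := sv₁.exists_hasFDerivAt hJ ht x
  obtain ⟨L, hL⟩ := sh.exists_hasFDerivAt hJ ht x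
  obtain ⟨L₂, hL₂⟩ := sv₂.exists_hasFDerivAt hJ ht x
  set y₀ := extChartAt (𝓡 5) x x with hy₀
  have hnhds : J ×ˢ (extChartAt (𝓡 5) x).target ∈ 𝓝 (t, y₀) :=
    prod_mem_nhds (hJ.mem_nhds ht) (extChartAt_target_mem_nhds x)
  -- the forms and the volume form in the chart at `x`
  let R : Fin 2 → ℝ × V5 → MixedForm V5 := fun i p => chartForm (𝓡 5) x (ρ p.1 i) p.2
  let ν : ℝ × V5 → V5 [⋀^Fin 5]→L[ℝ] ℝ := fun p =>
    volForm (inChart (𝓡 5) x μ p.2) (fun i => R i p)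
  have hRq : ∀ p ∈ J ×ˢ (extChartAt (𝓡 5) x).target,
      quartic (inChart (𝓡 5) x μ p.2) (fun i => R i p) ≠ 0 := fun p hp => by
    rw [quartic_inChart hμ0 x hp.2]
    exact hq _ hp.1 _
  have hν : ContDiffOn ℝ ∞ ν (J ×ˢ (extChartAt (𝓡 5) x).target) :=
    contDiffOn_volForm (contDiffOn_inChart_prod hμ x)
      (fun p hp => inChart_e5_ne_zero hμ0 x hp.2) (fun i k => hsmooth i k x) hRq
  obtain ⟨N', hN'⟩ : ∃ N', HasFDerivAt (fun p => ν p e5) N' (t, y₀) :=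
    ⟨_, (ContinuousAlternatingMap.apply ℝ V5 ℝ e5).hasFDerivAt.comp _
      ((hν.contDiffAt hnhds).differentiableAt (by simp)).hasFDerivAt⟩
  have hR : ∀ i, ∃ D, HasFormDerivAt (R i) D (t, y₀) := fun i =>
    exists_hasFormDerivAt fun k => ((hsmooth i k x).contDiffAt hnhds).differentiableAt (by simp)
  obtain ⟨Dα, hDα⟩ := hR 0
  obtain ⟨Dβ, hDβ⟩ := hR 1
  have rel : ∀ᶠ p in 𝓝 (t, y₀), Relations σ (ν p e5) (R 0 p) (R 1 p)
      (chartRep (𝓡 5) x (v₁ p.1) p.2) (chartRep (𝓡 5) x (h p.1) p.2)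
      (chartRep (𝓡 5) x (v₂ p.1) p.2) := by
    filter_upwards [hnhds] with p hp
    have r := relations (ρ := fun i => R i p) (inChart_e5_ne_zero hμ0 x hp.2) hσ
      (by rw [quartic_inChart hμ0 x hp.2]; exact hstable _ hp.1 _)
      (fun i k hk => by
        change (ρ p.1 i ((extChartAt (𝓡 5) x).symm p.2) k).compContinuousLinearMap _ = 0
        rw [heven p.1 hp.1 i _ k hk]; rfl)
    rw [hv₁, hh, hv₂]
    have c := chartRep_bilin_volForm hμ0 x hp.2 (ρ p.1) (hq _ hp.1)
    have c₁ : chartRep (𝓡 5) x (fun x => vOne (μ x) (fun i => ρ p.1 i x)) p.2 = _ := c 0 0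
    have c₂ : chartRep (𝓡 5) x (fun x => hMid (μ x) (fun i => ρ p.1 i x)) p.2 = _ := c 0 1
    have c₃ : chartRep (𝓡 5) x (fun x => vTwo (μ x) (fun i => ρ p.1 i x)) p.2 = _ := c 1 1
    simp only [c₁, c₂, c₃]
    exact r
  have var := variation_of_eventually rel hN' hDα hDβ hL₁ hL hL₂
  have r₀ := rel.self_of_nhds
  have hN0 : ν (t, y₀) e5 ≠ 0 :=
    volForm_e5_ne_zero (σ := σ) (inChart_e5_ne_zero hμ0 x (mem_extChartAt_target x))
      (by rw [quartic_inChart hμ0 x (mem_extChartAt_target x)]; exact hstable _ ht _)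
  -- the forms are closed
  have cl : ∀ i (D : ℝ × V5 →ₗ[ℝ] MixedForm V5), HasFormDerivAt (R i) D (t, y₀) →
      dirac (D ∘ₗ LinearMap.inr ℝ ℝ V5) = 0 := by
    intro i D hD
    rw [← mixedD_eq_dirac (α := ρ t i) hD.comp_inr]
    exact funext fun k => hclosed t ht i x k
  -- the flow equation, for `ρ̂ = c h · ρ`
  have fl : ∀ i (D : ℝ × V5 →ₗ[ℝ] MixedForm V5), HasFormDerivAt (R i) D (t, y₀) → ∀ c : ℝ,
      (∀ x', ρhat t i x' = c • clifford (h t x') (ρ t i x')) →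
      D (1, 0) = c • lieJet (h t x) (L ∘L ContinuousLinearMap.inr ℝ ℝ V5 : V5 →L[ℝ] GenVec V5)
        (ρ t i x) (D ∘ₗ LinearMap.inr ℝ ℝ V5) := by
    intro i D hD c hc
    have e₁ : D (1, 0) = mixedD (𝓡 5) (ρhat t i) x := by
      funext k
      obtain ⟨K, hK, hK'⟩ := hD k
      rw [← hK']
      have hK₂ := HasFDerivAt.hasDerivAt_left hK
      refine hK₂.unique ?_
      have : ∀ s, R i (s, y₀) = ρ s i x := fun s => chartForm_self (𝓡 5) x (ρ s i)
      simp only [this]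
      exact hflow t ht i x k
    have e₂ := (HasFormDerivAt.clifford (HasFDerivAt.comp_inr hL) hD.comp_inr).const_smul c
    have e₃ : HasFormDerivAt (chartForm (𝓡 5) x (ρhat t i)) _ y₀ := e₂.congr (by
      filter_upwards [extChartAt_target_mem_nhds (I := 𝓡 5) x] with y hy
      change pullForm _ (ρhat t i _) = _
      rw [hc, pullForm_smul, ← clifford_pull (chartDeriv_isInvertible (𝓡 5) hy)]
      rfl)
    rw [e₁, mixedD_eq_dirac e₃, lieJet, ← dirac_smul]
    congr 1
    funext X
    have a₁ : chartRep (𝓡 5) x (h t) y₀ = h t x := chartRep_self (𝓡 5) x (h t)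
    have a₂ : R i (t, y₀) = ρ t i x := chartForm_self (𝓡 5) x (ρ t i)
    simp only [a₁, a₂]
    rfl
  -- `ρ̂₁ = -2σ h · ρ₁` and `ρ̂₂ = 2σ h · ρ₂`
  have hhat0 : ∀ x', ρhat t 0 x' = (-2 * σ) • clifford (h t x') (ρ t 0 x') := by
    intro x'
    have e := (IsHat.eq (apply_e5_ne_zero (hμ0 x')) hσ (hstable t ht x')
      (fun i => heven t ht i x') (hhat t ht x')).1
    have r := relations (apply_e5_ne_zero (hμ0 x')) hσ (hstable t ht x')
      (fun i => heven t ht i x')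
    rw [e, r.mid₁, smul_smul, hh]
    congr 1; ring
  have hhat1 : ∀ x', ρhat t 1 x' = (2 * σ) • clifford (h t x') (ρ t 1 x') := by
    intro x'
    have e := (IsHat.eq (apply_e5_ne_zero (hμ0 x')) hσ (hstable t ht x')
      (fun i => heven t ht i x') (hhat t ht x')).2
    have r := relations (apply_e5_ne_zero (hμ0 x')) hσ (hstable t ht x')
      (fun i => heven t ht i x')
    rw [e, r.mid₂, smul_smul, hh]
    congr 1; ring
  -- at `x` itself the representatives in the chart are the given sections and forms
  have s₁ : chartRep (𝓡 5) x (v₁ t) y₀ = v₁ t x := chartRep_self (𝓡 5) x (v₁ t)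
  have s₂ : chartRep (𝓡 5) x (h t) y₀ = h t x := chartRep_self (𝓡 5) x (h t)
  have s₃ : chartRep (𝓡 5) x (v₂ t) y₀ = v₂ t x := chartRep_self (𝓡 5) x (v₂ t)
  have s₄ : ∀ i, R i (t, y₀) = ρ t i x := fun i => chartForm_self (𝓡 5) x (ρ t i)
  simp only [s₁, s₂, s₃, s₄] at var r₀
  have key := nahm_jet (DN := N' ∘ₗ LinearMap.inr ℝ ℝ V5) (Dα := Dα ∘ₗ LinearMap.inr ℝ ℝ V5)
    (Dβ := Dβ ∘ₗ LinearMap.inr ℝ ℝ V5) (Dv₁ := L₁ ∘L ContinuousLinearMap.inr ℝ ℝ V5)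
    (Dh := L ∘L ContinuousLinearMap.inr ℝ ℝ V5) (Dv₂ := L₂ ∘L ContinuousLinearMap.inr ℝ ℝ V5)
    hσ hN0 r₀ (fun X => var (0, X)) (var (1, 0)) (cl 0 Dα hDα) (cl 1 Dβ hDβ)
    (fl 0 Dα hDα _ hhat0) (fl 1 Dβ hDβ _ hhat1)
  have c₁ := HasFDerivAt.comp_inr hL₁
  have c₂ := HasFDerivAt.comp_inr hL
  have c₃ := HasFDerivAt.comp_inr hL₂
  refine ⟨-N' (1, 0) / ν (t, y₀) e5, ?_, ?_, ?_⟩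
  · rw [courant_eq (𝓡 5) c₂ c₁, ← key.1]
    exact hasDerivAt_of_chartRep hL₁
  · rw [courant_eq (𝓡 5) c₁ c₃, ← key.2.1]
    exact hasDerivAt_of_chartRep hL
  · rw [courant_eq (𝓡 5) c₂ c₃, ← key.2.2]
    exact hasDerivAt_of_chartRep hL₂

end Flow

/-! ### Brackets of sections of an isotropic plane field -/

section CourantSpan

variable {V : Type*} [NormedAddCommGroup V] [NormedSpace ℝ V]

lemma courantJet_swap (a : GenVec V) (Da : V →L[ℝ] GenVec V) (b : GenVec V)
    (Db : V →L[ℝ] GenVec V) : courantJet b Db a Da = -courantJet a Da b Db := by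
  refine eq_of_pairing_eq fun e => ?_
  rw [pairing_neg_left, pairing_courantJet, pairing_courantJet, pairing_comm _ a, pairing_comm b]
  ring

/-- The Courant bracket is additive in the first argument and satisfies a Leibniz rule,
which simplifies when the sections are orthogonal. -/
lemma courantJet_combination (f g : ℝ) (f' g' : V →L[ℝ] ℝ) (v w : GenVec V)
    (Dv Dw : V →L[ℝ] GenVec V) (b : GenVec V) (Db : V →L[ℝ] GenVec V)
    (hvb : pairing v b = 0) (hwb : pairing w b = 0) :
    courantJet (f • v + g • w) (f • Dv + g • Dw + f'.smulRight v + g'.smulRight w) b Db =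
      f • courantJet v Dv b Db + g • courantJet w Dw b Db - f' b.1 • v - g' b.1 • w := by
  refine eq_of_pairing_eq fun e => ?_
  simp only [pairing_courantJet, pairing_sub_left, pairing_add_left, pairing_smul_left,
    add_apply, smul_apply, ContinuousLinearMap.smulRight_apply, Prod.fst_add, Prod.smul_fst,
    map_add, map_smul, hvb, hwb]
  ring

/-- The Courant bracket of two sections of an isotropic plane field spanned by `v` and `w` lies
in the plane as soon as the bracket of `w` and `v` does. -/
lemma courantJet_mem {D : Submodule ℝ (GenVec V)} (hD : ∀ a ∈ D, ∀ b ∈ D, pairing a b = 0)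
    {v w : GenVec V} {Dv Dw : V →L[ℝ] GenVec V} (hv : v ∈ D) (hw : w ∈ D)
    (hC : courantJet w Dw v Dv ∈ D) (f g f₂ g₂ : ℝ) (f' g' f₂' g₂' : V →L[ℝ] ℝ) :
    courantJet (f • v + g • w) (f • Dv + g • Dw + f'.smulRight v + g'.smulRight w)
      (f₂ • v + g₂ • w) (f₂ • Dv + g₂ • Dw + f₂'.smulRight v + g₂'.smulRight w) ∈ D := by
  have hb : f₂ • v + g₂ • w ∈ D := D.add_mem (D.smul_mem _ hv) (D.smul_mem _ hw)
  have h0 : ∀ c ∈ D, ∀ Dc : V →L[ℝ] GenVec V, courantJet v Dv c Dc ∈ D →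
      courantJet w Dw c Dc ∈ D → ∀ (f g : ℝ) (f' g' : V →L[ℝ] ℝ),
      courantJet (f • v + g • w) (f • Dv + g • Dw + f'.smulRight v + g'.smulRight w) c Dc ∈ D := by
    intro c hc Dc h1 h2 f g f' g'
    rw [courantJet_combination _ _ _ _ _ _ _ _ _ _ (hD v hv c hc) (hD w hw c hc)]
    exact D.sub_mem (D.sub_mem (D.add_mem (D.smul_mem _ h1) (D.smul_mem _ h2))
      (D.smul_mem _ hv)) (D.smul_mem _ hw)
  refine h0 _ hb _ ?_ ?_ f g f' g'
  · rw [courantJet_swap]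
    refine D.neg_mem (h0 v hv Dv ?_ hC _ _ _ _)
    rw [courantJet_self]; exact D.zero_mem
  · rw [courantJet_swap]
    refine D.neg_mem (h0 w hw Dw ?_ ?_ _ _ _ _)
    · rw [courantJet_swap]; exact D.neg_mem hC
    · rw [courantJet_self]; exact D.zero_mem

/-- A differentiable section of a plane field has differentiable coefficients with respect to a
frame `v`, `w`. The functional `ℓ` gives the coefficient of `w`, and `m` then that of `v`. -/
lemma exists_coefficients {W F : Type*} [NormedAddCommGroup W] [NormedSpace ℝ W]
    [NormedAddCommGroup F] [NormedSpace ℝ F] {x : W} {v w a : W → F} {Dv Dw : W →L[ℝ] F}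
    (hv : HasFDerivAt v Dv x) (hw : HasFDerivAt w Dw x) (ha : DifferentiableAt ℝ a x)
    (hmem : ∀ᶠ y in 𝓝 x, a y ∈ Submodule.span ℝ {v y, w y}) (ℓ m : F →L[ℝ] ℝ)
    (hℓv : ∀ᶠ y in 𝓝 x, ℓ (v y) = 0) (hℓw : ∀ᶠ y in 𝓝 x, ℓ (w y) = 1) (hm : m (v x) ≠ 0) :
    ∃ (f g : ℝ) (f' g' : W →L[ℝ] ℝ), a x = f • v x + g • w x ∧
      HasFDerivAt a (f • Dv + g • Dw + f'.smulRight (v x) + g'.smulRight (w x)) x := by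
  have hg : DifferentiableAt ℝ (fun y => ℓ (a y)) x := ℓ.differentiableAt.comp x ha
  have hf : DifferentiableAt ℝ (fun y => m (a y - ℓ (a y) • w y) / m (v y)) x := by
    have h1 : DifferentiableAt ℝ (fun y => m (a y - ℓ (a y) • w y)) x :=
      m.differentiableAt.comp x (ha.sub (hg.smul hw.differentiableAt))
    have h2 : DifferentiableAt ℝ (fun y => m (v y)) x :=
      m.differentiableAt.comp x hv.differentiableAt
    simpa only [div_eq_mul_inv] using h1.fun_mul (h2.fun_inv hm)
  have hm' : ∀ᶠ y in 𝓝 x, m (v y) ≠ 0 :=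
    (m.continuous.continuousAt.comp hv.continuousAt).eventually_ne hm
  have heq : ∀ᶠ y in 𝓝 x,
      a y = (m (a y - ℓ (a y) • w y) / m (v y)) • v y + ℓ (a y) • w y := by
    filter_upwards [hmem, hℓv, hℓw, hm'] with y h1 h2 h3 h4
    obtain ⟨c, d, h⟩ := Submodule.mem_span_pair.1 h1
    have hd : ℓ (a y) = d := by rw [← h]; simp [h2, h3]
    have hc : m (a y - ℓ (a y) • w y) / m (v y) = c := by
      rw [hd, ← h, add_sub_cancel_right, map_smul, smul_eq_mul, mul_div_assoc, div_self h4,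
        mul_one]
    rw [hc, hd, h]
  obtain ⟨f', hf'⟩ : ∃ f', HasFDerivAt (fun y => m (a y - ℓ (a y) • w y) / m (v y)) f' x :=
    ⟨_, hf.hasFDerivAt⟩
  obtain ⟨g', hg'⟩ : ∃ g', HasFDerivAt (fun y => ℓ (a y)) g' x := ⟨_, hg.hasFDerivAt⟩
  refine ⟨_, _, f', g', heq.self_of_nhds, ?_⟩
  refine (((hf'.smul hv).add (hg'.smul hw)).congr_of_eventuallyEq heq).congr_fderiv ?_
  abel

end CourantSpan

/-! ### The bracket of `∂/∂t + c dt - u` and `v` -/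

section LiftAlgebra

variable {E : Type*} [NormedAddCommGroup E] [NormedSpace ℝ E]

/-- The vector `∂/∂t + c dt`. -/
def timeVec (c : ℝ) : GenVec (ℝ × E) := ((1, 0), c • ContinuousLinearMap.fst ℝ ℝ E)

lemma pairing_liftCLM (a b : GenVec E) : pairing (liftCLM a) (liftCLM b) = pairing a b := by
  simp [pairing, liftCLM_apply]

lemma pairing_timeVec_liftCLM (c : ℝ) (a : GenVec E) : pairing (timeVec c) (liftCLM a) = 0 := by
  simp [pairing, liftCLM_apply, timeVec]

lemma pairing_timeVec (c : ℝ) : pairing (timeVec c : GenVec (ℝ × E)) (timeVec c) = c := by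
  simp [pairing, timeVec]

lemma liftCLM_ne_zero {a : GenVec E} (h : a ≠ 0) : liftCLM a ≠ 0 := by
  intro h0
  refine h (eq_of_pairing_eq fun e => ?_)
  rw [← pairing_liftCLM, h0, pairing_zero_left, pairing_zero_left]

lemma exists_pairing_ne_zero {a : GenVec E} (h : a ≠ 0) : ∃ e, pairing e a ≠ 0 := by
  by_contra! hc
  refine h (eq_of_pairing_eq fun e => ?_)
  rw [pairing_comm, hc, pairing_zero_left]

/-- The inner products of `∂/∂t + c dt - u` with itself and with a vector over `M`. -/
lemma pairing_time_sub_lift (c : ℝ) (u v : GenVec E) :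
    pairing (timeVec c - liftCLM u) (timeVec c - liftCLM u) = c + pairing u u ∧
    pairing (timeVec c - liftCLM u) (liftCLM v) = -pairing u v := by
  constructor
  · rw [pairing_sub_left, pairing_comm (timeVec c), pairing_comm (liftCLM u) (timeVec c - _),
      pairing_sub_left, pairing_sub_left, pairing_timeVec, pairing_timeVec_liftCLM,
      pairing_comm (liftCLM u) (timeVec c), pairing_timeVec_liftCLM, pairing_liftCLM]
    ring
  · rw [pairing_sub_left, pairing_timeVec_liftCLM, pairing_liftCLM]; ring

/-- The span of `v` and `∂/∂t + c dt - u` is isotropic. -/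
lemma pairing_eq_zero_of_mem_span {c : ℝ} {u v : GenVec E} (hvv : pairing v v = 0)
    (huv : pairing u v = 0) (huu : pairing u u = -c) {a b : GenVec (ℝ × E)}
    (ha : a ∈ Submodule.span ℝ {liftCLM v, timeVec c - liftCLM u})
    (hb : b ∈ Submodule.span ℝ {liftCLM v, timeVec c - liftCLM u}) : pairing a b = 0 := by
  obtain ⟨f, g, rfl⟩ := Submodule.mem_span_pair.1 ha
  obtain ⟨f', g', rfl⟩ := Submodule.mem_span_pair.1 hb
  obtain ⟨h1, h2⟩ := pairing_time_sub_lift c u v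
  simp only [pairing_add_left, pairing_add_right, pairing_smul_left, pairing_smul_right,
    pairing_liftCLM, h1, h2, pairing_comm (liftCLM v) (timeVec c - liftCLM u), hvv, huv, huu]
  ring

/-- The bracket of `∂/∂t + c dt - u` and `v` vanishes modulo `v` when `v' = [u, v]` modulo `v`. -/
lemma courantJet_time_sub_lift {c l : ℝ} {u v : GenVec E} {Du Dv : ℝ × E →L[ℝ] GenVec E}
    {Dw : ℝ × E →L[ℝ] GenVec (ℝ × E)} (hDw : ∀ X, Dw X = -liftCLM (Du X))
    (huv : pairing u v = 0) (Duu : ∀ X, pairing (Du X) u = 0)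
    (Duv : ∀ X, pairing (Du X) v + pairing u (Dv X) = 0)
    (hv : Dv (1, 0) = courantJet u (Du ∘L ContinuousLinearMap.inr ℝ ℝ E) v
      (Dv ∘L ContinuousLinearMap.inr ℝ ℝ E) + l • v) :
    courantJet (timeVec c - liftCLM u) Dw (liftCLM v) (liftCLM ∘L Dv) =
      l • liftCLM v := by
  have split : ∀ (D : ℝ × E →L[ℝ] GenVec E) (s : ℝ) (Y : E),
      D (s, Y) = s • D (1, 0) + D (0, Y) := by
    intro D s Y
    rw [← map_smul, ← map_add]; simp
  -- since `(u, u)` is constant, `2 ([u, v], u)` is the derivative of `(u, v) = 0` along `u`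
  have key : pairing u (Dv (1, 0)) = 0 := by
    rw [hv, pairing_add_right, pairing_smul_right, huv, mul_zero, add_zero, pairing_comm,
      pairing_courantJet]
    simp only [ContinuousLinearMap.comp_apply, ContinuousLinearMap.inr_apply, Duu]
    rw [pairing_comm (Dv _) u]
    linear_combination Duv (0, u.1) / 2
  refine eq_of_pairing_eq fun e => ?_
  obtain ⟨⟨s, Y⟩, ξ⟩ := e
  set η : E →L[ℝ] ℝ := ξ ∘L ContinuousLinearMap.inr ℝ ℝ E with hη
  have hlift : ∀ a : GenVec E, pairing (liftCLM a) ((s, Y), ξ) = pairing a (Y, η) := by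
    intro a; simp [pairing, liftCLM_apply, hη]
  have hv' := congrArg (fun a => pairing a (Y, η)) hv
  simp only [pairing_add_left, pairing_smul_left, pairing_courantJet,
    ContinuousLinearMap.comp_apply, ContinuousLinearMap.inr_apply] at hv'
  have e₁ : (timeVec c - liftCLM u : GenVec (ℝ × E)).1 = (1, -u.1) := by
    simp [timeVec, liftCLM_apply]
  have e₂ : (liftCLM v).1 = ((0, v.1) : ℝ × E) := rfl
  have e₃ : ∀ a : GenVec E, pairing (timeVec c - liftCLM u) (liftCLM a) = -pairing u a :=
    fun a => (pairing_time_sub_lift c u a).2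
  have e₄ : Dv (0, -u.1) = -Dv (0, u.1) := by rw [← map_neg]; simp
  rw [pairing_courantJet, pairing_smul_left, hlift, e₁, e₂]
  simp only [hDw, ContinuousLinearMap.comp_apply, pairing_neg_left,
    hlift, e₃, pairing_liftCLM]
  rw [split Dv 1, one_smul, split Du s, split Dv s, e₄]
  simp only [pairing_add_left, pairing_add_right, pairing_smul_left, pairing_smul_right,
    pairing_neg_left, key]
  have k₂ := Duv (1, 0)
  rw [key, add_zero] at k₂
  rw [k₂]
  linear_combination hv'

end LiftAlgebra

/-! ### Integrability over the product with the time axis -/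

lemma HasFDerivAt.const_sub_clm_comp {W F G : Type*} [NormedAddCommGroup W] [NormedSpace ℝ W]
    [NormedAddCommGroup F] [NormedSpace ℝ F] [NormedAddCommGroup G] [NormedSpace ℝ G]
    {f : W → F} {f' : W →L[ℝ] F} {x : W} (L : F →L[ℝ] G) (c : G) (h : HasFDerivAt f f' x) :
    ∃ K : W →L[ℝ] G, HasFDerivAt (fun y => c - L (f y)) K x ∧ ∀ X, K X = -L (f' X) :=
  ⟨_, (HasFDerivAt.clm_comp L h).const_sub c, fun _ => rfl⟩

lemma exists_hasFDerivAt_time_sub_lift {E W : Type*} [NormedAddCommGroup E] [NormedSpace ℝ E]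
    [NormedAddCommGroup W] [NormedSpace ℝ W] (c : ℝ) {f : W → GenVec E} {f' : W →L[ℝ] GenVec E}
    {x : W} (h : HasFDerivAt f f' x) :
    ∃ K : W →L[ℝ] GenVec (ℝ × E),
      HasFDerivAt (fun y => timeVec c - liftCLM (f y)) K x ∧ ∀ X, K X = -liftCLM (f' X) :=
  HasFDerivAt.const_sub_clm_comp (F := GenVec E) (G := GenVec (ℝ × E)) liftCLM (timeVec c) h

lemma extChartAt_prod_apply {E : Type*} [NormedAddCommGroup E] [NormedSpace ℝ E] {H : Type*}
    [TopologicalSpace H] (I : ModelWithCorners ℝ E H) {M : Type*} [TopologicalSpace M]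
    [ChartedSpace H M] (q : ℝ × M) :
    extChartAt (𝓘(ℝ, ℝ).prod I) q q = (q.1, extChartAt I q.2 q.2) := by
  rw [extChartAt_prod]; rfl

section Integrability

variable {E : Type*} [NormedAddCommGroup E] [NormedSpace ℝ E] {H : Type*} [TopologicalSpace H]
  {I : ModelWithCorners ℝ E H} [I.Boundaryless]
  {M : Type*} [TopologicalSpace M] [ChartedSpace H M] [IsManifold I ∞ M]

/-- A smooth section of the span of `v` and `∂/∂t + c dt - u` has, in the chart, differentiable
coefficients with respect to this frame. -/
lemma exists_coefficients_chart {c : ℝ} {u v : ℝ → M → GenVec E} {t : ℝ} {x : M}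
    {Dv : ℝ × E →L[ℝ] GenVec E} {Dw : ℝ × E →L[ℝ] GenVec (ℝ × E)}
    (hDw : HasFDerivAt (fun p : ℝ × E => timeVec c - liftCLM (chartRep I x (u p.1) p.2)) Dw
      (t, extChartAt I x x))
    (hDv : HasFDerivAt (fun p : ℝ × E => chartRep I x (v p.1) p.2) Dv (t, extChartAt I x x))
    (hv0 : v t x ≠ 0) {U : Set (ℝ × M)} (hU : IsOpen U) (hp : (t, x) ∈ U)
    {a : ℝ × M → GenVec (ℝ × E)} (ha : IsSmoothSectionOn (𝓘(ℝ, ℝ).prod I) a U)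
    (hmem : ∀ p ∈ U, a p ∈ Submodule.span ℝ {lift v p, timeSection c p - lift u p}) :
    ∃ (f g : ℝ) (f' g' : ℝ × E →L[ℝ] ℝ),
      a (t, x) = f • liftCLM (v t x) + g • (timeVec c - liftCLM (u t x)) ∧
      HasFDerivAt (chartRep (𝓘(ℝ, ℝ).prod I) (t, x) a)
        (f • (liftCLM ∘L Dv) + g • Dw + f'.smulRight (liftCLM (v t x)) +
          g'.smulRight (timeVec c - liftCLM (u t x)))
        (extChartAt (𝓘(ℝ, ℝ).prod I) (t, x) (t, x)) := by
  have hy := extChartAt_prod_apply I (t, x)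
  have hV : HasFDerivAt (fun p : ℝ × E => liftCLM (chartRep I x (v p.1) p.2)) (liftCLM ∘L Dv)
      (t, extChartAt I x x) := HasFDerivAt.clm_comp liftCLM hDv
  obtain ⟨e, he⟩ := exists_pairing_ne_zero (liftCLM_ne_zero hv0)
  have hd := ha.differentiableAt _ hU hp
  have hUn : (extChartAt (𝓘(ℝ, ℝ).prod I) (t, x)).symm ⁻¹' U ∈
      𝓝 (extChartAt (𝓘(ℝ, ℝ).prod I) (t, x) (t, x)) :=
    (continuousAt_extChartAt_symm (I := 𝓘(ℝ, ℝ).prod I) (t, x)).preimage_mem_nhds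
      (by rw [extChartAt_to_inv]; exact hU.mem_nhds hp)
  have hTn := extChartAt_target_mem_nhds (I := 𝓘(ℝ, ℝ).prod I) (t, x)
  rw [hy] at hd hUn hTn
  have hm : ∀ᶠ p in 𝓝 (t, extChartAt I x x), chartRep (𝓘(ℝ, ℝ).prod I) (t, x) a p ∈
      Submodule.span ℝ {liftCLM (chartRep I x (v p.1) p.2),
        timeVec c - liftCLM (chartRep I x (u p.1) p.2)} := by
    filter_upwards [hTn, hUn] with p hp1 hp2
    have hp1' := (mem_extChartAt_prod_target I (t, x) p).1 hp1
    obtain ⟨f, g, h⟩ := Submodule.mem_span_pair.1 (hmem _ hp2)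
    refine Submodule.mem_span_pair.2 ⟨f, g, ?_⟩
    have c₁ := chartRep_lift I (t, x) v hp1'
    have c₂ := chartRep_time_sub_lift I (t, x) c u hp1'
    rw [chartRep] at c₁ c₂
    refine ((congrArg (pullVec (chartDeriv (𝓘(ℝ, ℝ).prod I) (t, x) p)) h.symm).trans ?_).symm
    rw [pullVec_add, pullVec_smul, pullVec_smul, c₁, c₂]
    rfl
  -- the coefficient of `∂/∂t + c dt - u` is the component along `∂/∂t`, that of `v` is found by
  -- pairing with a constant vector `e`
  obtain ⟨f, g, f', g', h1, h2⟩ := exists_coefficients hV hDw hd hm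
    (ContinuousLinearMap.fst ℝ ℝ E ∘L ContinuousLinearMap.fst ℝ (ℝ × E) (ℝ × E →L[ℝ] ℝ))
    (pairingCLM e) (Filter.Eventually.of_forall fun p => by simp [liftCLM_apply])
    (Filter.Eventually.of_forall fun p => by simp [liftCLM_apply, timeVec])
    (by rw [chartRep_self, pairingCLM_apply]; exact he)
  simp only [chartRep_self] at h1 h2
  refine ⟨f, g, f', g', ?_, ?_⟩
  · rw [← h1, ← hy, chartRep_self]
  · rw [hy]; exact h2

/-- A constant inner product of two time-dependent sections, differentiated. -/
lemma pairing_deriv_eq_zero {J : Set ℝ} (hJ : IsOpen J) {t : ℝ} (ht : t ∈ J) {x : M}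
    {a b : ℝ → M → GenVec E} {A B : ℝ × E →L[ℝ] GenVec E} {r : ℝ}
    (hA : HasFDerivAt (fun p : ℝ × E => chartRep I x (a p.1) p.2) A (t, extChartAt I x x))
    (hB : HasFDerivAt (fun p : ℝ × E => chartRep I x (b p.1) p.2) B (t, extChartAt I x x))
    (h : ∀ t ∈ J, ∀ x, pairing (a t x) (b t x) = r) (X : ℝ × E) :
    pairing (A X) (b t x) + pairing (a t x) (B X) = 0 := by
  obtain ⟨K, hK, hK'⟩ := HasFDerivAt.pairing hA hB
  have hnhds : J ×ˢ (extChartAt I x).target ∈ 𝓝 (t, extChartAt I x x) :=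
    prod_mem_nhds (hJ.mem_nhds ht) (extChartAt_target_mem_nhds x)
  have hc : (fun p : ℝ × E => pairing (chartRep I x (a p.1) p.2) (chartRep I x (b p.1) p.2))
      =ᶠ[𝓝 (t, extChartAt I x x)] fun _ => r := by
    filter_upwards [hnhds] with p hp
    rw [chartRep, chartRep, pairing_pullVec (chartDeriv_isInvertible I hp.2)]
    exact h _ hp.1 _
  have := hK' X
  rw [hK.unique ((hasFDerivAt_const r _).congr_of_eventuallyEq hc)] at this
  rw [chartRep_self, chartRep_self] at this
  exact this.symm

/-- The integrability part of `spanIsotropicIntegrable_of_lax`: sections of the span have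
differentiable coefficients with respect to the frame, and the bracket of the frame is a multiple of
`v` by the equation for `v'`. -/
lemma isCourantIntegrableOn_of_lax {c : ℝ} {J : Set ℝ} (hJ : IsOpen J)
    {u v : ℝ → M → GenVec E} (hu : IsSmoothSectionFamilyOn I J u)
    (hv : IsSmoothSectionFamilyOn I J v)
    (hvv : ∀ t ∈ J, ∀ x, pairing (v t x) (v t x) = 0)
    (huv : ∀ t ∈ J, ∀ x, pairing (u t x) (v t x) = 0)
    (huu : ∀ t ∈ J, ∀ x, pairing (u t x) (u t x) = -c)
    (hv0 : ∀ t ∈ J, ∀ x, v t x ≠ 0)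
    (lax : ∀ t ∈ J, ∀ x, ∃ l : ℝ, HasDerivAt (fun s => v s x)
      (courant I (u t) (v t) x + l • v t x) t) :
    IsCourantIntegrableOn (𝓘(ℝ, ℝ).prod I)
      (fun p => Submodule.span ℝ {lift v p, timeSection c p - lift u p})
      (J ×ˢ (Set.univ : Set M)) := by
  rintro U hU hUJ a b ha hb hamem hbmem ⟨t, x⟩ hp
  have ht : t ∈ J := (hUJ hp).1
  obtain ⟨Dv, hDv⟩ := hv.exists_hasFDerivAt hJ ht x
  obtain ⟨Du, hDu⟩ := hu.exists_hasFDerivAt hJ ht x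
  obtain ⟨Dw, hDw, hDw'⟩ := exists_hasFDerivAt_time_sub_lift c hDu
  obtain ⟨f, g, f', g', ha0, hDa⟩ :=
    exists_coefficients_chart hDw hDv (hv0 t ht x) hU hp ha hamem
  obtain ⟨f₂, g₂, f₂', g₂', hb0, hDb⟩ :=
    exists_coefficients_chart hDw hDv (hv0 t ht x) hU hp hb hbmem
  obtain ⟨l, hl⟩ := lax t ht x
  rw [courant_eq I (HasFDerivAt.comp_inr hDu) (HasFDerivAt.comp_inr hDv)] at hl
  have key : courantJet (timeVec c - liftCLM (u t x)) Dw (liftCLM (v t x))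
      (liftCLM ∘L Dv) ∈ Submodule.span ℝ {liftCLM (v t x), timeVec c - liftCLM (u t x)} := by
    rw [courantJet_time_sub_lift (l := l) hDw' (huv t ht x) (fun X => ?_)
      (pairing_deriv_eq_zero hJ ht hDu hDv huv) ((hasDerivAt_of_chartRep hDv).unique hl)]
    · exact Submodule.smul_mem _ _ (Submodule.subset_span (by simp))
    · have := pairing_deriv_eq_zero hJ ht hDu hDu huu X
      rw [pairing_comm (u t x)] at this
      linarith
  rw [courant_eq _ hDa hDb, ha0, hb0]
  exact courantJet_mem (fun a ha b hb => pairing_eq_zero_of_mem_span (hvv t ht x) (huv t ht x)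
    (huu t ht x) ha hb) (Submodule.subset_span (by simp)) (Submodule.subset_span (by simp)) key
    _ _ _ _ _ _ _ _

/-- A Lax-type criterion: if `v' = [u, v]` modulo `v` and `v`, `u` satisfy the
indicated orthogonality relations, then `v` and `∂/∂t + c dt - u` span an isotropic
Courant-integrable subbundle over the product with the time axis. -/
theorem spanIsotropicIntegrable_of_lax {c : ℝ} {J : Set ℝ} (hJ : IsOpen J)
    {u v : ℝ → M → GenVec E} (hu : IsSmoothSectionFamilyOn I J u)
    (hv : IsSmoothSectionFamilyOn I J v)
    (hvv : ∀ t ∈ J, ∀ x, pairing (v t x) (v t x) = 0)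
    (huv : ∀ t ∈ J, ∀ x, pairing (u t x) (v t x) = 0)
    (huu : ∀ t ∈ J, ∀ x, pairing (u t x) (u t x) = -c)
    (hv0 : ∀ t ∈ J, ∀ x, v t x ≠ 0)
    (lax : ∀ t ∈ J, ∀ x, ∃ l : ℝ, HasDerivAt (fun s => v s x)
      (courant I (u t) (v t) x + l • v t x) t) :
    SpanIsotropicIntegrable (𝓘(ℝ, ℝ).prod I) (lift v) (fun p => timeSection c p - lift u p)
      (J ×ˢ (Set.univ : Set M)) where
  smooth_left := hv.lift hJ
  smooth_right := hu.time_sub_lift hJ c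
  rank_two := by
    rintro ⟨t, x⟩ ⟨ht, -⟩
    refine LinearIndependent.pair_iff.2 fun r s h0 => ?_
    have h1 : s = 0 := by
      have := congrArg (fun a => a.1.1) h0
      simpa [lift, timeSection] using this
    rw [h1, zero_smul, add_zero] at h0
    exact ⟨(smul_eq_zero.1 h0).resolve_right (liftCLM_ne_zero (hv0 t ht x)), h1⟩
  isotropic := by
    rintro ⟨t, x⟩ ⟨ht, -⟩ a ha b hb
    exact pairing_eq_zero_of_mem_span (hvv t ht x) (huv t ht x) (huu t ht x) ha hb
  integrable := isCourantIntegrableOn_of_lax hJ hu hv hvv huv huu hv0 lax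

end Integrability

/-! ### From the Nahm-type equations to a Lax equation -/

section CourantLinear

variable {E : Type*} [NormedAddCommGroup E] [NormedSpace ℝ E] {H : Type*} [TopologicalSpace H]
  {I : ModelWithCorners ℝ E H} [I.Boundaryless]
  {M : Type*} [TopologicalSpace M] [ChartedSpace H M] [IsManifold I ∞ M]

/-- The bracket `[p v₁ + q h + r v₂, p' v₁ + q' h + r' v₂]`, with constant coefficients. -/
lemma courant_combination {J : Set ℝ} (hJ : IsOpen J) {v₁ h v₂ : ℝ → M → GenVec E}
    (sv₁ : IsSmoothSectionFamilyOn I J v₁) (sh : IsSmoothSectionFamilyOn I J h)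
    (sv₂ : IsSmoothSectionFamilyOn I J v₂) {t : ℝ} (ht : t ∈ J) (x : M) (p q r p' q' r' : ℝ) :
    courant I (fun y => p • v₁ t y + q • h t y + r • v₂ t y)
      (fun y => p' • v₁ t y + q' • h t y + r' • v₂ t y) x =
      (q * p' - p * q') • courant I (h t) (v₁ t) x +
        (p * r' - r * p') • courant I (v₁ t) (v₂ t) x +
        (q * r' - r * q') • courant I (h t) (v₂ t) x := by
  obtain ⟨L₁, hL₁⟩ := sv₁.exists_hasFDerivAt hJ ht x
  obtain ⟨L, hL⟩ := sh.exists_hasFDerivAt hJ ht x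
  obtain ⟨L₂, hL₂⟩ := sv₂.exists_hasFDerivAt hJ ht x
  have d₁ := HasFDerivAt.comp_inr hL₁
  have d := HasFDerivAt.comp_inr hL
  have d₂ := HasFDerivAt.comp_inr hL₂
  have comb : ∀ p q r : ℝ, HasFDerivAt
      (chartRep I x (fun y => p • v₁ t y + q • h t y + r • v₂ t y))
      (p • (L₁ ∘L ContinuousLinearMap.inr ℝ ℝ E) + q • (L ∘L ContinuousLinearMap.inr ℝ ℝ E) +
        r • (L₂ ∘L ContinuousLinearMap.inr ℝ ℝ E)) (extChartAt I x x) := by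
    intro p q r
    refine (((d₁.const_smul p).add (d.const_smul q)).add
      (d₂.const_smul r)).congr_of_eventuallyEq (Filter.Eventually.of_forall fun y => ?_)
    simp only [chartRep, pullVec_add, pullVec_smul]
    rfl
  rw [courant_eq I (comb p q r) (comb p' q' r'), courant_eq I d d₁, courant_eq I d₁ d₂,
    courant_eq I d d₂]
  refine eq_of_pairing_eq fun e => ?_
  simp only [pairing_courantJet, pairing_add_left, pairing_add_right, pairing_smul_left,
    pairing_smul_right, add_apply, smul_apply, Prod.fst_add, Prod.smul_fst, map_add, map_smul,
    pairing_comm (v₁ t x), pairing_comm (h t x), pairing_comm (v₂ t x)]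
  ring

end CourantLinear

section NahmToLax

variable {M : Type*} [TopologicalSpace M] [ChartedSpace (EuclideanSpace ℝ (Fin 5)) M]
  [IsManifold (𝓡 5) ∞ M]

/-- The Nahm-type equations, together with the inner products of `v₁`, `h` and `v₂`, make the span
of `v = p v₁ + 2 q h + r v₂` and `∂/∂t - 2σ dt - u`, where `u = σ (a v₁ + b h + c v₂)`, isotropic
and Courant-integrable. The condition `hpqr` says that `v` is null, `h4` that `(u, u) = 2σ` and `h5`
that `(u, v) = 0`; `h1`, `h2`, `h3` compare the coefficients of `[h, v₁]`, `[v₁, v₂]` and `[h, v₂]`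
in `v'` and `[u, v]`. -/
lemma spanIsotropicIntegrable_of_nahm {σ : ℝ} (hσ : σ = 1 ∨ σ = -1) {J : Set ℝ} (hJ : IsOpen J)
    {v₁ h v₂ : ℝ → M → GenVec V5}
    (sv₁ : IsSmoothSectionFamilyOn (𝓡 5) J v₁) (sh : IsSmoothSectionFamilyOn (𝓡 5) J h)
    (sv₂ : IsSmoothSectionFamilyOn (𝓡 5) J v₂)
    (rel : ∀ t ∈ J, ∀ x, ∃ N α β, Relations σ N α β (v₁ t x) (h t x) (v₂ t x))
    (nahm : ∀ t ∈ J, ∀ x, ∃ l : ℝ, HasDerivAt (fun s => v₁ s x)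
        (-(2 * σ) • courant (𝓡 5) (h t) (v₁ t) x + l • v₁ t x) t ∧
      HasDerivAt (fun s => h s x) (σ • courant (𝓡 5) (v₁ t) (v₂ t) x + l • h t x) t ∧
      HasDerivAt (fun s => v₂ s x) ((2 * σ) • courant (𝓡 5) (h t) (v₂ t) x + l • v₂ t x) t)
    {p q r a b c : ℝ} (hpqr : q ^ 2 = p * r) (h0 : p ≠ 0 ∨ r ≠ 0)
    (h1 : b * p - 2 * a * q = -2 * p) (h2 : a * r - c * p = 2 * q)
    (h3 : b * r - 2 * c * q = 2 * r) (h4 : b ^ 2 - 4 * a * c = 4) (h5 : b * q = a * r + c * p)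
    {u v : ℝ → M → GenVec V5}
    (hv : ∀ t x, v t x = p • v₁ t x + (2 * q) • h t x + r • v₂ t x)
    (hu : ∀ t x, u t x = (σ * a) • v₁ t x + (σ * b) • h t x + (σ * c) • v₂ t x) :
    SpanIsotropicIntegrable (𝓘(ℝ, ℝ).prod (𝓡 5)) (lift v)
      (fun x => timeSection (-2 * σ) x - lift u x) (J ×ˢ (Set.univ : Set M)) := by
  obtain rfl : v = _ := funext₂ hv
  obtain rfl : u = _ := funext₂ hu
  have hσ2 : σ * σ = 1 := by rcases hσ with rfl | rfl <;> norm_num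
  have hσ0 : σ ≠ 0 := by rintro rfl; simp at hσ2
  have hp : ∀ t ∈ J, ∀ x, ∀ p q r p' q' r' : ℝ,
      pairing (p • v₁ t x + q • h t x + r • v₂ t x) (p' • v₁ t x + q' • h t x + r' • v₂ t x) =
        σ * (q * q' / 2 - p * r' - r * p') := by
    intro t ht x p q r p' q' r'
    obtain ⟨N, α, β, R⟩ := rel t ht x
    simp only [pairing_add_left, pairing_add_right, pairing_smul_left, pairing_smul_right,
      R.v₁v₁, R.v₂v₂, R.hv₁, R.hv₂, R.v₁v₂, R.hh, pairing_comm (v₁ t x) (h t x),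
      pairing_comm (v₂ t x) (h t x), pairing_comm (v₂ t x) (v₁ t x)]
    ring
  have sm : ∀ p q r : ℝ, IsSmoothSectionFamilyOn (𝓡 5) J
      fun t x => p • v₁ t x + q • h t x + r • v₂ t x := fun p q r =>
    ((sv₁.const_smul p).add (sh.const_smul q)).add (sv₂.const_smul r)
  refine spanIsotropicIntegrable_of_lax hJ (sm _ _ _) (sm _ _ _) ?_ ?_ ?_ ?_ ?_
  · intro t ht x
    rw [hp t ht x]
    linear_combination 2 * σ * hpqr
  · intro t ht x
    rw [hp t ht x]
    linear_combination (σ * σ) * h5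
  · intro t ht x
    rw [hp t ht x]
    linear_combination (σ * σ * σ / 2) * h4 + 2 * σ * hσ2
  · intro t ht x hz
    have e₁ := hp t ht x p (2 * q) r 0 0 1
    have e₂ := hp t ht x p (2 * q) r 1 0 0
    rw [hz, pairing_zero_left] at e₁ e₂
    rcases h0 with h0 | h0
    · exact mul_ne_zero hσ0 h0 (by linear_combination e₁)
    · exact mul_ne_zero hσ0 h0 (by linear_combination e₂)
  · intro t ht x
    obtain ⟨l, n₁, n, n₂⟩ := nahm t ht x
    refine ⟨l, ?_⟩
    refine (((n₁.const_smul p).add (n.const_smul (2 * q))).add (n₂.const_smul r)).congr_deriv ?_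
    rw [courant_combination hJ sv₁ sh sv₂ ht x]
    have k₁ : σ * b * p - σ * a * (2 * q) = p * -(2 * σ) := by linear_combination σ * h1
    have k₂ : σ * a * r - σ * c * p = 2 * q * σ := by linear_combination σ * h2
    have k₃ : σ * b * r - σ * c * (2 * q) = r * (2 * σ) := by linear_combination σ * h3
    rw [k₁, k₂, k₃]
    module

end NahmToLax

end GenGeom

end

open GenGeom in
theorem mainTheorem5
    {M : Type*} [TopologicalSpace M] [ChartedSpace (EuclideanSpace ℝ (Fin 5)) M]
    [IsManifold (𝓡 5) ∞ M]
    -- the orientation of `M`, given by a nowhere vanishing `5`-form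
    (μ : M → V5 [⋀^Fin 5]→L[ℝ] ℝ) (hμ : IsSmoothFormOn (𝓡 5) μ Set.univ) (hμ0 : ∀ x, μ x ≠ 0)
    -- the time interval
    (J : Set ℝ) (hJ : IsOpen J)
    -- the smooth family of even closed `ℝ²`-valued forms on `M`
    (ρ : ℝ → Fin 2 → M → MixedForm V5)
    (hsmooth : ∀ i, IsSmoothFamilyOn (𝓡 5) J (fun t => ρ t i))
    (heven : ∀ t ∈ J, ∀ i x, IsEven (ρ t i x))
    (hclosed : ∀ t ∈ J, ∀ i x k, mixedD (𝓡 5) (ρ t i) x k = 0)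
    -- it lies in an open orbit; `σ = 1`: `V` has signature `(2, 1)`, `σ = -1`: `(1, 2)`
    (σ : ℝ) (hσ : σ = 1 ∨ σ = -1)
    (hstable : ∀ t ∈ J, ∀ x, σ * quartic (μ x) (fun i => ρ t i x) < 0)
    -- the Hamiltonian flow `∂ρ/∂t = dρ̂`
    (ρhat : ℝ → Fin 2 → M → MixedForm V5)
    (hhat : ∀ t ∈ J, ∀ x, IsHat (μ x) (fun i => ρ t i x) (fun i => ρhat t i x))
    (hflow : ∀ t ∈ J, ∀ i x k,
      HasDerivAt (fun s => ρ s i x k) (mixedD (𝓡 5) (ρhat t i) x k) t)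
    -- the sections `v₁`, `h`, `v₂`
    (v₁ h v₂ : ℝ → M → GenVec V5)
    (hv₁ : v₁ = fun t x => vOne (μ x) (fun i => ρ t i x))
    (hh : h = fun t x => hMid (μ x) (fun i => ρ t i x))
    (hv₂ : v₂ = fun t x => vTwo (μ x) (fun i => ρ t i x)) :
    -- the Nahm-type equations
    (∃ lam : ℝ → M → ℝ, ∀ t ∈ J, ∀ x,
      HasDerivAt (fun s => v₁ s x)
        (-(2 * σ) • courant (𝓡 5) (h t) (v₁ t) x + lam t x • v₁ t x) t ∧
      HasDerivAt (fun s => h s x)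
        (σ • courant (𝓡 5) (v₁ t) (v₂ t) x + lam t x • h t x) t ∧
      HasDerivAt (fun s => v₂ s x)
        ((2 * σ) • courant (𝓡 5) (h t) (v₂ t) x + lam t x • v₂ t x) t) ∧
    -- `v(z) = v₁ + 2zh + z²v₂` and `w(z) = ∂/∂t - 2σdt - u(z)`, `u(z) = σ(z⁻¹v₁ - zv₂)`
    (∀ z : ℝ, z ≠ 0 →
      SpanIsotropicIntegrable (𝓘(ℝ, ℝ).prod (𝓡 5))
        (lift fun t x => v₁ t x + (2 * z) • h t x + z ^ 2 • v₂ t x)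
        (fun p => timeSection (-2 * σ) p
          - lift (fun t x => σ • (z⁻¹ • v₁ t x - z • v₂ t x)) p)
        (J ×ˢ (Set.univ : Set M))) ∧
    -- `z = 0`, with `u(z)` replaced by `u(z) - σz⁻¹v(z)`
    SpanIsotropicIntegrable (𝓘(ℝ, ℝ).prod (𝓡 5))
      (lift v₁)
      (fun p => timeSection (-2 * σ) p - lift (fun t x => (-(2 * σ)) • h t x) p)
      (J ×ˢ (Set.univ : Set M)) ∧
    -- `z = ∞`, with `u(z)` replaced by `u(z) + σz⁻¹v(z)`
    SpanIsotropicIntegrable (𝓘(ℝ, ℝ).prod (𝓡 5))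
      (lift v₂)
      (fun p => timeSection (-2 * σ) p - lift (fun t x => (2 * σ) • h t x) p)
      (J ×ˢ (Set.univ : Set M)) := by
  have nahm := fun t (ht : t ∈ J) x => nahm_of_flow hμ hμ0 hJ hsmooth heven hclosed hσ hstable hhat
    hflow hv₁ hh hv₂ ht x
  have hq : ∀ t ∈ J, ∀ x, quartic (μ x) (fun i => ρ t i x) ≠ 0 := fun t ht x h0 => by
    have := hstable t ht x
    simp [h0] at this
  have sv₁ : IsSmoothSectionFamilyOn (𝓡 5) J v₁ := by
    rw [hv₁]; exact isSmoothSectionFamilyOn_bilin hμ hμ0 hsmooth hq 0 0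
  have sh : IsSmoothSectionFamilyOn (𝓡 5) J h := by
    rw [hh]; exact isSmoothSectionFamilyOn_bilin hμ hμ0 hsmooth hq 0 1
  have sv₂ : IsSmoothSectionFamilyOn (𝓡 5) J v₂ := by
    rw [hv₂]; exact isSmoothSectionFamilyOn_bilin hμ hμ0 hsmooth hq 1 1
  have rel : ∀ t ∈ J, ∀ x, ∃ N α β, Relations σ N α β (v₁ t x) (h t x) (v₂ t x) :=
    fun t ht x => by
      rw [hv₁, hh, hv₂]
      exact ⟨_, _, _, relations (apply_e5_ne_zero (hμ0 x)) hσ (hstable t ht x)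
        fun i => heven t ht i x⟩
  have span := @spanIsotropicIntegrable_of_nahm M _ _ _ σ hσ J hJ v₁ h v₂ sv₁ sh sv₂ rel nahm
  -- `v(z)` is `v₁ + 2 z h + z² v₂` for finite `z` and `v₂` for `z = ∞`, and `u(z)` is given by
  -- `(a, b, c) = (z⁻¹, 0, -z)`; at `z = 0, ∞`, where `u(z)` has a pole, the coefficients are
  -- `(0, -2, 0)` and `(0, 2, 0)`, those of `u(z) ∓ σ z⁻¹ v(z)` in the limit
  refine ⟨?_, fun z hz => ?_, ?_, ?_⟩
  · classical
    refine ⟨fun t x => if ht : t ∈ J then (nahm t ht x).choose else 0, fun t ht x => ?_⟩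
    simp only [dif_pos ht]
    exact (nahm t ht x).choose_spec
  · exact span (p := 1) (q := z) (r := z ^ 2) (a := z⁻¹) (b := 0) (c := -z) (by ring)
      (Or.inl one_ne_zero) (by field_simp; ring) (by field_simp; ring) (by ring)
      (by field_simp; ring) (by field_simp; ring) (fun t x => by module) (fun t x => by module)
  · exact span (p := 1) (q := 0) (r := 0) (a := 0) (b := -2) (c := 0) (by ring)
      (Or.inl one_ne_zero) (by ring) (by ring) (by ring) (by ring) (by ring)
      (fun t x => by module) (fun t x => by module)
  · exact span (p := 0) (q := 0) (r := 1) (a := 0) (b := 2) (c := 0) (by ring)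
      (Or.inr one_ne_zero) (by ring) (by ring) (by ring) (by ring) (by ring)
      (fun t x => by module) (fun t x => by module)
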